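/- **Theorem 3.1 (Comparison).** Let $N\ge 1$ and let $\Omega\subset\mathbb R^N$ be open. Let $d$ be the signed distance from $\partial\Omega$ (positive in $\Omega$, negative outside $\bar\Omega$). *Domain (O).* $\Omega$ is of class $W^{2,\infty}$: for every $\hat s\in\partial\Omega$ there are $r>0$ and a $W^{2,\infty}$-diffeomorphism $\psi$ of the ball $B_r(\hat s)$ onto an open subset of $\mathbb R^N$ ($\psi$ and $\psi^{-1}$ are bounded and $C^1$ with bounded Lipschitz derivatives) with $\psi_N=d$ on $B_r(\hat s)$. Let $n=-Dd$ on $\partial\Omega$ be the exterior unit normal. *Operator.* For $x\in\bar\Omega$ let $\mu_x$ be a nonnegative measure on $\mathbb R^N$ with density $\frac{d\mu_x}{dz}\ge 0$ with respect to Lebesgue measure, let $j(x,\cdot):\mathbb R^N\to\mathbb R^N$, and assume: - (M) there are $\sigma\in(0,1)$ and $C_\mu,D_\mu>0$ such that for all $x,y\in\bar\Omega$, $z\ne0$: $\frac{d\mu_x}{dz}(z)\le C_\mu|z|^{-(N+\sigma)}$ and $\left|\frac{d\mu_x}{dz}(z)-\frac{d\mu_y}{dz}(z)\right|\le D_\mu|x-y||z|^{-(N+\sigma)}$;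 - (J0) for every $x\in\bar\Omega$, $j(x,\cdot)$ is a $C^1$ bijection of $\mathbb R^N$ whose inverse $j^{-1}(x,\cdot)$ is $C^1$, and $|Dj^{-1}(x,\cdot)|\le A_j$ for a constant $A_j$ independent of $x$; - (J1) there are $\tilde C_j,C_j,D_j>0$ such that for all $x,y\in\bar\Omega$, $z\in\mathbb R^N$: $\tilde C_j|z|\le|j(x,z)|\le C_j|z|$ and $|j(x,z)-j(y,z)|\le D_j|z||x-y|$. The censored operator is $\mathcal I[w](x)=\mathrm{P.V.}\int_{x+j(x,z)\in\bar\Omega}[w(x+j(x,z))-w(x)]\,d\mu_x(z)$. For $\xi>0$, $\mathcal I_\xi[w](x)$ and $\mathcal I^\xi[w](x)$ denote the same integral restricted to $|z|<\xi$ and to $|z|\ge\xi$, respectively. *Hamiltonian.* Let $H:\bar\Omega\times\mathbb R^N\to\mathbb R$ be continuous. A modulus of continuity is a function $\omega:[0,\infty)\to[0,\infty)$ with $\omega(0)=0$ that is continuous at $0$. Assume one of the following. 1. (Bellman type) $H(x,p)=\sup_{\alpha\in\mathcal A}\{-b(x,\alpha)\cdot p-l(x,\alpha)\}$, where $\mathcal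 A$ is a nonempty compact metric space and $b:\bar\Omega\times\mathcal A\to\mathbb R^N$, $l:\bar\Omega\times\mathcal A\to\mathbb R$ are bounded and continuous, and - (C) $|l(x,\alpha)-l(y,\alpha)|\le\omega_l(|x-y|)$ for all $\alpha\in\mathcal A$, $x,y\in\bar\Omega$, with a modulus of continuity $\omega_l$; - (L) $|b(x,\alpha)-b(y,\alpha)|\le C|x-y|$ for all $\alpha\in\mathcal A$, $x,y\in\bar\Omega$, with a constant $C>0$; - (B) $\Gamma_{\rm in}\cup\Gamma_{\rm out}\cup\Gamma=\partial\Omega$, and each of the three sets is a union of connected components of $\partial\Omega$, where $\Gamma_{\rm in}$ (resp. $\Gamma_{\rm out}$) is the set of $x\in\partial\Omega$ with $b(x,\alpha)\cdot n(x)<0$ (resp. $>0$) for all $\alpha\in\mathcal A$, and $\Gamma$ is the set of $x\in\partial\Omega$ for which there are $\alpha_1,\alpha_2\in\mathcal A$ with $b(x,\alpha_1)\cdot n(x)<0<b(x,\alpha_2)\cdot n(x)$. 2. (Coercive) $H$ satisfies (H1) and (Ha), or (H1), (Hb) and (Hc), where - (H1) there are $m>\sigma$, $c_0>0$, $D>0$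 with $H(x,p)\ge c_0|p|^m-D$ for all $x\in\bar\Omega$, $p\in\mathbb R^N$; - (Ha) there are $C>0$ and a modulus of continuity $\omega_1$ with $H(y,p)-H(x,q)\le\omega_1(|x-y|)(1+|p|)+C|p-q|$ for all $x,y\in\bar\Omega$, $p,q\in\mathbb R^N$; - (Hb) there are $m>1$ and $A,\bar C>0$ with $H(x,p)-\mu H(x,\mu^{-1}p)\le(1-\mu)\left(\bar C(1-m)|p|^m+A\right)$ for all $\mu\in(0,1)$, $x\in\bar\Omega$, $p\in\mathbb R^N$; - (Hc) with $m$ as in (Hb), there are $C>0$ and a modulus of continuity $\omega_1$ with $H(y,p)-H(x,q)\le\omega_1(|x-y|)(1+|p|^m\vee|q|^m)+C|p-q|(|p|^{m-1}\vee|q|^{m-1})$ for all $x,y\in\bar\Omega$, $p,q\in\mathbb R^N$. *Viscosity sub- and supersolutions.* Consider the problem $$u-\mathcal I[u]+H(x,Du)=0\ \text{ in }\Omega,\qquad \frac{\partial u}{\partial n}=0\ \text{ on }\partial\Omega,$$ and put $F_\xi[w,\phi](x)=w(x)-\mathcal I_\xi[\phi](x)-\mathcal I^\xi[w](x)+H(x,D\phi(x))$.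 A bounded usc function $u$ on $\bar\Omega$ is a viscosity subsolution if for every $\phi\in C^1(\mathbb R^N)$, $\xi>0$ and $x\in\bar\Omega$ such that $u-\phi$ attains its maximum over $\bar B_{C_j\xi}(x)\cap\bar\Omega$ at $x$, one has $F_\xi[u,\phi](x)\le0$ if $x\in\Omega$ and $\min\{F_\xi[u,\phi](x),\frac{\partial\phi}{\partial n}(x)\}\le0$ if $x\in\partial\Omega$. A bounded lsc function $v$ on $\bar\Omega$ is a viscosity supersolution if for every $\phi\in C^1(\mathbb R^N)$, $\xi>0$ and $x\in\bar\Omega$ such that $v-\phi$ attains its minimum over $\bar B_{C_j\xi}(x)\cap\bar\Omega$ at $x$, one has $F_\xi[v,\phi](x)\ge0$ if $x\in\Omega$ and $\max\{F_\xi[v,\phi](x),\frac{\partial\phi}{\partial n}(x)\}\ge0$ if $x\in\partial\Omega$. *Conclusion.* If $u$ is a bounded usc viscosity subsolution and $v$ a bounded lsc viscosity supersolution of this problem, then $u\le v$ on $\bar\Omega$. -/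

import Mathlib

open Set Filter Topology MeasureTheory
open scoped NNReal

universe u

namespace CensoredNeumann

/-- The Euclidean space `ℝᴺ`. -/
abbrev Space (N : ℕ) : Type := EuclideanSpace ℝ (Fin N)

variable {N : ℕ}

/-! ### The domain -/

open Classical in
/-- Signed distance from the boundary of `Ω`: positive in `Ω`, negative outside `closure Ω`. -/
noncomputable def signedDistBdry (Ω : Set (Space N)) (x : Space N) : ℝ :=
  if x ∈ Ω then Metric.infDist x (frontier Ω) else - Metric.infDist x (frontier Ω)

/-- `f` is bounded on `U`, of class `C¹` with bounded derivative, and its derivative is Lipschitz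
on `U`. On a ball this is exactly `f ∈ W^{2,∞}`. -/
def IsW2Infty (f : Space N → Space N) (U : Set (Space N)) : Prop :=
  ContDiffOn ℝ 1 f U ∧
  (∃ K : ℝ, ∀ x ∈ U, ‖f x‖ ≤ K ∧ ‖fderiv ℝ f x‖ ≤ K) ∧
  (∃ L : ℝ≥0, LipschitzOnWith L (fderiv ℝ f) U)

/-- Assumption (O): near every boundary point there is a `W^{2,∞}`-diffeomorphism `ψ` from a ball
onto an open subset of `ℝᴺ`, whose last coordinate is the signed distance from the boundary. -/
def DomainClassW2Infty (Ω : Set (Space N)) : Prop :=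
  ∀ s₀ ∈ frontier Ω, ∃ r : ℝ, 0 < r ∧ ∃ ψ : OpenPartialHomeomorph (Space N) (Space N),
    ψ.source = Metric.ball s₀ r ∧
    IsW2Infty ψ ψ.source ∧ IsW2Infty ψ.symm ψ.target ∧
    ∀ s ∈ Metric.ball s₀ r, ∀ i : Fin N, (i : ℕ) + 1 = N → ψ s i = signedDistBdry Ω s

/-- The exterior unit normal `n(x) = - D d(x)`, for `x` on the boundary. -/
noncomputable def outerNormal (Ω : Set (Space N)) (x : Space N) : Space N :=
  - gradient (signedDistBdry Ω) x

/-- The normal derivative `∂φ/∂n (x)`. -/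
noncomputable def normalDeriv (Ω : Set (Space N)) (φ : Space N → ℝ) (x : Space N) : ℝ :=
  inner ℝ (gradient φ x) (outerNormal Ω x)

/-! ### The censored operator -/

/-- Assumption (M), with order `σ ∈ (0,1)`: the nonnegative measures `μ x`, `x ∈ closure Ω`, have
densities `ρ x` with respect to Lebesgue measure, with the stated bound and Lipschitz estimate. -/
def AssumptionM (Ω : Set (Space N)) (μ : Space N → Measure (Space N)) (σ : ℝ) : Prop :=
  0 < σ ∧ σ < 1 ∧
  ∃ ρ : Space N → Space N → ℝ,
    (∀ x ∈ closure Ω, Measurable (ρ x) ∧ (∀ z, 0 ≤ ρ x z) ∧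
      μ x = (volume : Measure (Space N)).withDensity (fun z => ENNReal.ofReal (ρ x z))) ∧
    ∃ Cμ : ℝ, 0 < Cμ ∧ ∃ Dμ : ℝ, 0 < Dμ ∧
      ∀ x ∈ closure Ω, ∀ y ∈ closure Ω, ∀ z : Space N, z ≠ 0 →
        ρ x z ≤ Cμ * ‖z‖ ^ (-((N : ℝ) + σ)) ∧
        |ρ x z - ρ y z| ≤ Dμ * ‖x - y‖ * ‖z‖ ^ (-((N : ℝ) + σ))

/-- Assumption (J0). -/
def AssumptionJ0 (Ω : Set (Space N)) (j : Space N → Space N → Space N) : Prop :=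
  ∃ Aj : ℝ, ∀ x ∈ closure Ω, ContDiff ℝ 1 (j x) ∧
    ∃ g : Space N → Space N, Function.LeftInverse g (j x) ∧ Function.RightInverse g (j x) ∧
      ContDiff ℝ 1 g ∧ ∀ w, ‖fderiv ℝ g w‖ ≤ Aj

/-- Assumption (J1), with the upper constant `Cj`. -/
def AssumptionJ1 (Ω : Set (Space N)) (j : Space N → Space N → Space N) (Cj : ℝ) : Prop :=
  0 < Cj ∧ ∃ cj : ℝ, 0 < cj ∧ ∃ Dj : ℝ, 0 < Dj ∧
    ∀ x ∈ closure Ω, ∀ y ∈ closure Ω, ∀ z : Space N,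
      cj * ‖z‖ ≤ ‖j x z‖ ∧ ‖j x z‖ ≤ Cj * ‖z‖ ∧ ‖j x z - j y z‖ ≤ Dj * ‖z‖ * ‖x - y‖

/-- `𝓘_ξ[φ](x)`: the part of the censored operator over `|z| < ξ`. For `φ` of class `C¹` the
integral converges absolutely under (M) and (J1), so it equals its principal value. -/
noncomputable def innerPart (Ω : Set (Space N)) (μ : Space N → Measure (Space N))
    (j : Space N → Space N → Space N) (ξ : ℝ) (φ : Space N → ℝ) (x : Space N) : ℝ :=
  ∫ z in {z : Space N | ‖z‖ < ξ ∧ x + j x z ∈ closure Ω}, (φ (x + j x z) - φ x) ∂(μ x)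

/-- `𝓘^ξ[w](x)`: the part of the censored operator over `|z| ≥ ξ`. -/
noncomputable def outerPart (Ω : Set (Space N)) (μ : Space N → Measure (Space N))
    (j : Space N → Space N → Space N) (ξ : ℝ) (w : Space N → ℝ) (x : Space N) : ℝ :=
  ∫ z in {z : Space N | ξ ≤ ‖z‖ ∧ x + j x z ∈ closure Ω}, (w (x + j x z) - w x) ∂(μ x)

/-! ### The Hamiltonian -/

/-- A modulus of continuity: `ω ≥ 0` on `[0,∞)`, `ω 0 = 0`, `ω` continuous at `0`. -/
def IsModulus (ω : ℝ → ℝ) : Prop :=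
  ω 0 = 0 ∧ (∀ t, 0 ≤ t → 0 ≤ ω t) ∧ Tendsto ω (𝓝[≥] 0) (𝓝 0)

/-- `Γ_in`. -/
def GammaIn (Ω : Set (Space N)) {A : Type u} (b : Space N → A → Space N) : Set (Space N) :=
  {x | x ∈ frontier Ω ∧ ∀ α, inner ℝ (b x α) (outerNormal Ω x) < 0}

/-- `Γ_out`. -/
def GammaOut (Ω : Set (Space N)) {A : Type u} (b : Space N → A → Space N) : Set (Space N) :=
  {x | x ∈ frontier Ω ∧ ∀ α, 0 < inner ℝ (b x α) (outerNormal Ω x)}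

/-- `Γ`. -/
def GammaMixed (Ω : Set (Space N)) {A : Type u} (b : Space N → A → Space N) : Set (Space N) :=
  {x | x ∈ frontier Ω ∧ ∃ α₁ α₂, inner ℝ (b x α₁) (outerNormal Ω x) < 0 ∧
    0 < inner ℝ (b x α₂) (outerNormal Ω x)}

/-- `S` is a union of connected components of `F`. -/
def IsUnionOfComponents (S F : Set (Space N)) : Prop :=
  ∃ T ⊆ F, S = ⋃ x ∈ T, connectedComponentIn F x

/-- Assumption (B). -/
def AssumptionB (Ω : Set (Space N)) {A : Type u} (b : Space N → A → Space N) : Prop :=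
  GammaIn Ω b ∪ GammaOut Ω b ∪ GammaMixed Ω b = frontier Ω ∧
  IsUnionOfComponents (GammaIn Ω b) (frontier Ω) ∧
  IsUnionOfComponents (GammaOut Ω b) (frontier Ω) ∧
  IsUnionOfComponents (GammaMixed Ω b) (frontier Ω)

/-- Assumption (C) on the cost. -/
def AssumptionC (Ω : Set (Space N)) {A : Type u} (l : Space N → A → ℝ) : Prop :=
  ∃ ω : ℝ → ℝ, IsModulus ω ∧
    ∀ α, ∀ x ∈ closure Ω, ∀ y ∈ closure Ω, |l x α - l y α| ≤ ω ‖x - y‖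

/-- Assumption (L) on the drift. -/
def AssumptionL (Ω : Set (Space N)) {A : Type u} (b : Space N → A → Space N) : Prop :=
  ∃ C : ℝ, 0 < C ∧ ∀ α, ∀ x ∈ closure Ω, ∀ y ∈ closure Ω, ‖b x α - b y α‖ ≤ C * ‖x - y‖

/-- `H` is of Bellman type, `H(x,p) = sup_α {-b(x,α)·p - l(x,α)}`, over a compact metric control
space, with continuous bounded drift `b` and cost `l` satisfying (C), (L), (B). -/
def IsBellman (Ω : Set (Space N)) (H : Space N → Space N → ℝ) : Prop :=
  ∃ (A : Type u) (_ : MetricSpace A) (_ : CompactSpace A) (_ : Nonempty A)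
    (b : Space N → A → Space N) (l : Space N → A → ℝ),
    ContinuousOn (Function.uncurry b) (closure Ω ×ˢ univ) ∧
    ContinuousOn (Function.uncurry l) (closure Ω ×ˢ univ) ∧
    (∃ K : ℝ, ∀ x ∈ closure Ω, ∀ α, ‖b x α‖ ≤ K ∧ |l x α| ≤ K) ∧
    (∀ x ∈ closure Ω, ∀ p, IsLUB (range fun α => - inner ℝ (b x α) p - l x α) (H x p)) ∧
    AssumptionC Ω l ∧ AssumptionL Ω b ∧ AssumptionB Ω b

/-- Assumption (H1): superfractional coercivity. -/
def AssumptionH1 (Ω : Set (Space N)) (H : Space N → Space N → ℝ) (σ : ℝ) : Prop :=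
  ∃ m : ℝ, σ < m ∧ ∃ c₀ : ℝ, 0 < c₀ ∧ ∃ D : ℝ, 0 < D ∧
    ∀ x ∈ closure Ω, ∀ p, c₀ * ‖p‖ ^ m - D ≤ H x p

/-- Assumption (Ha). -/
def AssumptionHa (Ω : Set (Space N)) (H : Space N → Space N → ℝ) : Prop :=
  ∃ C : ℝ, 0 < C ∧ ∃ ω : ℝ → ℝ, IsModulus ω ∧
    ∀ x ∈ closure Ω, ∀ y ∈ closure Ω, ∀ p q,
      H y p - H x q ≤ ω ‖x - y‖ * (1 + ‖p‖) + C * ‖p - q‖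

/-- Assumption (Hb), with exponent `m > 1`. -/
def AssumptionHb (Ω : Set (Space N)) (H : Space N → Space N → ℝ) (m : ℝ) : Prop :=
  1 < m ∧ ∃ A : ℝ, 0 < A ∧ ∃ C : ℝ, 0 < C ∧
    ∀ θ : ℝ, 0 < θ → θ < 1 → ∀ x ∈ closure Ω, ∀ p,
      H x p - θ * H x (θ⁻¹ • p) ≤ (1 - θ) * (C * (1 - m) * ‖p‖ ^ m + A)

/-- Assumption (Hc), with the exponent `m` of (Hb). -/
def AssumptionHc (Ω : Set (Space N)) (H : Space N → Space N → ℝ) (m : ℝ) : Prop :=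
  ∃ C : ℝ, 0 < C ∧ ∃ ω : ℝ → ℝ, IsModulus ω ∧
    ∀ x ∈ closure Ω, ∀ y ∈ closure Ω, ∀ p q,
      H y p - H x q ≤ ω ‖x - y‖ * (1 + max (‖p‖ ^ m) (‖q‖ ^ m))
        + C * ‖p - q‖ * max (‖p‖ ^ (m - 1)) (‖q‖ ^ (m - 1))

/-! ### Viscosity sub- and supersolutions -/

/-- `F(x, w(x), Dφ(x), 𝓘_ξ[φ] + 𝓘^ξ[w])` with `F = w - 𝓘 + H(x, Dφ)`. -/
noncomputable def testF (Ω : Set (Space N)) (μ : Space N → Measure (Space N))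
    (j : Space N → Space N → Space N) (H : Space N → Space N → ℝ)
    (ξ : ℝ) (φ w : Space N → ℝ) (x : Space N) : ℝ :=
  w x - (innerPart Ω μ j ξ φ x + outerPart Ω μ j ξ w x) + H x (gradient φ x)

/-- `w` is bounded on `closure Ω`. -/
def BoundedOnClosure (Ω : Set (Space N)) (w : Space N → ℝ) : Prop :=
  ∃ K : ℝ, ∀ x ∈ closure Ω, |w x| ≤ K

/-- Bounded usc viscosity subsolutions of `u - 𝓘[u] + H(x,Du) = 0` in `Ω`, `∂u/∂n = 0` on `∂Ω`
(generalized boundary condition); `Cj` is the constant of (J1). -/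
def IsViscositySubsolution (Ω : Set (Space N)) (μ : Space N → Measure (Space N))
    (j : Space N → Space N → Space N) (Cj : ℝ) (H : Space N → Space N → ℝ)
    (u : Space N → ℝ) : Prop :=
  BoundedOnClosure Ω u ∧ UpperSemicontinuousOn u (closure Ω) ∧
  ∀ φ : Space N → ℝ, ContDiff ℝ 1 φ → ∀ ξ : ℝ, 0 < ξ → ∀ x ∈ closure Ω,
    IsMaxOn (fun y => u y - φ y) (Metric.closedBall x (Cj * ξ) ∩ closure Ω) x →
      (x ∈ Ω → testF Ω μ j H ξ φ u x ≤ 0) ∧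
      (x ∈ frontier Ω → min (testF Ω μ j H ξ φ u x) (normalDeriv Ω φ x) ≤ 0)

/-- Bounded lsc viscosity supersolutions of the same problem. -/
def IsViscositySupersolution (Ω : Set (Space N)) (μ : Space N → Measure (Space N))
    (j : Space N → Space N → Space N) (Cj : ℝ) (H : Space N → Space N → ℝ)
    (v : Space N → ℝ) : Prop :=
  BoundedOnClosure Ω v ∧ LowerSemicontinuousOn v (closure Ω) ∧
  ∀ φ : Space N → ℝ, ContDiff ℝ 1 φ → ∀ ξ : ℝ, 0 < ξ → ∀ x ∈ closure Ω,
    IsMinOn (fun y => v y - φ y) (Metric.closedBall x (Cj * ξ) ∩ closure Ω) x →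
      (x ∈ Ω → 0 ≤ testF Ω μ j H ξ φ v x) ∧
      (x ∈ frontier Ω → 0 ≤ max (testF Ω μ j H ξ φ v x) (normalDeriv Ω φ x))

end CensoredNeumann

open CensoredNeumann

namespace CensoredNeumann

/-! ### The singular kernel -/

/-! Suppose `u - v` takes a value `m > 0` on `closure Ω`. Variables are doubled: `u x - v y -
φₙ(x,y) - G x - G y` is maximized, where `φₙ` is a penalization with slope of order `n` and `G` is a
localizer of slope `l`. Subtracting the two viscosity inequalities at the maximum points must give a
contradiction, with `l` fixed small first and `n → ∞` afterwards. Since `σ < 1`, slope `n` costs the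
nonlocal operator only `n^σ`, and no second-order information is needed. Three points carry the
argument.

Boundary condition. The localizer is tilted by a term `-τ arctan(d/τ)`, which makes its normal
derivative at least `2l`. The penalizations have normal derivative at least `-l`, because `∇d` is
Lipschitz and `d ≥ 0` on `closure Ω` with equality on the boundary. So the Neumann alternative is
never the active one, and the equation holds up to the boundary (`exists_localized_doubling`,
`eventually_outerPart_le`).

Censoring. Jumps admissible from only one of `x`, `y` are not compared by the maximum property; for
them only one-sided increments bounded by `min(n|z|,1)` are available (`eventually_incr_le`). Such a
jump lands in a strip around the boundary of width `|d x - d y| + O(|z||x-y|)`, and in a flattening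
chart the volume of a strip is proportional to its width. The bad contribution therefore vanishes as
soon as `n|x-y| → 0` and `|d x - d y|` is below a scale much smaller than `1/n`
(`tendsto_integral_mismatch`). What remains is `m/4 ≤ H(y,·) - H(x,·) + C l^σ`
(`eventually_gap_le`).

Closeness of the distances. This comes from the equation, which bounds the Hamiltonian at a maximum
point by `C n^σ` (`eventually_hamiltonian_le`). For coercive `H`, the penalization is `n|x-y|`
smoothed at a scale `τₙ`. If `|x-y| > τₙ`, its gradient has size at least `n/2`, and growth `|p|^m`
with `m > σ` is contradictory. Hence `|x-y| ≤ τₙ`, where `τₙ` may depend on `n` in any way, so it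
also defeats the modulus of continuity of `H` (`not_gap_of_coercive`). For Bellman `H`, the
penalization is `n²|x-y|² + n|d x - d y|`, the second term smoothed. If `|d x - d y| > τₙ`, the
gradient has a component of size at least `n/2` along `∇d` and a remainder `o(n)`. The sign
condition on the drift then makes `H` of order `n` at `x`, against the subsolution, or of order `-n`
at `y`, against the supersolution (`isDominated_of_bellman`, `not_gap_of_isDominated`).

Under (Hb) and (Hc), `u` is first replaced by `(1-η)u`; the gain `-κ|p|^m` from (Hb) absorbs the
superlinear error of (Hc) (`le_of_coercive_of_convex`). -/

/-- The kernel `|z|^{-(N+σ)}`. -/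
noncomputable def kernel (N : ℕ) (σ : ℝ) (z : Space N) : ℝ := ‖z‖ ^ (-((N : ℝ) + σ))

lemma kernel_nonneg {N : ℕ} (σ : ℝ) (z : Space N) : 0 ≤ kernel N σ z :=
  Real.rpow_nonneg (norm_nonneg _) _

lemma measurable_kernel {N : ℕ} (σ : ℝ) : Measurable (kernel N σ) := by
  unfold kernel; fun_prop

/-- The truncated linear weight `min(a|z|, 1)`. -/
noncomputable def weight {N : ℕ} (a : ℝ) (z : Space N) : ℝ := min (a * ‖z‖) 1

lemma weight_nonneg {N : ℕ} {a : ℝ} (ha : 0 ≤ a) (z : Space N) : 0 ≤ weight a z :=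
  le_min (by positivity) zero_le_one

lemma weight_le_one {N : ℕ} (a : ℝ) (z : Space N) : weight a z ≤ 1 := min_le_right _ _

lemma weight_le_mul {N : ℕ} (a : ℝ) (z : Space N) : weight a z ≤ a * ‖z‖ := min_le_left _ _

lemma measurable_weight {N : ℕ} (a : ℝ) : Measurable (weight (N := N) a) := by
  unfold weight; fun_prop

lemma le_mul_weight {N : ℕ} {a B t : ℝ} {z : Space N} (h1 : t ≤ B * (a * ‖z‖)) (h2 : t ≤ B) :
    t ≤ B * weight a z := by
  unfold weight
  rcases le_total (a * ‖z‖) 1 with h | h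
  · rwa [min_eq_left h]
  · rw [min_eq_right h]; linarith

/-- In polar coordinates the integrand is `y^(-σ)` on `(0,1]` and `y^(-1-σ)` beyond: `σ < 1` gives
integrability at the origin and `σ > 0` at infinity. -/
lemma integrable_weight_one_mul_kernel {N : ℕ} (hN : 0 < N) {σ : ℝ} (h0 : 0 < σ) (h1 : σ < 1) :
    Integrable (fun z : Space N => weight 1 z * kernel N σ z) := by
  have : Nonempty (Fin N) := ⟨⟨0, hN⟩⟩
  have : Nontrivial (Space N) := inferInstance
  have key := integrable_fun_norm_addHaar (volume : Measure (Space N))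
    (f := fun y : ℝ => min (1 * y) 1 * y ^ (-((N : ℝ) + σ)))
  refine key.2 ?_
  rw [finrank_euclideanSpace_fin, ← Ioc_union_Ioi_eq_Ioi (zero_le_one' ℝ)]
  have hpow : ∀ y : ℝ, 0 < y → y ^ (N - 1) * y ^ (-((N : ℝ) + σ)) = y ^ (-1 - σ) := by
    intro y hy
    rw [← Real.rpow_natCast, ← Real.rpow_add hy, Nat.cast_sub hN]
    congr 1; push_cast; ring
  refine IntegrableOn.union ?_ ?_
  · have h : IntegrableOn (fun y : ℝ => y ^ (-σ)) (Ioc 0 1) := by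
      rw [← intervalIntegrable_iff_integrableOn_Ioc_of_le zero_le_one]
      exact intervalIntegral.intervalIntegrable_rpow' (by linarith)
    refine h.congr_fun (fun y hy => ?_) measurableSet_Ioc
    have e : -σ = 1 + (-1 - σ) := by ring
    simp only [one_mul, min_eq_left hy.2, smul_eq_mul]
    rw [mul_left_comm, hpow y hy.1, e, Real.rpow_add hy.1, Real.rpow_one]
  · have h : IntegrableOn (fun y : ℝ => y ^ (-1 - σ)) (Ioi 1) :=
      integrableOn_Ioi_rpow_of_lt (by linarith) zero_lt_one
    refine h.congr_fun (fun y hy => ?_) measurableSet_Ioi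
    have hy' : (1:ℝ) < y := hy
    simp only [one_mul, min_eq_right hy'.le, smul_eq_mul]
    rw [hpow y (by linarith)]

lemma weight_mul_kernel_eq {N : ℕ} {σ : ℝ} {a : ℝ} (ha : 0 < a) (z : Space N) :
    weight a z * kernel N σ z =
      a ^ ((N : ℝ) + σ) * (weight 1 (a • z) * kernel N σ (a • z)) := by
  unfold weight kernel
  rw [norm_smul, Real.norm_of_nonneg ha.le, Real.mul_rpow ha.le (norm_nonneg _), one_mul,
    mul_left_comm (a ^ _), ← mul_assoc (a ^ _), ← Real.rpow_add ha]
  simp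

lemma integrable_weight_mul_kernel {N : ℕ} (hN : 0 < N) {σ : ℝ} (h0 : 0 < σ) (h1 : σ < 1)
    {a : ℝ} (ha : 0 < a) : Integrable (fun z : Space N => weight a z * kernel N σ z) := by
  simp_rw [weight_mul_kernel_eq ha]
  refine Integrable.const_mul ?_ _
  exact (integrable_comp_smul_iff volume (fun z : Space N => weight 1 z * kernel N σ z) ha.ne').2
    (integrable_weight_one_mul_kernel hN h0 h1)

/-- The mass `∫ min(|z|,1) |z|^{-(N+σ)} dz`. -/
noncomputable def kernelMass (N : ℕ) (σ : ℝ) : ℝ := ∫ z : Space N, weight 1 z * kernel N σ z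

lemma kernelMass_nonneg (N : ℕ) (σ : ℝ) : 0 ≤ kernelMass N σ :=
  integral_nonneg fun z => mul_nonneg (weight_nonneg zero_le_one z) (kernel_nonneg σ z)

/-- Dilation by `a`: the homogeneity of the kernel contributes `a^(N+σ)` and the change of variables
`a^(-N)`. This exact power is what makes a slope `n` cost `n^σ` and a vanishing slope cost nothing
in the limit. -/
lemma integral_weight_mul_kernel {N : ℕ} {σ : ℝ} {a : ℝ} (ha : 0 < a) :
    ∫ z : Space N, weight a z * kernel N σ z = a ^ σ * kernelMass N σ := by
  simp_rw [weight_mul_kernel_eq ha]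
  rw [integral_const_mul,
    Measure.integral_comp_smul volume (fun z : Space N => weight 1 z * kernel N σ z) a,
    finrank_euclideanSpace_fin, abs_of_nonneg (by positivity), smul_eq_mul, ← mul_assoc,
    Real.rpow_add ha, Real.rpow_natCast]
  have : (a ^ N : ℝ) ≠ 0 := by positivity
  field_simp
  rfl

/-- Integrals of the kernel against `|z|` near the origin. -/
lemma integrableOn_norm_mul_kernel_and_le {N : ℕ} (hN : 0 < N) {σ : ℝ} (h0 : 0 < σ) (h1 : σ < 1)
    {ρ : ℝ} (hρ : 0 < ρ) :
    IntegrableOn (fun z : Space N => ‖z‖ * kernel N σ z) {z | ‖z‖ < ρ} ∧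
    ∫ z in {z : Space N | ‖z‖ < ρ}, ‖z‖ * kernel N σ z ≤ ρ ^ (1 - σ) * kernelMass N σ := by
  have hm : MeasurableSet {z : Space N | ‖z‖ < ρ} := measurableSet_lt (by fun_prop) (by fun_prop)
  have hi := (integrable_weight_mul_kernel (N := N) hN h0 h1 (inv_pos.2 hρ)).const_mul ρ
  have heq : ∀ z ∈ {z : Space N | ‖z‖ < ρ},
      ρ * (weight ρ⁻¹ z * kernel N σ z) = ‖z‖ * kernel N σ z := by
    intro z hz
    have : ρ⁻¹ * ‖z‖ ≤ 1 := by
      rw [inv_mul_le_iff₀ hρ]; simpa using (show ‖z‖ < ρ from hz).le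
    unfold weight
    rw [min_eq_left this]; field_simp
  refine ⟨hi.integrableOn.congr_fun heq hm, ?_⟩
  rw [← setIntegral_congr_fun hm heq]
  calc _ ≤ ∫ z : Space N, ρ * (weight ρ⁻¹ z * kernel N σ z) :=
        setIntegral_le_integral hi (Eventually.of_forall fun z => mul_nonneg hρ.le
          (mul_nonneg (weight_nonneg (by positivity) z) (kernel_nonneg σ z)))
    _ = _ := by
        rw [integral_const_mul, integral_weight_mul_kernel (inv_pos.2 hρ), Real.rpow_sub hρ,
          Real.inv_rpow hρ.le, Real.rpow_one]
        ring

/-- A set occupying at most the fraction `B` of every small ball has mass at most a multiple of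
`B` for the measures `|z|^{γ-N} dz`. -/
lemma lintegral_rpow_le_of_volume_le {N : ℕ} {γ δ : ℝ} (hγ : 0 < γ) (hγN : γ ≤ N)
    (hδ : 0 < δ) :
    ∃ C : ℝ, 0 ≤ C ∧ ∀ (A : Set (Space N)) (B : ℝ), 0 ≤ B → MeasurableSet A →
      (∀ s, 0 < s → s ≤ δ → volume (A ∩ Metric.closedBall 0 s) ≤ ENNReal.ofReal (B * s ^ N)) →
      ∫⁻ z in A ∩ {z | ‖z‖ < δ ∧ z ≠ 0}, ENNReal.ofReal (‖z‖ ^ (γ - N)) ≤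
        ENNReal.ofReal (C * B) := by
  -- Ratio of the geometric series over the dyadic annuli `T k`: the integrand contributes
  -- `2^(-k(γ-N))` and the volume bound `2^(-kN)`.
  set q : ℝ := 2⁻¹ ^ γ with hq
  have hq0 : 0 < q := by positivity
  have hq1 : q < 1 := Real.rpow_lt_one (by norm_num) (by norm_num) hγ
  refine ⟨2⁻¹ ^ (γ - N) * δ ^ γ * (1 - q)⁻¹, by
    have : 0 < 1 - q := by linarith
    positivity, fun A B hB hA hvol => ?_⟩
  set T : ℕ → Set (Space N) := fun k => A ∩ {z | δ * 2⁻¹ ^ (k + 1) ≤ ‖z‖ ∧ ‖z‖ < δ * 2⁻¹ ^ k}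
    with hT
  have hcov : A ∩ {z | ‖z‖ < δ ∧ z ≠ 0} ⊆ ⋃ k, T k := by
    rintro z ⟨hzA, hz1, hz0⟩
    have hpos : 0 < ‖z‖ := norm_pos_iff.2 hz0
    obtain ⟨n, h1, h2⟩ := exists_nat_pow_near_of_lt_one (x := ‖z‖ / δ) (y := (2⁻¹ : ℝ))
      (by positivity) ((div_le_one hδ).2 hz1.le) (by norm_num) (by norm_num)
    -- The dyadic lemma yields intervals closed on the right, whereas the annuli are closed on the
    -- left. A point on the outer sphere belongs to the preceding annulus, and for `n = 0` it would
    -- have norm `δ`, which is excluded.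
    rcases h2.lt_or_eq with h2 | h2
    · refine mem_iUnion.2 ⟨n, hzA, ?_, ?_⟩
      · have := (lt_div_iff₀ hδ).1 h1; linarith
      · have := (div_lt_iff₀ hδ).1 h2; linarith
    · cases n with
      | zero => exfalso; rw [pow_zero, div_eq_one_iff_eq hδ.ne'] at h2; linarith
      | succ m =>
        refine mem_iUnion.2 ⟨m, hzA, ?_, ?_⟩
        · rw [div_eq_iff hδ.ne'] at h2; linarith
        · rw [div_eq_iff hδ.ne'] at h2; rw [h2, pow_succ]
          have : (0:ℝ) < 2⁻¹ ^ m := by positivity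
          nlinarith
  have hterm : ∀ k, ∫⁻ z in T k, ENNReal.ofReal (‖z‖ ^ (γ - N)) ≤
      ENNReal.ofReal (2⁻¹ ^ (γ - N) * δ ^ γ * B * q ^ k) := by
    intro k
    have hl : MeasurableSet {z : Space N | δ * 2⁻¹ ^ (k + 1) ≤ ‖z‖} :=
      measurableSet_le (by fun_prop) (by fun_prop)
    have hr' : MeasurableSet {z : Space N | ‖z‖ < δ * 2⁻¹ ^ k} :=
      measurableSet_lt (by fun_prop) (by fun_prop)
    have hTm : MeasurableSet (T k) := hA.inter (hl.inter hr')
    have hpk : (0:ℝ) < 2⁻¹ ^ k := by positivity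
    have hr : 0 < δ * 2⁻¹ ^ (k + 1) := by positivity
    calc ∫⁻ z in T k, ENNReal.ofReal (‖z‖ ^ (γ - N))
        ≤ ∫⁻ z in T k, ENNReal.ofReal ((δ * 2⁻¹ ^ (k + 1)) ^ (γ - N)) := by
          refine setLIntegral_mono' hTm fun z hz => ENNReal.ofReal_le_ofReal ?_
          exact Real.rpow_le_rpow_of_nonpos hr hz.2.1 (by linarith)
      _ = ENNReal.ofReal ((δ * 2⁻¹ ^ (k + 1)) ^ (γ - N)) * volume (T k) := by
          rw [setLIntegral_const]
      _ ≤ ENNReal.ofReal ((δ * 2⁻¹ ^ (k + 1)) ^ (γ - N)) *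
            ENNReal.ofReal (B * (δ * 2⁻¹ ^ k) ^ N) := by
          gcongr
          refine (measure_mono ?_).trans (hvol (δ * 2⁻¹ ^ k) (by positivity) ?_)
          · rintro z ⟨hzA, hz⟩
            exact ⟨hzA, by simpa using hz.2.le⟩
          · exact mul_le_of_le_one_right hδ.le (pow_le_one₀ (by norm_num) (by norm_num))
      _ = _ := by
          rw [← ENNReal.ofReal_mul (by positivity)]
          congr 1
          have e1 : (δ * 2⁻¹ ^ k) ^ N = (δ * 2⁻¹ ^ k : ℝ) ^ (N : ℝ) := (Real.rpow_natCast _ _).symm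
          have e2 : (δ * 2⁻¹ ^ (k + 1) : ℝ) = (δ * 2⁻¹ ^ k) * 2⁻¹ := by ring
          have e3 : (δ * 2⁻¹ ^ k : ℝ) ^ γ = δ ^ γ * q ^ k := by
            rw [Real.mul_rpow hδ.le hpk.le, hq, ← Real.rpow_natCast, ← Real.rpow_natCast,
              ← Real.rpow_mul (by norm_num), ← Real.rpow_mul (by norm_num), mul_comm (k : ℝ)]
          have hx : (0:ℝ) < δ * 2⁻¹ ^ k := by positivity
          rw [e1, e2, Real.mul_rpow hx.le (by norm_num), Real.rpow_sub hx, e3]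
          have : (δ * 2⁻¹ ^ k : ℝ) ^ (N : ℝ) ≠ 0 := by positivity
          field_simp
  calc _ ≤ ∫⁻ z in ⋃ k, T k, ENNReal.ofReal (‖z‖ ^ (γ - N)) := lintegral_mono_set hcov
    _ ≤ ∑' k, ∫⁻ z in T k, ENNReal.ofReal (‖z‖ ^ (γ - N)) := lintegral_iUnion_le _ _
    _ ≤ ∑' k, ENNReal.ofReal (2⁻¹ ^ (γ - N) * δ ^ γ * B * q ^ k) := ENNReal.tsum_le_tsum hterm
    _ = _ := by
        rw [← ENNReal.ofReal_tsum_of_nonneg (fun k => by positivity)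
          ((summable_geometric_of_lt_one hq0.le hq1).mul_left _), tsum_mul_left,
          tsum_geometric_of_lt_one hq0.le hq1]
        congr 1; ring

/-- Uses `min(t,1) ≤ t^((1+σ)/2)`. The exponent lies strictly between `σ` and `1`: exceeding `σ`
leaves the integrable power `|z|^((1-σ)/2 - N)`, and being below `1` keeps the growth in `a` at most
linear. -/
lemma setIntegral_weight_mul_kernel_le_of_volume_le {N : ℕ} (hN : 0 < N) {σ : ℝ} (h0 : 0 < σ)
    (h1 : σ < 1) {δ : ℝ} (hδ : 0 < δ) :
    ∃ C : ℝ, 0 ≤ C ∧ ∀ (A : Set (Space N)) (B : ℝ), 0 ≤ B → MeasurableSet A →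
      (∀ s, 0 < s → s ≤ δ → volume (A ∩ Metric.closedBall 0 s) ≤ ENNReal.ofReal (B * s ^ N)) →
      ∀ a : ℝ, 1 ≤ a → ∫ z in A ∩ {z | ‖z‖ < δ}, weight a z * kernel N σ z ≤
        C * a ^ ((1 + σ) / 2) * B := by
  have hN' : (1:ℝ) ≤ N := by exact_mod_cast hN
  have : Nonempty (Fin N) := ⟨⟨0, hN⟩⟩
  obtain ⟨C, hC, hC'⟩ := lintegral_rpow_le_of_volume_le (N := N) (γ := (1 - σ) / 2) (δ := δ)
    (by linarith) (by linarith) hδ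
  refine ⟨C, hC, fun A B hB hA hvol a ha => ?_⟩
  have ha0 : 0 < a := by linarith
  have hpt : ∀ z : Space N, z ≠ 0 →
      weight a z * kernel N σ z ≤ a ^ ((1 + σ) / 2) * ‖z‖ ^ ((1 - σ) / 2 - N) := by
    intro z hz
    have hz' : 0 < ‖z‖ := norm_pos_iff.2 hz
    have hx : 0 < a * ‖z‖ := by positivity
    have hw : weight a z ≤ (a * ‖z‖) ^ ((1 + σ) / 2) := by
      unfold weight
      rcases le_total (a * ‖z‖) 1 with h | h
      · rw [min_eq_left h]
        exact Real.self_le_rpow_of_le_one hx.le h (by linarith)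
      · rw [min_eq_right h]
        exact Real.one_le_rpow h (by linarith)
    calc _ ≤ (a * ‖z‖) ^ ((1 + σ) / 2) * kernel N σ z := by
          gcongr; exact kernel_nonneg σ z
      _ = _ := by
          unfold kernel
          rw [Real.mul_rpow ha0.le hz'.le, mul_assoc, ← Real.rpow_add hz']
          congr 2; ring
  have hae : ∀ᵐ z : Space N, z ≠ 0 := by
    simp [ae_iff]
  have hm : MeasurableSet (A ∩ {z : Space N | ‖z‖ < δ}) :=
    hA.inter (measurableSet_lt (by fun_prop) (by fun_prop))
  rw [integral_eq_lintegral_of_nonneg_ae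
    (Eventually.of_forall fun z => mul_nonneg (weight_nonneg ha0.le z) (kernel_nonneg σ z))
    (((measurable_weight a).mul (measurable_kernel σ)).aestronglyMeasurable)]
  refine ENNReal.toReal_le_of_le_ofReal (by positivity) ?_
  have hset : (A ∩ {z : Space N | ‖z‖ < δ} : Set (Space N)) =ᵐ[volume]
      (A ∩ {z | ‖z‖ < δ ∧ z ≠ 0} : Set (Space N)) := by
    filter_upwards [hae] with z hz
    apply propext
    constructor
    · rintro ⟨h, h'⟩; exact ⟨h, h', hz⟩
    · rintro ⟨h, h', -⟩; exact ⟨h, h'⟩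
  calc _ ≤ ∫⁻ z in A ∩ {z | ‖z‖ < δ},
        ENNReal.ofReal (a ^ ((1 + σ) / 2)) * ENNReal.ofReal (‖z‖ ^ ((1 - σ) / 2 - N)) := by
        refine lintegral_mono_ae ?_
        filter_upwards [ae_restrict_of_ae hae] with z hz
        rw [← ENNReal.ofReal_mul (by positivity)]
        exact ENNReal.ofReal_le_ofReal (hpt z hz)
    _ = ENNReal.ofReal (a ^ ((1 + σ) / 2)) *
        ∫⁻ z in A ∩ {z | ‖z‖ < δ ∧ z ≠ 0}, ENNReal.ofReal (‖z‖ ^ ((1 - σ) / 2 - N)) := by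
        rw [lintegral_const_mul' _ _ ENNReal.ofReal_ne_top, setLIntegral_congr hset]
    _ ≤ ENNReal.ofReal (a ^ ((1 + σ) / 2)) * ENNReal.ofReal (C * B) := by
        gcongr; exact hC' A B hB hA hvol
    _ = _ := by
        rw [← ENNReal.ofReal_mul (by positivity)]; congr 1; ring

/-! ### Volumes of Lipschitz images and of strips -/

/-- Lebesgue measure is a multiple of the `N`-dimensional Hausdorff measure by uniqueness of Haar
measure, and the latter scales by `K^N` under Lipschitz maps. -/
lemma volume_image_le_of_lipschitzOnWith {N : ℕ} {K : ℝ≥0} {f : Space N → Space N}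
    {s : Set (Space N)} (hf : LipschitzOnWith K f s) :
    volume (f '' s) ≤ (K : ENNReal) ^ N * volume s := by
  have h := Measure.isAddLeftInvariant_eq_smul (volume : Measure (Space N))
    (Measure.hausdorffMeasure (N : ℝ))
  rw [h]
  simp only [Measure.smul_apply]
  have := hf.hausdorffMeasure_image_le (d := (N : ℝ)) (Nat.cast_nonneg N)
  rw [ENNReal.rpow_natCast] at this
  rw [ENNReal.smul_def, ENNReal.smul_def, smul_eq_mul, smul_eq_mul, mul_left_comm]
  gcongr

/-- The slab sits in a box with one side `2t` and all other sides `2R`. -/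
lemma volume_slab_le {N : ℕ} (i : Fin N) (c : Space N) {R t : ℝ} (hR : 0 ≤ R) (ht : 0 ≤ t) :
    volume {w : Space N | ‖w - c‖ ≤ R ∧ |w i| ≤ t} ≤
      ENNReal.ofReal (2 * t * (2 * R) ^ (N - 1)) := by
  classical
  set I : Fin N → Set ℝ := fun k => if k = i then Icc (-t) t else Icc (c k - R) (c k + R) with hI
  have hsub : {w : Space N | ‖w - c‖ ≤ R ∧ |w i| ≤ t} ⊆
      (MeasurableEquiv.toLp 2 (Fin N → ℝ)).symm ⁻¹' (Set.univ.pi I) := by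
    rintro w ⟨h1, h2⟩ k -
    simp only [hI, MeasurableEquiv.toLp_symm_apply]
    split_ifs with hk
    · subst hk; exact abs_le.1 h2
    · have := (PiLp.norm_apply_le (w - c) k).trans h1
      rw [Real.norm_eq_abs, PiLp.sub_apply, abs_le] at this
      constructor <;> linarith [this.1, this.2]
  refine (measure_mono hsub).trans ?_
  have hmeas : MeasurableSet (Set.univ.pi I) := MeasurableSet.univ_pi fun k => by
    simp only [hI]; split_ifs <;> exact measurableSet_Icc
  rw [(EuclideanSpace.volume_preserving_symm_measurableEquiv_toLp (Fin N)).measure_preimage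
    hmeas.nullMeasurableSet, volume_pi_pi]
  have hv : ∀ k, volume (I k) = ENNReal.ofReal (if k = i then 2 * t else 2 * R) := by
    intro k
    simp only [hI]; split_ifs <;> rw [Real.volume_Icc] <;> congr 1 <;> ring
  simp_rw [hv]
  rw [← ENNReal.ofReal_prod_of_nonneg (fun k _ => by split_ifs <;> positivity)]
  refine ENNReal.ofReal_le_ofReal (le_of_eq ?_)
  rw [← Finset.mul_prod_erase Finset.univ _ (Finset.mem_univ i), if_pos rfl,
    Finset.prod_congr rfl (g := fun _ => 2 * R)
      (fun k hk => if_neg (Finset.ne_of_mem_erase hk)), Finset.prod_const,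
    Finset.card_erase_of_mem (Finset.mem_univ i), Finset.card_univ, Fintype.card_fin]

/-! ### The signed distance -/

lemma signedDistBdry_of_mem_closure {N : ℕ} {Ω : Set (Space N)} {x : Space N}
    (hx : x ∈ closure Ω) : signedDistBdry Ω x = Metric.infDist x (frontier Ω) := by
  unfold signedDistBdry
  split_ifs with h
  · rfl
  · have : x ∈ frontier Ω := ⟨hx, fun h' => h (interior_subset h')⟩
    rw [Metric.infDist_zero_of_mem this, neg_zero]

lemma signedDistBdry_nonpos {N : ℕ} {Ω : Set (Space N)} {x : Space N}
    (hx : x ∉ closure Ω) : signedDistBdry Ω x ≤ 0 := by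
  unfold signedDistBdry
  rw [if_neg fun h => hx (subset_closure h)]
  exact neg_nonpos.2 Metric.infDist_nonneg

lemma signedDistBdry_of_mem_frontier {N : ℕ} {Ω : Set (Space N)} {x : Space N}
    (hx : x ∈ frontier Ω) : signedDistBdry Ω x = 0 := by
  rw [signedDistBdry_of_mem_closure hx.1, Metric.infDist_zero_of_mem hx]

lemma abs_signedDistBdry_sub_le {N : ℕ} {Ω : Set (Space N)} {x y : Space N}
    (hx : x ∈ closure Ω) (hy : y ∈ closure Ω) :
    |signedDistBdry Ω x - signedDistBdry Ω y| ≤ ‖x - y‖ := by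
  rw [signedDistBdry_of_mem_closure hx, signedDistBdry_of_mem_closure hy, ← Real.dist_eq,
    ← dist_eq_norm]
  simpa using (Metric.lipschitz_infDist_pt (frontier Ω)).dist_le_mul x y

lemma norm_gradient {N : ℕ} (f : Space N → ℝ) (x : Space N) :
    ‖gradient f x‖ = ‖fderiv ℝ f x‖ := by
  unfold gradient; exact LinearIsometryEquiv.norm_map _ _

lemma norm_gradient_sub {N : ℕ} (f g : Space N → ℝ) (x y : Space N) :
    ‖gradient f x - gradient g y‖ = ‖fderiv ℝ f x - fderiv ℝ g y‖ := by
  unfold gradient; rw [← map_sub]; exact LinearIsometryEquiv.norm_map _ _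

/-- `d` describes `closure Ω` near `x₁`: it behaves as the signed distance from the boundary. -/
structure IsLocalDistance (Ω : Set (Space N)) (x₁ : Space N) (r L : ℝ) (d : Space N → ℝ) :
    Prop where
  pos : 0 < r
  nonneg_const : 0 ≤ L
  contDiffOn : ContDiffOn ℝ 1 d (Metric.ball x₁ r)
  lip : ∀ x ∈ Metric.ball x₁ r, ∀ y ∈ Metric.ball x₁ r,
    ‖gradient d x - gradient d y‖ ≤ L * ‖x - y‖
  bound : ∀ x ∈ Metric.ball x₁ r, ‖gradient d x‖ ≤ L
  lip_closure : ∀ x ∈ closure Ω, ∀ y ∈ closure Ω, |d x - d y| ≤ ‖x - y‖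
  nonneg : ∀ x ∈ closure Ω, 0 ≤ d x
  nonpos : ∀ x ∈ Metric.ball x₁ r, x ∉ closure Ω → d x ≤ 0
  eq_zero : ∀ x ∈ Metric.ball x₁ r, x ∈ frontier Ω → d x = 0
  gradient_eq : ∀ x ∈ Metric.ball x₁ r, x ∈ frontier Ω → gradient d x = - outerNormal Ω x
  norm_eq : ∀ x ∈ Metric.ball x₁ r, x ∈ frontier Ω → ‖gradient d x‖ = 1
  norm_le : ∀ x ∈ Metric.ball x₁ r, x ∈ closure Ω → ‖gradient d x‖ ≤ 1
  strip : ∀ y ∈ Metric.ball x₁ r, ∀ s w : ℝ, 0 < s → s ≤ r → 0 ≤ w →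
    volume {h : Space N | ‖h‖ ≤ s ∧ |d (y + h)| ≤ w * s} ≤ ENNReal.ofReal (L * w * s ^ N)

/-- Near an interior point the boundary clauses are vacuous, so a constant can play the role of the
distance. Interior and boundary points are then treated by one argument. -/
lemma exists_isLocalDistance_of_mem {N : ℕ} {Ω : Set (Space N)} (hΩ : IsOpen Ω) {x₁ : Space N}
    (hx : x₁ ∈ Ω) : ∃ r L, IsLocalDistance Ω x₁ r L (fun _ => 1) := by
  obtain ⟨r, hr, hsub⟩ := Metric.isOpen_iff.1 hΩ x₁ hx
  have hfr : ∀ x ∈ Metric.ball x₁ (min r 1), x ∉ frontier Ω := by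
    intro x hx h
    exact (hΩ.frontier_eq ▸ h : x ∈ closure Ω \ Ω).2
      (hsub (Metric.ball_subset_ball (min_le_left _ _) hx))
  have hg : ∀ x, gradient (fun _ : Space N => (1:ℝ)) x = 0 := fun x => gradient_const x 1
  set V : ℝ := (volume (Metric.closedBall (0 : Space N) 1)).toReal with hV
  refine ⟨min r 1, V, ⟨lt_min hr one_pos, ENNReal.toReal_nonneg, contDiffOn_const,
    fun x _ y _ => by simp only [hg]; simp; positivity, fun x _ => by simp only [hg]; simp [hV],
    fun x _ y _ => by simp, fun x _ => zero_le_one,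
    fun x hx h => (h (subset_closure (hsub
      (Metric.ball_subset_ball (min_le_left _ _) hx)))).elim,
    fun x hx h => (hfr x hx h).elim, fun x hx h => (hfr x hx h).elim,
    fun x hx h => (hfr x hx h).elim, fun x _ _ => by simp only [hg]; simp, ?_⟩⟩
  intro y _ s w hs hsr hw
  rw [abs_one]
  -- The set is nonempty only if `w * s ≥ 1`. The radius was cut at `1` so that this forces `w ≥ 1`,
  -- and the volume of the whole ball is then small enough.
  by_cases h1 : 1 ≤ w * s
  · have hw1 : 1 ≤ w := by
      have : s ≤ 1 := hsr.trans (min_le_right _ _)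
      nlinarith
    calc _ ≤ volume (Metric.closedBall (0 : Space N) s) :=
          measure_mono fun h hh => by simpa using hh.1
      _ = ENNReal.ofReal (s ^ N) * volume (Metric.closedBall (0 : Space N) 1) := by
          rw [Measure.addHaar_closedBall' _ _ hs.le, finrank_euclideanSpace_fin]
      _ = ENNReal.ofReal (s ^ N * V) := by
          rw [ENNReal.ofReal_mul (by positivity), hV,
            ENNReal.ofReal_toReal (measure_closedBall_lt_top).ne]
      _ ≤ _ := by
          refine ENNReal.ofReal_le_ofReal ?_
          have : 0 ≤ s ^ N * V := by positivity
          nlinarith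
  · simp [h1]

/-- The chart has `d` as a coordinate, so it carries the strip into a flat slab of radius `K * s`
and half-width `w * s`; the Lipschitz inverse brings the volume bound back. -/
lemma exists_strip_of_chart {N : ℕ} {s₀ : Space N} {r : ℝ} (hr : 0 < r)
    {ψ : OpenPartialHomeomorph (Space N) (Space N)} (hs : ψ.source = Metric.ball s₀ r)
    {K K' : ℝ≥0} (hψ : LipschitzOnWith K ψ ψ.source) {ρ : ℝ} (hρ : 0 < ρ)
    (hψ' : LipschitzOnWith K' ψ.symm (Metric.ball (ψ s₀) ρ))
    {d : Space N → ℝ} (i : Fin N) (hd : ∀ s ∈ Metric.ball s₀ r, ψ s i = d s) :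
    ∃ r' C : ℝ, 0 < r' ∧ r' ≤ r ∧ 0 ≤ C ∧ ∀ y ∈ Metric.ball s₀ r', ∀ s w : ℝ, 0 < s → s ≤ r' →
      0 ≤ w → volume {h : Space N | ‖h‖ ≤ s ∧ |d (y + h)| ≤ w * s} ≤
        ENNReal.ofReal (C * w * s ^ N) := by
  obtain ⟨ε, hε, hball⟩ := Metric.continuousAt_iff.1
    (ψ.continuousAt (x := s₀) (by rw [hs]; exact Metric.mem_ball_self hr)) ρ hρ
  -- `ε` keeps the image inside the ball where the inverse chart is known to be Lipschitz; halving
  -- leaves room for the displaced point `y + h`.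
  refine ⟨min ε r / 2, K' ^ N * (2 * (2 * K) ^ (N - 1)), by positivity, ?_, by positivity, ?_⟩
  · have := min_le_right ε r
    have : 0 < min ε r := by positivity
    linarith
  intro y hy s w hs0 hsr hw
  have hN : N - 1 + 1 = N := Nat.sub_add_cancel (Nat.lt_of_le_of_lt (Nat.zero_le _) i.2)
  have hin : ∀ h : Space N, ‖h‖ ≤ s → dist (y + h) s₀ < min ε r := by
    intro h hh
    have h1 : dist (y + h) y = ‖h‖ := by simp [dist_eq_norm]
    have h2 := dist_triangle (y + h) y s₀
    have h3 : dist y s₀ < min ε r / 2 := hy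
    linarith
  have hsubset : {h : Space N | ‖h‖ ≤ s ∧ |d (y + h)| ≤ w * s} ⊆
      (fun z => ψ.symm z - y) '' (Metric.ball (ψ s₀) ρ ∩
        {z | ‖z - ψ y‖ ≤ K * s ∧ |z i| ≤ w * s}) := by
    rintro h ⟨hh1, hh2⟩
    have hd' := hin h hh1
    have hsrc : y + h ∈ ψ.source := by
      rw [hs]; exact hd'.trans_le (min_le_right _ _)
    have hysrc : y ∈ ψ.source := by
      have := hin 0 (by simpa using hs0.le)
      rw [hs]; rw [add_zero] at this; exact this.trans_le (min_le_right _ _)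
    refine ⟨ψ (y + h), ⟨hball (hd'.trans_le (min_le_left _ _)), ?_, ?_⟩, ?_⟩
    · have := hψ.dist_le_mul _ hsrc _ hysrc
      rw [dist_eq_norm, dist_eq_norm, add_sub_cancel_left] at this
      exact this.trans (by gcongr)
    · rw [hd _ (hs ▸ hsrc)]; exact hh2
    · simp [ψ.left_inv hsrc]
  have hlip : LipschitzOnWith K' (fun z => ψ.symm z - y) (Metric.ball (ψ s₀) ρ ∩
        {z | ‖z - ψ y‖ ≤ K * s ∧ |z i| ≤ w * s}) := by
    intro a ha b hb
    simp only [edist_sub_right]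
    exact hψ' ha.1 hb.1
  calc _ ≤ (K' : ENNReal) ^ N * volume (Metric.ball (ψ s₀) ρ ∩
        {z | ‖z - ψ y‖ ≤ K * s ∧ |z i| ≤ w * s}) :=
        (measure_mono hsubset).trans (volume_image_le_of_lipschitzOnWith hlip)
    _ ≤ (K' : ENNReal) ^ N * ENNReal.ofReal (2 * (w * s) * (2 * (K * s)) ^ (N - 1)) := by
        gcongr
        exact (measure_mono inter_subset_right).trans
          (volume_slab_le i _ (by positivity) (by positivity))
    _ = _ := by
        rw [← ENNReal.ofReal_coe_nnreal, ← ENNReal.ofReal_pow (by positivity),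
          ← ENNReal.ofReal_mul (by positivity)]
        congr 1
        have : s ^ N = s ^ (N - 1) * s := by rw [← pow_succ, hN]
        rw [this]
        ring

/-- The regularity of `d` is that of the last coordinate of the chart. The bound `‖∇d‖ ≤ 1` passes
from `Ω`, where `d` is 1-Lipschitz, to the closure by continuity of the gradient. -/
lemma exists_isLocalDistance_of_mem_frontier {N : ℕ} (hN : 0 < N) {Ω : Set (Space N)}
    (hΩ : IsOpen Ω) (hO : DomainClassW2Infty Ω) {x₁ : Space N} (hx : x₁ ∈ frontier Ω) :
    ∃ r L, IsLocalDistance Ω x₁ r L (signedDistBdry Ω) := by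
  obtain ⟨r, hr, ψ, hs, ⟨hC, ⟨K, hK⟩, L, hL⟩, ⟨hC', ⟨K', hK'⟩, -⟩, hd⟩ := hO x₁ hx
  set i : Fin N := ⟨N - 1, by omega⟩
  have hi : (i : ℕ) + 1 = N := Nat.sub_add_cancel hN
  have hd' : ∀ s ∈ Metric.ball x₁ r, ψ s i = signedDistBdry Ω s := fun s h => hd s h i hi
  set d := signedDistBdry Ω with hdd
  rw [hs] at hC hK hL
  have hψdiff : ∀ x ∈ Metric.ball x₁ r, DifferentiableAt ℝ ψ x := fun x hx =>
    (hC.differentiableOn one_ne_zero).differentiableAt (Metric.isOpen_ball.mem_nhds hx)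
  have hKn : ∀ x ∈ Metric.ball x₁ r, ‖fderiv ℝ ψ x‖ ≤ K := fun x hx => (hK x hx).2
  have hK0 : 0 ≤ K := (norm_nonneg _).trans (hKn x₁ (Metric.mem_ball_self hr))
  have hψlip : LipschitzOnWith K.toNNReal ψ (Metric.ball x₁ r) :=
    (convex_ball x₁ r).lipschitzOnWith_of_nnnorm_fderiv_le hψdiff
      (fun x hx => by
        rw [← NNReal.coe_le_coe, Real.coe_toNNReal _ hK0]; exact hKn x hx)
  obtain ⟨ρ, hρ, hρsub⟩ := Metric.isOpen_iff.1 ψ.open_target (ψ x₁)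
    (ψ.map_source (by rw [hs]; exact Metric.mem_ball_self hr))
  have hK'0 : 0 ≤ K' := (norm_nonneg _).trans (hK' _ (hρsub (Metric.mem_ball_self hρ))).2
  have hψ'lip : LipschitzOnWith K'.toNNReal ψ.symm (Metric.ball (ψ x₁) ρ) :=
    (convex_ball _ ρ).lipschitzOnWith_of_nnnorm_fderiv_le
      (fun x hx => (hC'.differentiableOn one_ne_zero).differentiableAt
        (ψ.open_target.mem_nhds (hρsub hx)))
      (fun x hx => by
        rw [← NNReal.coe_le_coe, Real.coe_toNNReal _ hK'0]; exact (hK' x (hρsub hx)).2)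
  obtain ⟨r', C, hr', hr'r, hC0, hstrip⟩ := exists_strip_of_chart hr hs (by rwa [hs]) hρ
    hψ'lip i hd'
  have hbsub : Metric.ball x₁ r' ⊆ Metric.ball x₁ r := Metric.ball_subset_ball hr'r
  set π : Space N →L[ℝ] ℝ := EuclideanSpace.proj i with hπ
  have hπ1 : ‖π‖ ≤ 1 := ContinuousLinearMap.opNorm_le_bound _ zero_le_one fun x => by
    rw [one_mul]; exact PiLp.norm_apply_le x i
  have hev : ∀ x ∈ Metric.ball x₁ r, d =ᶠ[𝓝 x] fun y => π (ψ y) := fun x hx => by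
    filter_upwards [Metric.isOpen_ball.mem_nhds hx] with y hy
    exact (hd' y hy).symm
  have hfd : ∀ x ∈ Metric.ball x₁ r, fderiv ℝ d x = π.comp (fderiv ℝ ψ x) := fun x hx => by
    rw [(hev x hx).fderiv_eq]
    exact (π.hasFDerivAt.comp x (hψdiff x hx).hasFDerivAt).fderiv
  have hdC : ContDiffOn ℝ 1 d (Metric.ball x₁ r) :=
    (π.contDiff.comp_contDiffOn hC).congr fun x hx => (hd' x hx).symm
  have hdiff : ∀ x ∈ Metric.ball x₁ r, DifferentiableAt ℝ d x := fun x hx =>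
    (hdC.differentiableOn one_ne_zero).differentiableAt (Metric.isOpen_ball.mem_nhds hx)
  have hlip : ∀ x ∈ Metric.ball x₁ r, ∀ y ∈ Metric.ball x₁ r,
      ‖gradient d x - gradient d y‖ ≤ L * ‖x - y‖ := by
    intro x hx y hy
    rw [norm_gradient_sub, hfd x hx, hfd y hy, ← ContinuousLinearMap.comp_sub]
    calc _ ≤ ‖π‖ * ‖fderiv ℝ ψ x - fderiv ℝ ψ y‖ := ContinuousLinearMap.opNorm_comp_le _ _
      _ ≤ 1 * ‖fderiv ℝ ψ x - fderiv ℝ ψ y‖ := by gcongr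
      _ ≤ L * ‖x - y‖ := by
        rw [one_mul, ← dist_eq_norm, ← dist_eq_norm]; exact hL.dist_le_mul x hx y hy
  have hcont : ∀ x ∈ Metric.ball x₁ r, ContinuousAt (gradient d) x := by
    intro x hx
    have : LipschitzOnWith L (gradient d) (Metric.ball x₁ r) :=
      LipschitzOnWith.of_dist_le_mul fun a ha b hb => by
        rw [dist_eq_norm, dist_eq_norm]; exact hlip a ha b hb
    exact this.continuousOn.continuousAt (Metric.isOpen_ball.mem_nhds hx)
  have hle : ∀ x ∈ Metric.ball x₁ r, x ∈ closure Ω → ‖gradient d x‖ ≤ 1 := by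
    intro x hx hxc
    have hin : ∀ y ∈ Metric.ball x₁ r ∩ Ω, ‖gradient d y‖ ≤ 1 := by
      rintro y ⟨hy, hyΩ⟩
      rw [norm_gradient]
      have hl : LipschitzOnWith 1 d Ω := LipschitzOnWith.of_dist_le_mul fun a ha b hb => by
        rw [Real.dist_eq, dist_eq_norm, NNReal.coe_one, one_mul]
        exact abs_signedDistBdry_sub_le (subset_closure ha) (subset_closure hb)
      exact (hdiff y hy).hasFDerivAt.le_of_lipschitzOn (hΩ.mem_nhds hyΩ) hl
    by_contra hcon
    push Not at hcon
    have : ∀ᶠ y in 𝓝 x, 1 < ‖gradient d y‖ ∧ y ∈ Metric.ball x₁ r :=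
      ((hcont x hx).norm.eventually_const_lt hcon).and (Metric.isOpen_ball.mem_nhds hx)
    obtain ⟨y, hy, hyΩ⟩ := (mem_closure_iff_frequently.1 hxc).and_eventually this |>.exists
    exact absurd (hin y ⟨hyΩ.2, hy⟩) (not_le.2 hyΩ.1)
  -- If the gradient had norm below `c < 1` near `x`, an interior point `y` close to `x` and its
  -- nearest boundary point `s` would satisfy `|y - s| = d y ≤ c|y - s|`. With `y` within `ε / 3` of
  -- `x`, the point `s` stays in the ball of radius `ε`.
  have hge : ∀ x ∈ Metric.ball x₁ r, x ∈ frontier Ω → ‖gradient d x‖ = 1 := by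
    intro x hx hxf
    refine le_antisymm (hle x hx hxf.1) ?_
    by_contra hcon
    push Not at hcon
    obtain ⟨c, hc1, hc2⟩ := exists_between hcon
    have : ∀ᶠ y in 𝓝 x, ‖gradient d y‖ < c ∧ y ∈ Metric.ball x₁ r :=
      ((hcont x hx).norm.eventually_lt_const hc1).and (Metric.isOpen_ball.mem_nhds hx)
    obtain ⟨ε, hε, hball⟩ := Metric.eventually_nhds_iff_ball.1 this
    have hxΩ : ∀ᶠ y in 𝓝 x, y ∈ Metric.ball x (ε / 3) := Metric.ball_mem_nhds x (by positivity)
    obtain ⟨y, hyΩ, hy⟩ := (mem_closure_iff_frequently.1 hxf.1).and_eventually hxΩ |>.exists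
    obtain ⟨s, hsf, hsd⟩ := isClosed_frontier.exists_infDist_eq_dist ⟨x, hxf⟩ y
    have hys : dist y s ≤ dist y x := hsd ▸ Metric.infDist_le_dist_of_mem hxf
    have hyx : dist y x < ε / 3 := hy
    have hsx : dist s x < ε := by
      have := dist_triangle s y x
      rw [dist_comm s y] at this
      linarith
    have hmv := (convex_ball x ε).norm_image_sub_le_of_norm_fderiv_le (𝕜 := ℝ) (f := d) (C := c)
      (fun z hz => hdiff z (hball z hz).2)
      (fun z hz => by rw [← norm_gradient]; exact (hball z hz).1.le)
      (show s ∈ Metric.ball x ε from hsx)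
      (show y ∈ Metric.ball x ε by rw [Metric.mem_ball]; linarith)
    rw [hdd, signedDistBdry_of_mem_frontier hsf,
      signedDistBdry_of_mem_closure (subset_closure hyΩ), hsd, sub_zero, Real.norm_eq_abs,
      abs_of_nonneg dist_nonneg, ← dist_eq_norm] at hmv
    have hpos : 0 < dist y s := by
      rw [dist_pos]
      rintro rfl
      exact (hΩ.frontier_eq ▸ hsf : y ∈ closure Ω \ Ω).2 hyΩ
    nlinarith
  refine ⟨r', max (max L K) C, ⟨hr', le_max_of_le_right hC0, hdC.mono hbsub, ?_, ?_,
    fun x hx y hy => abs_signedDistBdry_sub_le hx hy, fun x hx => ?_,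
    fun x _ hxc => signedDistBdry_nonpos hxc, fun x _ hxf => signedDistBdry_of_mem_frontier hxf,
    fun x _ _ => by rw [outerNormal, neg_neg], fun x hx => hge x (hbsub hx),
    fun x hx => hle x (hbsub hx), ?_⟩⟩
  · intro x hx y hy
    refine (hlip x (hbsub hx) y (hbsub hy)).trans ?_
    gcongr
    exact (le_max_left _ _).trans (le_max_left _ _)
  · intro x hx
    rw [norm_gradient, hfd x (hbsub hx)]
    calc _ ≤ ‖π‖ * ‖fderiv ℝ ψ x‖ := ContinuousLinearMap.opNorm_comp_le _ _
      _ ≤ 1 * K := by gcongr; exact hKn x (hbsub hx)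
      _ ≤ _ := by rw [one_mul]; exact (le_max_right _ _).trans (le_max_left _ _)
  · rw [hdd, signedDistBdry_of_mem_closure hx]; exact Metric.infDist_nonneg
  · intro y hy s w hs0 hsr hw
    refine (hstrip y hy s w hs0 hsr hw).trans (ENNReal.ofReal_le_ofReal ?_)
    gcongr
    exact le_max_right _ _

lemma exists_isLocalDistance {N : ℕ} (hN : 0 < N) {Ω : Set (Space N)}
    (hΩ : IsOpen Ω) (hO : DomainClassW2Infty Ω) {x₁ : Space N} (hx : x₁ ∈ closure Ω) :
    ∃ r L d, IsLocalDistance Ω x₁ r L d ∧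
      ((∀ x, d x = 1) ∨ x₁ ∈ frontier Ω) := by
  by_cases h : x₁ ∈ Ω
  · obtain ⟨r, L, hd⟩ := exists_isLocalDistance_of_mem hΩ h
    exact ⟨r, L, _, hd, Or.inl fun _ => rfl⟩
  · have hf : x₁ ∈ frontier Ω := ⟨hx, fun h' => h (interior_subset h')⟩
    obtain ⟨r, L, hd⟩ := exists_isLocalDistance_of_mem_frontier hN hΩ hO hf
    exact ⟨r, L, _, hd, Or.inr hf⟩

/-- Locally the boundary lies in a strip of width zero, so the strip estimate with `w = 0` applies.
-/
lemma volume_frontier_eq_zero {N : ℕ} (hN : 0 < N) {Ω : Set (Space N)}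
    (hΩ : IsOpen Ω) (hO : DomainClassW2Infty Ω) : volume (frontier Ω) = 0 := by
  refine measure_null_of_locally_null _ fun x hx => ?_
  obtain ⟨r, L, hd⟩ := exists_isLocalDistance_of_mem_frontier hN hΩ hO hx
  have hr := hd.pos
  refine ⟨frontier Ω ∩ Metric.ball x r, inter_mem_nhdsWithin _ (Metric.ball_mem_nhds x hr), ?_⟩
  have hsub : frontier Ω ∩ Metric.ball x r ⊆
      (fun h => x + h) '' {h : Space N | ‖h‖ ≤ r ∧ |signedDistBdry Ω (x + h)| ≤ 0 * r} := by
    rintro y ⟨hy, hyb⟩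
    refine ⟨y - x, ⟨?_, ?_⟩, by simp⟩
    · rw [← dist_eq_norm]; exact (Metric.mem_ball.1 hyb).le
    · rw [add_sub_cancel, signedDistBdry_of_mem_frontier hy]; simp
  refine measure_mono_null hsub ?_
  rw [image_add_left, measure_preimage_add]
  have := hd.strip x (Metric.mem_ball_self hr) r 0 hr le_rfl le_rfl
  simpa using this

/-! ### The nonlocal operator -/

/-- The assumptions on the measures and the jump function, with one common constant `Λ`. -/
structure IsJumpOperator {N : ℕ} (Ω : Set (Space N)) (μ : Space N → Measure (Space N))
    (j : Space N → Space N → Space N) (σ Cj : ℝ) (ρ : Space N → Space N → ℝ) (Λ : ℝ) :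
    Prop where
  dim_pos : 0 < N
  order_pos : 0 < σ
  order_lt_one : σ < 1
  one_le : 1 ≤ Λ
  measurable_density : ∀ x ∈ closure Ω, Measurable (ρ x)
  density_nonneg : ∀ x ∈ closure Ω, ∀ z, 0 ≤ ρ x z
  eq_withDensity : ∀ x ∈ closure Ω,
    μ x = (volume : Measure (Space N)).withDensity (fun z => ENNReal.ofReal (ρ x z))
  density_le : ∀ x ∈ closure Ω, ∀ z, z ≠ 0 → ρ x z ≤ Λ * kernel N σ z
  density_sub_le : ∀ x ∈ closure Ω, ∀ y ∈ closure Ω, ∀ z, z ≠ 0 →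
    |ρ x z - ρ y z| ≤ Λ * ‖x - y‖ * kernel N σ z
  const_le : Cj ≤ Λ
  continuous_jump : ∀ x ∈ closure Ω, Continuous (j x)
  norm_jump_le' : ∀ x ∈ closure Ω, ∀ z, ‖j x z‖ ≤ Cj * ‖z‖
  jump_sub_le : ∀ x ∈ closure Ω, ∀ y ∈ closure Ω, ∀ z, ‖j x z - j y z‖ ≤ Λ * ‖z‖ * ‖x - y‖
  exists_inverse : ∀ x ∈ closure Ω, ∃ g : Space N → Space N,
    Function.LeftInverse g (j x) ∧ LipschitzWith Λ.toNNReal g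

lemma exists_isJumpOperator {N : ℕ} (hN : 0 < N) {Ω : Set (Space N)}
    {μ : Space N → Measure (Space N)} {σ : ℝ} (hM : AssumptionM Ω μ σ)
    {j : Space N → Space N → Space N} {Cj : ℝ} (hJ0 : AssumptionJ0 Ω j)
    (hJ1 : AssumptionJ1 Ω j Cj) : ∃ ρ Λ, IsJumpOperator Ω μ j σ Cj ρ Λ := by
  obtain ⟨h0, h1, ρ, hρ, Cμ, hCμ, Dμ, hDμ, hb⟩ := hM
  obtain ⟨Aj, hA⟩ := hJ0
  obtain ⟨hCj, cj, -, Dj, hDj, hj⟩ := hJ1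
  set Λ : ℝ := 1 + Cμ + Dμ + |Aj| + Cj + Dj with hΛ
  have hAn := abs_nonneg Aj
  refine ⟨ρ, Λ, hN, h0, h1, by linarith, fun x hx => (hρ x hx).1, fun x hx => (hρ x hx).2.1,
    fun x hx => (hρ x hx).2.2, fun x hx z hz => ?_, fun x hx y hy z hz => ?_, by linarith,
    fun x hx => (hA x hx).1.continuous, fun x hx z => (hj x hx x hx z).2.1,
    fun x hx y hy z => ?_, fun x hx => ?_⟩
  · refine ((hb x hx x hx z hz).1).trans ?_
    have := kernel_nonneg σ z
    unfold kernel at *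
    gcongr
    linarith
  · refine ((hb x hx y hy z hz).2).trans ?_
    have := kernel_nonneg σ z
    unfold kernel at *
    gcongr
    linarith
  · refine ((hj x hx y hy z).2.2).trans ?_
    gcongr
    linarith
  · obtain ⟨-, g, hl, -, hg, hgA⟩ := hA x hx
    refine ⟨g, hl, lipschitzWith_of_nnnorm_fderiv_le (𝕜 := ℝ) (hg.differentiable one_ne_zero)
      fun w => ?_⟩
    rw [← NNReal.coe_le_coe, Real.coe_toNNReal _ (by linarith)]
    have := le_abs_self Aj
    exact (hgA w).trans (by linarith)

/-- The set of admissible jumps of size at least `ξ` from `x`. -/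
def jumpSet {N : ℕ} (Ω : Set (Space N)) (j : Space N → Space N → Space N) (ξ : ℝ) (x : Space N) :
    Set (Space N) := {z | ξ ≤ ‖z‖ ∧ x + j x z ∈ closure Ω}

/-- The jumps that are admissible from exactly one of the points `x`, `y`. -/
def mismatch {N : ℕ} (Ω : Set (Space N)) (j : Space N → Space N → Space N) (x y : Space N) :
    Set (Space N) := {z | ¬ (x + j x z ∈ closure Ω ↔ y + j y z ∈ closure Ω)}

lemma measurable_indicator_of_upperSemicontinuousOn {N : ℕ} {F : Set (Space N)}
    (hF : IsClosed F) {w : Space N → ℝ} (hw : UpperSemicontinuousOn w F) :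
    Measurable (F.indicator w) := by
  refine measurable_of_restrict_of_restrict_compl hF.measurableSet ?_ ?_
  · have h : F.domRestrict (F.indicator w) = F.domRestrict w := by
      ext x; exact indicator_of_mem x.2 _
    rw [h]
    exact (upperSemicontinuousOn_iff_restrict.2 hw).measurable
  · have h : Fᶜ.domRestrict (F.indicator w) = fun _ => 0 := by
      ext x; exact indicator_of_notMem x.2 _
    rw [h]
    exact measurable_const

/-! ### Lebesgue form and bounds of the inner and outer parts. -/

namespace IsJumpOperator

variable {N : ℕ} {Ω : Set (Space N)} {μ : Space N → Measure (Space N)}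
  {j : Space N → Space N → Space N} {σ Cj Λ : ℝ} {ρ : Space N → Space N → ℝ}

lemma norm_jump_le (h : IsJumpOperator Ω μ j σ Cj ρ Λ) {x : Space N} (hx : x ∈ closure Ω)
    (z : Space N) : ‖j x z‖ ≤ Λ * ‖z‖ :=
  (h.norm_jump_le' x hx z).trans (by gcongr; exact h.const_le)

lemma measurableSet_admissible (h : IsJumpOperator Ω μ j σ Cj ρ Λ) {x : Space N}
    (hx : x ∈ closure Ω) : MeasurableSet {z | x + j x z ∈ closure Ω} :=
  (isClosed_closure.preimage (continuous_const.add (h.continuous_jump x hx))).measurableSet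

lemma measurableSet_jumpSet (h : IsJumpOperator Ω μ j σ Cj ρ Λ) {x : Space N}
    (hx : x ∈ closure Ω) (ξ : ℝ) : MeasurableSet (jumpSet Ω j ξ x) := by
  have h1 : MeasurableSet {z : Space N | ξ ≤ ‖z‖} :=
    measurableSet_le measurable_const measurable_norm
  exact h1.inter (h.measurableSet_admissible hx)

lemma measurableSet_mismatch (h : IsJumpOperator Ω μ j σ Cj ρ Λ) {x y : Space N}
    (hx : x ∈ closure Ω) (hy : y ∈ closure Ω) : MeasurableSet (mismatch Ω j x y) :=
  ((h.measurableSet_admissible hx).iff (h.measurableSet_admissible hy)).compl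

lemma setIntegral_eq (h : IsJumpOperator Ω μ j σ Cj ρ Λ) {x : Space N} (hx : x ∈ closure Ω)
    {S : Set (Space N)} (hS : MeasurableSet S) (f : Space N → ℝ) :
    ∫ z in S, f z ∂(μ x) = ∫ z in S, ρ x z * f z := by
  rw [h.eq_withDensity x hx, setIntegral_withDensity_eq_setIntegral_toReal_smul
    (h.measurable_density x hx).ennreal_ofReal
    (Eventually.of_forall fun _ => ENNReal.ofReal_lt_top) _ hS]
  simp_rw [ENNReal.toReal_ofReal (h.density_nonneg x hx _), smul_eq_mul]

lemma ae_ne_zero (h : IsJumpOperator Ω μ j σ Cj ρ Λ) : ∀ᵐ z : Space N, z ≠ 0 := by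
  have : Nonempty (Fin N) := ⟨⟨0, h.dim_pos⟩⟩
  simp [ae_iff]

/-- The integrand of the outer part, with respect to Lebesgue measure. -/
noncomputable def integrand (Ω : Set (Space N)) (j : Space N → Space N → Space N)
    (ρ : Space N → Space N → ℝ) (ξ : ℝ) (w : Space N → ℝ) (x : Space N) : Space N → ℝ :=
  (jumpSet Ω j ξ x).indicator fun z => ρ x z * (w (x + j x z) - w x)

lemma outerPart_eq (h : IsJumpOperator Ω μ j σ Cj ρ Λ) {x : Space N} (hx : x ∈ closure Ω)
    (ξ : ℝ) (w : Space N → ℝ) :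
    outerPart Ω μ j ξ w x = ∫ z, integrand Ω j ρ ξ w x z := by
  unfold outerPart integrand
  rw [integral_indicator (h.measurableSet_jumpSet hx ξ)]
  exact h.setIntegral_eq hx (h.measurableSet_jumpSet hx ξ) _

lemma integrable_integrand (h : IsJumpOperator Ω μ j σ Cj ρ Λ) {x : Space N}
    (hx : x ∈ closure Ω) {ξ : ℝ} (hξ : 0 < ξ) {w : Space N → ℝ}
    (hw : Measurable ((closure Ω).indicator w)) {K : ℝ} (hK : ∀ y ∈ closure Ω, |w y| ≤ K) :
    Integrable (integrand Ω j ρ ξ w x) := by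
  have hS := h.measurableSet_jumpSet hx ξ
  have hmeas : Measurable (integrand Ω j ρ ξ w x) := by
    have : integrand Ω j ρ ξ w x = (jumpSet Ω j ξ x).indicator fun z =>
        ρ x z * ((closure Ω).indicator w (x + j x z) - w x) := by
      unfold integrand
      refine indicator_congr fun z hz => ?_
      rw [indicator_of_mem hz.2]
    rw [this]
    have hj := (h.continuous_jump x hx).measurable
    have hρ := h.measurable_density x hx
    exact (hρ.mul ((hw.comp (measurable_const.add hj)).sub measurable_const)).indicator hS
  have hi := (integrable_weight_mul_kernel (N := N) h.dim_pos h.order_pos h.order_lt_one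
    (inv_pos.2 hξ)).const_mul (Λ * (2 * K))
  have hK0 : 0 ≤ K := (abs_nonneg _).trans (hK x hx)
  have hΛ := h.one_le
  refine hi.mono' hmeas.aestronglyMeasurable ?_
  filter_upwards [h.ae_ne_zero] with z hz
  have hk := kernel_nonneg σ z
  have hw0 : 0 ≤ weight ξ⁻¹ z := weight_nonneg (by positivity) z
  unfold integrand
  by_cases hzS : z ∈ jumpSet Ω j ξ x
  · rw [indicator_of_mem hzS]
    have hwt : weight ξ⁻¹ z = 1 := by
      unfold weight
      exact min_eq_right (by rw [le_inv_mul_iff₀ hξ]; simpa using hzS.1)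
    rw [hwt, one_mul, norm_mul, Real.norm_eq_abs, Real.norm_eq_abs,
      abs_of_nonneg (h.density_nonneg x hx z)]
    have h1 := h.density_le x hx z hz
    have h2 : |w (x + j x z) - w x| ≤ 2 * K :=
      (abs_sub _ _).trans (by linarith [hK _ hzS.2, hK x hx])
    calc _ ≤ (Λ * kernel N σ z) * (2 * K) := by gcongr
      _ = _ := by ring
  · rw [indicator_of_notMem hzS, norm_zero]
    positivity

/-- For `σ < 1` the weight `|z|` already makes the kernel integrable at the origin, so a first-order
bound on the increment suffices and the inner part vanishes as `ξ → 0`. -/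
lemma abs_innerPart_le (h : IsJumpOperator Ω μ j σ Cj ρ Λ) {x : Space N} (hx : x ∈ closure Ω)
    {ξ : ℝ} (hξ : 0 < ξ) {φ : Space N → ℝ} {L : ℝ} (hL : 0 ≤ L)
    (hφ : ∀ z, ‖z‖ < ξ → |φ (x + j x z) - φ x| ≤ L * ‖z‖) :
    |innerPart Ω μ j ξ φ x| ≤ L * Λ * kernelMass N σ * ξ ^ (1 - σ) := by
  have h1 : MeasurableSet {z : Space N | ‖z‖ < ξ} :=
    measurableSet_lt measurable_norm measurable_const
  have hS : MeasurableSet {z | ‖z‖ < ξ ∧ x + j x z ∈ closure Ω} :=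
    h1.inter (h.measurableSet_admissible hx)
  obtain ⟨hi, hle⟩ := integrableOn_norm_mul_kernel_and_le (N := N) h.dim_pos h.order_pos
    h.order_lt_one hξ
  have hΛ := h.one_le
  unfold innerPart
  rw [h.setIntegral_eq hx hS, ← Real.norm_eq_abs]
  have hi' : IntegrableOn (fun z : Space N => L * Λ * (‖z‖ * kernel N σ z)) {z | ‖z‖ < ξ} :=
    hi.const_mul (L * Λ)
  calc _ ≤ ∫ z in {z | ‖z‖ < ξ ∧ x + j x z ∈ closure Ω}, L * Λ * (‖z‖ * kernel N σ z) := by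
        refine norm_integral_le_of_norm_le (hi'.mono_set fun z hz => hz.1) ?_
        filter_upwards [ae_restrict_mem hS, ae_restrict_of_ae h.ae_ne_zero] with z hz hz0
        rw [norm_mul, Real.norm_eq_abs, Real.norm_eq_abs,
          abs_of_nonneg (h.density_nonneg x hx z)]
        have hk := kernel_nonneg σ z
        calc _ ≤ (Λ * kernel N σ z) * (L * ‖z‖) := by
              gcongr
              · exact h.density_le x hx z hz0
              · exact hφ z hz.1
          _ = _ := by ring
    _ ≤ ∫ z in {z : Space N | ‖z‖ < ξ}, L * Λ * (‖z‖ * kernel N σ z) := by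
        refine setIntegral_mono_set hi' (Eventually.of_forall fun z => ?_)
          (Eventually.of_forall fun z hz => hz.1)
        have := kernel_nonneg σ z
        show 0 ≤ L * Λ * (‖z‖ * kernel N σ z)
        positivity
    _ ≤ _ := by
        rw [integral_const_mul]
        calc _ ≤ L * Λ * (ξ ^ (1 - σ) * kernelMass N σ) := by gcongr
          _ = _ := by ring

/-- The bound does not depend on the truncation `ξ`; it needs only a one-sided control of the
increments and not the regularity of `w`. -/
lemma outerPart_le (h : IsJumpOperator Ω μ j σ Cj ρ Λ) {x : Space N} (hx : x ∈ closure Ω)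
    {ξ : ℝ} (hξ : 0 < ξ) {w : Space N → ℝ}
    (hw : Measurable ((closure Ω).indicator w)) {K : ℝ} (hK : ∀ y ∈ closure Ω, |w y| ≤ K)
    {a B : ℝ} (ha : 0 < a) (hB : 0 ≤ B)
    (hwB : ∀ z, x + j x z ∈ closure Ω → w (x + j x z) - w x ≤ B * weight a z) :
    outerPart Ω μ j ξ w x ≤ B * Λ * kernelMass N σ * a ^ σ := by
  have hi := (integrable_weight_mul_kernel (N := N) h.dim_pos h.order_pos h.order_lt_one
    ha).const_mul (B * Λ)
  have hΛ := h.one_le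
  rw [h.outerPart_eq hx]
  calc _ ≤ ∫ z, B * Λ * (weight a z * kernel N σ z) := by
        refine integral_mono_ae (h.integrable_integrand hx hξ hw hK) hi ?_
        filter_upwards [h.ae_ne_zero] with z hz
        have hk := kernel_nonneg σ z
        have hw0 : 0 ≤ weight a z := weight_nonneg ha.le z
        unfold integrand
        by_cases hzS : z ∈ jumpSet Ω j ξ x
        · rw [indicator_of_mem hzS]
          calc _ ≤ ρ x z * (B * weight a z) := by
                gcongr
                · exact h.density_nonneg x hx z
                · exact hwB z hzS.2
            _ ≤ (Λ * kernel N σ z) * (B * weight a z) := by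
                gcongr; exact h.density_le x hx z hz
            _ = _ := by ring
        · rw [indicator_of_notMem hzS]; positivity
    _ = _ := by
        rw [integral_const_mul, integral_weight_mul_kernel ha]; ring

/-- Comparison of the outer parts of two functions at two points. -/
lemma outerPart_sub_outerPart_le (h : IsJumpOperator Ω μ j σ Cj ρ Λ) {x y : Space N}
    (hx : x ∈ closure Ω) (hy : y ∈ closure Ω) {ξ : ℝ} (hξ : 0 < ξ) {u v : Space N → ℝ}
    (hu : Measurable ((closure Ω).indicator u)) (hv : Measurable ((closure Ω).indicator v))
    {K : ℝ} (huK : ∀ y ∈ closure Ω, |u y| ≤ K) (hvK : ∀ y ∈ closure Ω, |v y| ≤ K)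
    {a b c B : ℝ} (ha : 0 < a) (hb : 0 < b) (hc : 0 < c) (hB : 0 ≤ B)
    (hU : ∀ z, x + j x z ∈ closure Ω → u (x + j x z) - u x ≤ B * weight a z)
    (hV : ∀ z, y + j y z ∈ closure Ω → v y - v (y + j y z) ≤ B * weight a z)
    (hT : ∀ z, x + j x z ∈ closure Ω → y + j y z ∈ closure Ω →
      (u (x + j x z) - u x) - (v (y + j y z) - v y) ≤ B * weight b z + B * weight c z) :
    outerPart Ω μ j ξ u x - outerPart Ω μ j ξ v y ≤
      B * Λ * kernelMass N σ * (b ^ σ + c ^ σ + ‖x - y‖ * a ^ σ) +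
      B * Λ * ∫ z in mismatch Ω j x y, weight a z * kernel N σ z := by
  have hint : ∀ {a : ℝ}, 0 < a → Integrable (fun z : Space N => weight a z * kernel N σ z) :=
    fun ha => integrable_weight_mul_kernel h.dim_pos h.order_pos h.order_lt_one ha
  have hΛ := h.one_le
  have hMm := h.measurableSet_mismatch hx hy
  rw [h.outerPart_eq hx, h.outerPart_eq hy, ← integral_sub (h.integrable_integrand hx hξ hu huK)
    (h.integrable_integrand hy hξ hv hvK)]
  have hR : Integrable fun z : Space N => (B * Λ) * ((weight b z * kernel N σ z) +
      (weight c z * kernel N σ z) + ‖x - y‖ * (weight a z * kernel N σ z) +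
      (mismatch Ω j x y).indicator (fun z => weight a z * kernel N σ z) z) :=
    ((((hint hb).add (hint hc)).add ((hint ha).const_mul _)).add
      ((hint ha).indicator hMm)).const_mul _
  calc _ ≤ ∫ z : Space N, (B * Λ) * ((weight b z * kernel N σ z) +
      (weight c z * kernel N σ z) + ‖x - y‖ * (weight a z * kernel N σ z) +
      (mismatch Ω j x y).indicator (fun z => weight a z * kernel N σ z) z) := by
        refine integral_mono_ae ((h.integrable_integrand hx hξ hu huK).sub
          (h.integrable_integrand hy hξ hv hvK)) hR ?_
        filter_upwards [h.ae_ne_zero] with z hz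
        have hk := kernel_nonneg σ z
        have hwa : 0 ≤ weight a z := weight_nonneg ha.le z
        have hwb : 0 ≤ weight b z := weight_nonneg hb.le z
        have hwc : 0 ≤ weight c z := weight_nonneg hc.le z
        have hrx := h.density_nonneg x hx z
        have hry := h.density_nonneg y hy z
        have hrx' := h.density_le x hx z hz
        have hry' := h.density_le y hy z hz
        have hd := abs_le.1 (h.density_sub_le x hx y hy z hz)
        have hmis0 : 0 ≤ (mismatch Ω j x y).indicator (fun z => weight a z * kernel N σ z) z :=
          indicator_nonneg (fun z _ => mul_nonneg (weight_nonneg ha.le z) (kernel_nonneg σ z)) z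
        have hP : 0 ≤ B * weight a z := by positivity
        have hT0 : 0 ≤ B * weight b z + B * weight c z := by positivity
        have e1 : 0 ≤ (B * Λ) * (weight b z * kernel N σ z + weight c z * kernel N σ z) := by
          positivity
        have e2 : 0 ≤ (B * Λ) * (‖x - y‖ * (weight a z * kernel N σ z)) := by positivity
        have e3 := mul_nonneg (mul_nonneg hB (by linarith : 0 ≤ Λ)) hmis0
        have g1 : ρ x z * (B * weight a z) ≤ (Λ * kernel N σ z) * (B * weight a z) := by gcongr
        have g2 : ρ y z * (B * weight a z) ≤ (Λ * kernel N σ z) * (B * weight a z) := by gcongr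
        show integrand Ω j ρ ξ u x z - integrand Ω j ρ ξ v y z ≤ _
        unfold integrand
        by_cases hzx : z ∈ jumpSet Ω j ξ x <;> by_cases hzy : z ∈ jumpSet Ω j ξ y
        · rw [indicator_of_mem hzx, indicator_of_mem hzy]
          have t1 := hT z hzx.2 hzy.2
          have t2 := hU z hzx.2
          have t3 := hV z hzy.2
          set U := u (x + j x z) - u x
          set V := v (y + j y z) - v y
          have g3 : (B * weight b z + B * weight c z) * ρ x z ≤
              (B * weight b z + B * weight c z) * (Λ * kernel N σ z) := by gcongr
          have g4 : (B * weight b z + B * weight c z) * ρ y z ≤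
              (B * weight b z + B * weight c z) * (Λ * kernel N σ z) := by gcongr
          -- With `U`, `V` the increments, write `ρ x U - ρ y V` as the smaller density times `U -
          -- V` plus a remainder. The remainder is `-V` or `U` times the nonnegative difference of
          -- the densities, so the one-sided bounds `hU`, `hV` are enough.
          rcases le_total (ρ x z) (ρ y z) with hle | hle
          · have k1 : (U - V) * ρ x z ≤ (B * weight b z + B * weight c z) * ρ x z := by gcongr
            have k2 : (-V) * (ρ y z - ρ x z) ≤ (B * weight a z) * (ρ y z - ρ x z) :=
              mul_le_mul_of_nonneg_right (by simp only [V]; linarith) (by linarith)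
            have k3 : (B * weight a z) * (ρ y z - ρ x z) ≤
                (B * weight a z) * (Λ * ‖x - y‖ * kernel N σ z) :=
              mul_le_mul_of_nonneg_left (by linarith) hP
            nlinarith
          · have k1 : (U - V) * ρ y z ≤ (B * weight b z + B * weight c z) * ρ y z := by gcongr
            have k2 : U * (ρ x z - ρ y z) ≤ (B * weight a z) * (ρ x z - ρ y z) :=
              mul_le_mul_of_nonneg_right t2 (by linarith)
            have k3 : (B * weight a z) * (ρ x z - ρ y z) ≤
                (B * weight a z) * (Λ * ‖x - y‖ * kernel N σ z) :=
              mul_le_mul_of_nonneg_left (by linarith) hP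
            nlinarith
        · rw [indicator_of_mem hzx, indicator_of_notMem hzy, indicator_of_mem
            (show z ∈ mismatch Ω j x y from fun hiff => hzy ⟨hzx.1, hiff.1 hzx.2⟩)]
          have t2 := mul_le_mul_of_nonneg_left (hU z hzx.2) hrx
          nlinarith
        · rw [indicator_of_notMem hzx, indicator_of_mem hzy, indicator_of_mem
            (show z ∈ mismatch Ω j x y from fun hiff => hzx ⟨hzy.1, hiff.2 hzy.2⟩)]
          have t2 := mul_le_mul_of_nonneg_left (hV z hzy.2) hry
          nlinarith
        · rw [indicator_of_notMem hzx, indicator_of_notMem hzy]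
          nlinarith
    _ = _ := by
        have i2 : Integrable fun z : Space N => weight b z * kernel N σ z +
          weight c z * kernel N σ z := (hint hb).add (hint hc)
        have i3 : Integrable fun z : Space N => weight b z * kernel N σ z +
          weight c z * kernel N σ z + ‖x - y‖ * (weight a z * kernel N σ z) :=
          i2.add ((hint ha).const_mul _)
        rw [integral_const_mul, integral_add i3 ((hint ha).indicator hMm),
          integral_add i2 ((hint ha).const_mul _), integral_add (hint hb) (hint hc), integral_const_mul, integral_indicator hMm,
          integral_weight_mul_kernel ha, integral_weight_mul_kernel hb,
          integral_weight_mul_kernel hc]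
        ring

end IsJumpOperator

/-! ### Local form of the viscosity inequalities -/

/-- Multiplication by a bump function. It is needed because the penalizations and the localizer are
smooth only near the points where they are tested. -/
lemma exists_contDiff_eventuallyEq {N : ℕ} {φ : Space N → ℝ} {x : Space N}
    (hφ : ContDiffAt ℝ 1 φ x) : ∃ f : Space N → ℝ, ContDiff ℝ 1 f ∧ f =ᶠ[𝓝 x] φ := by
  obtain ⟨s, hs, hφs⟩ := hφ.contDiffOn le_rfl (by simp)
  obtain ⟨ε, hε, hsub⟩ := Metric.mem_nhds_iff.1 hs
  let b : ContDiffBump x := ⟨ε / 4, ε / 2, by positivity, by linarith⟩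
  refine ⟨fun y => b y * φ y, ?_, ?_⟩
  · rw [contDiff_iff_contDiffAt]
    intro y
    by_cases hy : y ∈ Metric.ball x ε
    · exact b.contDiffAt.mul (hφs.contDiffAt (mem_of_superset
        (Metric.isOpen_ball.mem_nhds hy) hsub))
    · have hz : (fun y => b y * φ y) =ᶠ[𝓝 y] fun _ => 0 := by
        have hy' : y ∈ (Metric.closedBall x (ε / 2))ᶜ := by
          rw [Metric.mem_ball, not_lt] at hy
          simp only [mem_compl_iff, Metric.mem_closedBall, not_le]
          linarith
        filter_upwards [Metric.isClosed_closedBall.isOpen_compl.mem_nhds hy'] with w hw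
        rw [b.zero_of_le_dist (le_of_lt (by simpa using hw)), zero_mul]
      exact contDiffAt_const.congr_of_eventuallyEq hz
  · filter_upwards [b.eventuallyEq_one] with y hy
    rw [hy]; simp

/-- The definition tests global `C¹` functions on balls of radius `Cj * ξ`. As `ξ → 0` only the germ
of the test function matters and its inner part disappears, so local smoothness and a local maximum
suffice, at the price of an arbitrarily small `e`. -/
lemma IsViscositySubsolution.eventually_le {N : ℕ} {Ω : Set (Space N)}
    {μ : Space N → Measure (Space N)} {j : Space N → Space N → Space N} {σ Cj Λ : ℝ}
    {ρ : Space N → Space N → ℝ} (h : IsJumpOperator Ω μ j σ Cj ρ Λ)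
    {H : Space N → Space N → ℝ} {u : Space N → ℝ}
    (hu : IsViscositySubsolution Ω μ j Cj H u) {x : Space N} (hx : x ∈ closure Ω)
    {φ : Space N → ℝ} (hφ : ContDiffAt ℝ 1 φ x)
    (hmax : ∀ᶠ y in 𝓝[closure Ω] x, u y - φ y ≤ u x - φ x)
    (hn : x ∈ frontier Ω → 0 < normalDeriv Ω φ x) {e : ℝ} (he : 0 < e) :
    ∀ᶠ ξ in 𝓝[>] (0 : ℝ), u x - outerPart Ω μ j ξ u x + H x (gradient φ x) ≤ e := by
  obtain ⟨f, hf, hfφ⟩ := exists_contDiff_eventuallyEq hφ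
  obtain ⟨K, t, ht, hKt⟩ := hf.contDiffAt (x := x) |>.exists_lipschitzOnWith
  have hev : ∀ᶠ y in 𝓝 x, (y ∈ closure Ω → u y - φ y ≤ u x - φ x) ∧ f y = φ y ∧ y ∈ t :=
    (eventually_nhdsWithin_iff.1 hmax).and (hfφ.and ht)
  obtain ⟨ε, hε, hball⟩ := Metric.eventually_nhds_iff_ball.1 hev
  have hxx := (hball x (Metric.mem_ball_self hε)).2
  have hgrad : gradient f x = gradient φ x := hfφ.gradient_eq
  have hΛ := h.one_le
  have hlim : Tendsto (fun ξ : ℝ => (K * Λ) * Λ * kernelMass N σ * ξ ^ (1 - σ)) (𝓝[>] 0) (𝓝 0) := by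
    have h1 : Tendsto (fun ξ : ℝ => ξ ^ (1 - σ)) (𝓝 0) (𝓝 0) :=
      (Real.continuous_rpow_const (by linarith [h.order_lt_one])).tendsto' 0 0
        (Real.zero_rpow (by linarith [h.order_lt_one]))
    simpa using (h1.mono_left nhdsWithin_le_nhds).const_mul ((K * Λ) * Λ * kernelMass N σ)
  have hsmall : ∀ᶠ ξ in 𝓝[>] (0 : ℝ), ξ < ε / (2 * Λ) :=
    mem_nhdsWithin_of_mem_nhds (Iio_mem_nhds (by positivity))
  filter_upwards [hlim.eventually_lt_const he, hsmall, self_mem_nhdsWithin] with ξ h1 h2 h3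
  have hξ : 0 < ξ := h3
  have hΛξ : Λ * ξ < ε := by
    rw [lt_div_iff₀ (by positivity)] at h2
    nlinarith
  have hCξ : Cj * ξ < ε := lt_of_le_of_lt (by gcongr; exact h.const_le) hΛξ
  have hM : IsMaxOn (fun y => u y - f y) (Metric.closedBall x (Cj * ξ) ∩ closure Ω) x := by
    rintro y ⟨hyb, hyc⟩
    have := hball y (lt_of_le_of_lt hyb hCξ)
    show u y - f y ≤ u x - f x
    rw [this.2.1, hxx.1]
    exact this.1 hyc
  obtain ⟨hin, hbd⟩ := hu.2.2 f hf ξ hξ x hx hM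
  have hF : testF Ω μ j H ξ f u x ≤ 0 := by
    by_cases hxΩ : x ∈ Ω
    · exact hin hxΩ
    · have hxf : x ∈ frontier Ω := ⟨hx, fun h' => hxΩ (interior_subset h')⟩
      have h4 := hn hxf
      have h5 := hbd hxf
      have h6 : normalDeriv Ω f x = normalDeriv Ω φ x := by unfold normalDeriv; rw [hgrad]
      -- The normal derivative is strictly positive here, so the boundary alternative is impossible
      -- and the equation holds at `x`.
      rw [h6, min_le_iff] at h5
      rcases h5 with h5 | h5
      · exact h5
      · linarith
  have hinner := h.abs_innerPart_le hx hξ (φ := f) (L := K * Λ) (by positivity) (by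
    intro z hz
    have hj := h.norm_jump_le hx z
    have hlt : ‖j x z‖ < ε := hj.trans_lt (lt_of_le_of_lt (by gcongr) hΛξ)
    have := hKt.dist_le_mul (x + j x z) (hball _ (by simpa [dist_eq_norm] using hlt)).2.2 x hxx.2
    rw [Real.dist_eq, dist_eq_norm, add_sub_cancel_left] at this
    calc _ ≤ _ := this
      _ ≤ K * (Λ * ‖z‖) := by gcongr
      _ = _ := by ring)
  unfold testF at hF
  rw [hgrad] at hF
  have := (abs_le.1 hinner).2
  linarith

lemma gradient_fun_neg {N : ℕ} (f : Space N → ℝ) (x : Space N) :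
    gradient (fun y => - f y) x = - gradient f x := by
  unfold gradient
  rw [← map_neg]
  congr 1
  exact fderiv_neg

/-- Lets every one-sided estimate be proved for subsolutions only. The reflected Hamiltonian loses
its structure, but those estimates do not use it. -/
lemma IsViscositySupersolution.neg {N : ℕ} {Ω : Set (Space N)}
    {μ : Space N → Measure (Space N)} {j : Space N → Space N → Space N} {Cj : ℝ}
    {H : Space N → Space N → ℝ} {v : Space N → ℝ}
    (hv : IsViscositySupersolution Ω μ j Cj H v) :
    IsViscositySubsolution Ω μ j Cj (fun x p => - H x (-p)) (fun x => - v x) := by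
  obtain ⟨⟨K, hK⟩, hlsc, hv⟩ := hv
  refine ⟨⟨K, fun x hx => by rw [abs_neg]; exact hK x hx⟩, ?_, ?_⟩
  · intro x hx a ha
    filter_upwards [hlsc x hx (-a) (by linarith)] with y hy
    linarith
  · intro φ hφ ξ hξ x hx hmax
    have hmin : IsMinOn (fun y => v y - - φ y)
        (Metric.closedBall x (Cj * ξ) ∩ closure Ω) x := by
      intro y hy
      have := hmax hy
      simp only [mem_ofPred_eq] at this ⊢
      linarith
    have key := hv (fun y => - φ y) hφ.neg ξ hξ x hx hmin
    have hF : testF Ω μ j (fun x p => - H x (-p)) ξ φ (fun x => - v x) x =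
        - testF Ω μ j H ξ (fun y => - φ y) v x := by
      have e1 : innerPart Ω μ j ξ (fun y => - φ y) x = - innerPart Ω μ j ξ φ x := by
        unfold innerPart
        rw [← integral_neg]
        congr 1; ext z; ring
      have e2 : outerPart Ω μ j ξ (fun y => - v y) x = - outerPart Ω μ j ξ v x := by
        unfold outerPart
        rw [← integral_neg]
        congr 1; ext z; ring
      unfold testF
      rw [e1, e2, gradient_fun_neg]
      ring
    have hnd : normalDeriv Ω (fun y => - φ y) x = - normalDeriv Ω φ x := by
      unfold normalDeriv
      rw [gradient_fun_neg, inner_neg_left]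
    refine ⟨fun hxΩ => by rw [hF]; linarith [key.1 hxΩ], fun hxf => ?_⟩
    have := key.2 hxf
    rw [hnd, le_max_iff] at this
    rw [hF, min_le_iff]
    rcases this with h | h
    · left; linarith
    · right; linarith

/-! ### Jumps admissible from only one of two nearby points -/

/-- The scale below which jumps are negligible at the gradient size `n`. -/
noncomputable def smallScale (σ n : ℝ) : ℝ := n ^ (-2 / (1 - σ))

/-- The smoothing parameter of the penalization at the gradient size `n`. -/
noncomputable def smoothScale (σ n : ℝ) : ℝ := smallScale σ n / n ^ 2

lemma smallScale_pos {σ n : ℝ} (hn : 0 < n) : 0 < smallScale σ n := Real.rpow_pos_of_pos hn _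

lemma smoothScale_pos {σ n : ℝ} (hn : 0 < n) : 0 < smoothScale σ n :=
  div_pos (smallScale_pos hn) (by positivity)

/-- This identity dictates the exponent of `smallScale`: up to a constant the left side bounds the
mass of `min(n|z|,1)|z|^{-(N+σ)}` over `|z| < smallScale σ n`, which must tend to zero. -/
lemma smallScale_rpow {σ n : ℝ} (h1 : σ < 1) (hn : 0 < n) :
    n * smallScale σ n ^ (1 - σ) = n⁻¹ := by
  have : 1 - σ ≠ 0 := by linarith
  rw [smallScale, ← Real.rpow_mul hn.le, div_mul_cancel₀ _ this, Real.rpow_neg hn.le,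
    Real.rpow_two]
  field_simp

lemma smoothScale_le {σ n : ℝ} (h1 : σ < 1) (hn : 1 ≤ n) : smoothScale σ n ≤ (n ^ 2)⁻¹ := by
  have h : smallScale σ n ≤ 1 := Real.rpow_le_one_of_one_le_of_nonpos hn
    (div_nonpos_of_nonpos_of_nonneg (by norm_num) (by linarith))
  rw [smoothScale, div_eq_mul_inv]
  exact mul_le_of_le_one_left (by positivity) h

/-! ### First- and second-order estimates for the local distance. -/

namespace IsLocalDistance

variable {N : ℕ} {Ω : Set (Space N)} {x₁ : Space N} {r L : ℝ} {d : Space N → ℝ}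

lemma differentiableAt (hd : IsLocalDistance Ω x₁ r L d) {x : Space N}
    (hx : x ∈ Metric.ball x₁ r) : DifferentiableAt ℝ d x :=
  (hd.contDiffOn.differentiableOn one_ne_zero).differentiableAt (Metric.isOpen_ball.mem_nhds hx)

/-- The map `t ↦ d (t + h) - d t` has derivative at most `L‖h‖` because the gradient is Lipschitz,
on the convex set where both points stay in the ball; replacing `h` by `h'` at `y` costs `L‖h -
h'‖`. -/
lemma abs_second_difference_le (hd : IsLocalDistance Ω x₁ r L d) {x y h h' : Space N}
    (hx : x ∈ Metric.ball x₁ r) (hy : y ∈ Metric.ball x₁ r) (hxh : x + h ∈ Metric.ball x₁ r)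
    (hyh : y + h ∈ Metric.ball x₁ r) (hyh' : y + h' ∈ Metric.ball x₁ r) :
    |(d (x + h) - d (y + h')) - (d x - d y)| ≤ L * ‖h‖ * ‖x - y‖ + L * ‖h - h'‖ := by
  have hmem : ∀ t : Space N, t ∈ Metric.ball (x₁ - h) r → t + h ∈ Metric.ball x₁ r := by
    intro t ht
    rw [Metric.mem_ball, dist_eq_norm] at ht ⊢
    rwa [show t + h - x₁ = t - (x₁ - h) by abel]
  have hmem' : ∀ t : Space N, t + h ∈ Metric.ball x₁ r → t ∈ Metric.ball (x₁ - h) r := by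
    intro t ht
    rw [Metric.mem_ball, dist_eq_norm] at ht ⊢
    rwa [show t - (x₁ - h) = t + h - x₁ by abel]
  have h1 : |(d (x + h) - d x) - (d (y + h) - d y)| ≤ L * ‖h‖ * ‖x - y‖ := by
    have hder : ∀ t ∈ Metric.ball x₁ r ∩ Metric.ball (x₁ - h) r,
        HasFDerivAt (fun t => d (t + h) - d t) (fderiv ℝ d (t + h) - fderiv ℝ d t) t := by
      rintro t ⟨ht1, ht2⟩
      exact ((hasFDerivAt_comp_add_right h).2
        (hd.differentiableAt (hmem t ht2)).hasFDerivAt).sub (hd.differentiableAt ht1).hasFDerivAt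
    refine ((convex_ball x₁ r).inter (convex_ball (x₁ - h) r)).norm_image_sub_le_of_norm_fderiv_le
      (𝕜 := ℝ) (f := fun t => d (t + h) - d t) (fun t ht => (hder t ht).differentiableAt) ?_
      ⟨hy, hmem' y hyh⟩ ⟨hx, hmem' x hxh⟩
    intro t ht
    rw [(hder t ht).fderiv, ← norm_gradient_sub]
    simpa using hd.lip (t + h) (hmem t ht.2) t ht.1
  have h2 : |d (y + h) - d (y + h')| ≤ L * ‖h - h'‖ := by
    have := (convex_ball x₁ r).norm_image_sub_le_of_norm_fderiv_le (𝕜 := ℝ) (f := d) (C := L)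
      (fun t ht => hd.differentiableAt ht)
      (fun t ht => by rw [← norm_gradient]; exact hd.bound t ht) hyh' hyh
    simpa using this
  rw [abs_le] at h1 h2 ⊢
  constructor <;> linarith [h1.1, h1.2, h2.1, h2.2]

/-- First-order expansion of `d` from a boundary point: `d x = 0 ≤ d y`, and the error is quadratic.
It shows that `x - y` points almost outwards when `x` is on the boundary. -/
lemma inner_gradient_ge (hd : IsLocalDistance Ω x₁ r L d) {x y : Space N}
    (hx : x ∈ Metric.ball x₁ r) (hy : y ∈ Metric.ball x₁ r) (hxf : x ∈ frontier Ω)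
    (hyc : y ∈ closure Ω) : - (L * ‖x - y‖ ^ 2) ≤ inner ℝ (gradient d x) (y - x) := by
  have hder : ∀ t ∈ Metric.ball x₁ r,
      HasFDerivAt (fun t => d t - fderiv ℝ d x t) (fderiv ℝ d t - fderiv ℝ d x) t := fun t ht =>
    (hd.differentiableAt ht).hasFDerivAt.sub (fderiv ℝ d x).hasFDerivAt
  -- On this smaller convex set the gradient differs from its value at `x` by at most `L * ‖x - y‖`.
  set s := Metric.ball x₁ r ∩ Metric.closedBall x ‖x - y‖ with hs
  have hmv := ((convex_ball x₁ r).inter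
    (convex_closedBall x ‖x - y‖)).norm_image_sub_le_of_norm_fderiv_le
      (𝕜 := ℝ) (f := fun t => d t - fderiv ℝ d x t) (C := L * ‖x - y‖)
      (fun t ht => (hder t ht.1).differentiableAt) (fun t ht => by
        rw [(hder t ht.1).fderiv, ← norm_gradient_sub]
        refine (hd.lip t ht.1 x hx).trans ?_
        have := hd.nonneg_const
        gcongr
        rw [← dist_eq_norm]
        exact ht.2)
      (show x ∈ _ from ⟨hx, Metric.mem_closedBall_self (norm_nonneg _)⟩)
      (show y ∈ _ from ⟨hy, by rw [Metric.mem_closedBall, dist_comm, dist_eq_norm]⟩)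
  have hg : inner ℝ (gradient d x) (y - x) = fderiv ℝ d x (y - x) := by
    unfold gradient; rw [InnerProductSpace.toDual_symm_apply]
  rw [hg, map_sub]
  rw [Real.norm_eq_abs, abs_le, norm_sub_rev y x] at hmv
  have h1 := hd.eq_zero x hx hxf
  have h2 := hd.nonneg y hyc
  nlinarith [hmv.2]

end IsLocalDistance

/-! ### Smallness of the integral over mismatched jumps. -/

section Mismatch

variable {N : ℕ} {Ω : Set (Space N)} {μ : Space N → Measure (Space N)}
  {j : Space N → Space N → Space N} {σ Cj Λ : ℝ} {ρ : Space N → Space N → ℝ}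
  {x₁ : Space N} {r L : ℝ} {d : Space N → ℝ}

lemma abs_second_difference_jump_le (h : IsJumpOperator Ω μ j σ Cj ρ Λ)
    (hd : IsLocalDistance Ω x₁ r L d) {x y z : Space N} (hx : x ∈ closure Ω) (hy : y ∈ closure Ω)
    {s : ℝ} (hxs : dist x x₁ < s) (hys : dist y x₁ < s) (hz : s + Λ * ‖z‖ ≤ r) :
    |(d (x + j x z) - d (y + j y z)) - (d x - d y)| ≤ 2 * L * Λ * ‖z‖ * ‖x - y‖ := by
  have hL := hd.nonneg_const
  have hΛ := h.one_le
  have h1 := h.norm_jump_le hx z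
  have h2 := h.norm_jump_le hy z
  have hb : ∀ p q : Space N, dist p x₁ < s → ‖q‖ ≤ Λ * ‖z‖ → p + q ∈ Metric.ball x₁ r := by
    intro p q hp hq
    rw [Metric.mem_ball]
    have := dist_triangle (p + q) p x₁
    rw [dist_eq_norm (p + q) p, add_sub_cancel_left] at this
    linarith
  have hsr : s ≤ r := by
    have : 0 ≤ Λ * ‖z‖ := by positivity
    linarith
  refine (hd.abs_second_difference_le (hxs.trans_le hsr) (hys.trans_le hsr) (hb x _ hxs h1)
    (hb y _ hys h1) (hb y _ hys h2)).trans ?_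
  have h3 := h.jump_sub_le x hx y hy z
  calc _ ≤ L * (Λ * ‖z‖) * ‖x - y‖ + L * (Λ * ‖z‖ * ‖x - y‖) := by gcongr
    _ = _ := by ring

/-- The two landing points lie on different sides of the boundary, so `d` has opposite weak signs
there and each value is bounded by the difference, which the second-difference estimate compares
with `d x - d y`. -/
lemma abs_le_of_mem_mismatch (h : IsJumpOperator Ω μ j σ Cj ρ Λ)
    (hd : IsLocalDistance Ω x₁ r L d) {x y z : Space N} (hx : x ∈ closure Ω) (hy : y ∈ closure Ω)
    {s : ℝ} (hxs : dist x x₁ < s) (hys : dist y x₁ < s) (hz : s + Λ * ‖z‖ ≤ r)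
    (hm : z ∈ mismatch Ω j x y) :
    |d (y + j y z)| ≤ |d x - d y| + 2 * L * Λ * ‖z‖ * ‖x - y‖ := by
  have h0 := abs_second_difference_jump_le h hd hx hy hxs hys hz
  have hb : ∀ p q : Space N, dist p x₁ < s → ‖q‖ ≤ Λ * ‖z‖ → p + q ∈ Metric.ball x₁ r := by
    intro p q hp hq
    rw [Metric.mem_ball]
    have := dist_triangle (p + q) p x₁
    rw [dist_eq_norm (p + q) p, add_sub_cancel_left] at this
    linarith
  have hbx := hb x _ hxs (h.norm_jump_le hx z)
  have hby := hb y _ hys (h.norm_jump_le hy z)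
  have h3 := abs_le.1 h0
  have h4 := abs_le.1 (le_refl |d x - d y|)
  by_cases hxc : x + j x z ∈ closure Ω
  · have hyc : y + j y z ∉ closure Ω := fun hyc => hm ⟨fun _ => hyc, fun _ => hxc⟩
    have := hd.nonneg _ hxc
    have := hd.nonpos _ hby hyc
    rw [abs_of_nonpos this]
    linarith [h3.2, h4.2]
  · have hyc : y + j y z ∈ closure Ω := by
      by_contra hyc
      exact hm ⟨fun h => (hxc h).elim, fun h => (hyc h).elim⟩
    have := hd.nonneg _ hyc
    have := hd.nonpos _ hbx hxc
    rw [abs_of_nonneg (hd.nonneg _ hyc)]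
    linarith [h3.1, h4.1]

/-- The set is the image under the Lipschitz inverse of the jump map of a geometric strip of radius
`Λ * s`; the relative width becomes `w / Λ`. -/
lemma volume_strip_jump_le (h : IsJumpOperator Ω μ j σ Cj ρ Λ)
    (hd : IsLocalDistance Ω x₁ r L d) {y : Space N} (hy : y ∈ closure Ω)
    (hyb : y ∈ Metric.ball x₁ r) {s w : ℝ} (hs : 0 < s) (hsr : Λ * s ≤ r) (hw : 0 ≤ w) :
    volume {z : Space N | ‖z‖ ≤ s ∧ |d (y + j y z)| ≤ w * s} ≤
      ENNReal.ofReal (L * Λ ^ N * Λ ^ N * w * s ^ N) := by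
  obtain ⟨g, hg, hgl⟩ := h.exists_inverse y hy
  have hΛ := h.one_le
  have hΛ0 : 0 < Λ := by linarith
  have hL := hd.nonneg_const
  have hsub : {z : Space N | ‖z‖ ≤ s ∧ |d (y + j y z)| ≤ w * s} ⊆
      g '' {p : Space N | ‖p‖ ≤ Λ * s ∧ |d (y + p)| ≤ (w / Λ) * (Λ * s)} := by
    rintro z ⟨hz1, hz2⟩
    refine ⟨j y z, ⟨(h.norm_jump_le hy z).trans (by gcongr), ?_⟩, hg z⟩
    rwa [← mul_assoc, div_mul_cancel₀ _ hΛ0.ne']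
  calc _ ≤ (Λ.toNNReal : ENNReal) ^ N *
        volume {p : Space N | ‖p‖ ≤ Λ * s ∧ |d (y + p)| ≤ (w / Λ) * (Λ * s)} :=
        (measure_mono hsub).trans (volume_image_le_of_lipschitzOnWith hgl.lipschitzOnWith)
    _ ≤ (Λ.toNNReal : ENNReal) ^ N * ENNReal.ofReal (L * (w / Λ) * (Λ * s) ^ N) := by
        gcongr
        exact hd.strip y hyb _ _ (by positivity) hsr (by positivity)
    _ ≤ _ := by
        rw [← ENNReal.ofReal_coe_nnreal, ← ENNReal.ofReal_pow (by positivity),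
          ← ENNReal.ofReal_mul (by positivity), Real.coe_toNNReal _ hΛ0.le]
        refine ENNReal.ofReal_le_ofReal ?_
        have : w / Λ ≤ w := div_le_self hw hΛ
        rw [mul_pow]
        calc _ ≤ Λ ^ N * (L * w * (Λ ^ N * s ^ N)) := by gcongr
          _ = _ := by ring

lemma ae_jump_notMem_frontier (h : IsJumpOperator Ω μ j σ Cj ρ Λ)
    (hfr : volume (frontier Ω) = 0) {x : Space N} (hx : x ∈ closure Ω) :
    ∀ᵐ z : Space N, x + j x z ∉ frontier Ω := by
  obtain ⟨g, hg, hgl⟩ := h.exists_inverse x hx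
  have hsub : {z : Space N | ¬ (x + j x z ∉ frontier Ω)} ⊆
      g '' ((fun p => x + p) ⁻¹' frontier Ω) := by
    intro z hz
    exact ⟨j x z, not_not.1 hz, hg z⟩
  refine measure_mono_null hsub (le_antisymm ?_ zero_le)
  refine (volume_image_le_of_lipschitzOnWith hgl.lipschitzOnWith).trans ?_
  rw [measure_preimage_add, hfr, mul_zero]

lemma tendsto_jump (h : IsJumpOperator Ω μ j σ Cj ρ Λ) {x : ℕ → Space N} {xs : Space N}
    (hx : ∀ k, x k ∈ closure Ω) (hxs : xs ∈ closure Ω) (hxl : Tendsto x atTop (𝓝 xs))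
    (z : Space N) : Tendsto (fun k => x k + j (x k) z) atTop (𝓝 (xs + j xs z)) := by
  refine hxl.add ?_
  rw [tendsto_iff_norm_sub_tendsto_zero] at hxl ⊢
  refine squeeze_zero (fun _ => norm_nonneg _) (fun k => h.jump_sub_le _ (hx k) _ hxs z) ?_
  simpa using hxl.const_mul (Λ * ‖z‖)

/-- For almost every `z` the jump from the limit point misses the boundary, so both nearby jumps
eventually land on the same side of it. Dominated convergence applies because the weights are at
most `1` and the kernel is integrable on `|z| ≥ δ`, whatever the growth of `n`. -/
lemma tendsto_integral_mismatch_far (h : IsJumpOperator Ω μ j σ Cj ρ Λ)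
    (hΩ : IsOpen Ω) (hfr : volume (frontier Ω) = 0) {x y : ℕ → Space N} {n : ℕ → ℝ}
    {xs : Space N} (hx : ∀ k, x k ∈ closure Ω) (hy : ∀ k, y k ∈ closure Ω) (hxs : xs ∈ closure Ω)
    (hxl : Tendsto x atTop (𝓝 xs)) (hyl : Tendsto y atTop (𝓝 xs)) (hn : ∀ k, 0 < n k)
    {δ : ℝ} (hδ : 0 < δ) :
    Tendsto (fun k => ∫ z in mismatch Ω j (x k) (y k) ∩ {z | δ ≤ ‖z‖},
      weight (n k) z * kernel N σ z) atTop (𝓝 0) := by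
  have hm : MeasurableSet {z : Space N | δ ≤ ‖z‖} :=
    measurableSet_le measurable_const measurable_norm
  have hms : ∀ k, MeasurableSet (mismatch Ω j (x k) (y k) ∩ {z | δ ≤ ‖z‖}) := fun k =>
    (h.measurableSet_mismatch (hx k) (hy k)).inter hm
  refine Tendsto.congr (fun k => integral_indicator (hms k)) ?_
  rw [← integral_zero (Space N) ℝ]
  refine tendsto_integral_of_dominated_convergence (fun z => weight δ⁻¹ z * kernel N σ z)
    (fun k => (((measurable_weight _).mul (measurable_kernel σ)).indicator
      (hms k)).aestronglyMeasurable)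
    (integrable_weight_mul_kernel h.dim_pos h.order_pos h.order_lt_one (inv_pos.2 hδ))
    (fun k => Eventually.of_forall fun z => ?_) ?_
  · have hk := kernel_nonneg σ z
    have hw0 : 0 ≤ weight δ⁻¹ z := weight_nonneg (by positivity) z
    have hw1 := weight_nonneg (hn k).le z
    by_cases hz : z ∈ mismatch Ω j (x k) (y k) ∩ {z | δ ≤ ‖z‖}
    · rw [indicator_of_mem hz, Real.norm_of_nonneg (by positivity)]
      have hwt : weight δ⁻¹ z = 1 := by
        unfold weight
        exact min_eq_right (by rw [le_inv_mul_iff₀ hδ]; simpa using hz.2)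
      rw [hwt]
      gcongr
      exact weight_le_one _ _
    · rw [indicator_of_notMem hz, norm_zero]; positivity
  · filter_upwards [ae_jump_notMem_frontier h hfr hxs] with z hz
    refine tendsto_const_nhds.congr' ?_
    have hX := tendsto_jump h hx hxs hxl z
    have hY := tendsto_jump h hy hxs hyl z
    by_cases hzc : xs + j xs z ∈ closure Ω
    · have hzΩ : xs + j xs z ∈ Ω := by
        by_contra hcon
        exact hz ⟨hzc, fun h' => hcon (interior_subset h')⟩
      filter_upwards [hX.eventually_mem (hΩ.mem_nhds hzΩ), hY.eventually_mem (hΩ.mem_nhds hzΩ)]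
        with k h1 h2
      rw [indicator_of_notMem]
      rintro ⟨hmis, -⟩
      exact hmis ⟨fun _ => subset_closure h2, fun _ => subset_closure h1⟩
    · have hop := isClosed_closure (s := Ω) |>.isOpen_compl.mem_nhds hzc
      filter_upwards [hX.eventually_mem hop, hY.eventually_mem hop] with k h1 h2
      rw [indicator_of_notMem]
      rintro ⟨hmis, -⟩
      exact hmis ⟨fun h' => (h1 h').elim, fun h' => (h2 h').elim⟩

/-- Three ranges of jumps: below `smallScale` the mass is at most a multiple of `1/n` even without
restriction to the mismatch set; between `smallScale` and `δ` the mismatch set is a thin strip;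
beyond `δ` dominated convergence applies. -/
lemma tendsto_integral_mismatch (h : IsJumpOperator Ω μ j σ Cj ρ Λ)
    (hd : IsLocalDistance Ω x₁ r L d)
    (hΩ : IsOpen Ω) (hfr : volume (frontier Ω) = 0) {x y : ℕ → Space N} {n : ℕ → ℝ}
    {xs : Space N} (hx : ∀ k, x k ∈ closure Ω) (hy : ∀ k, y k ∈ closure Ω) (hxs : xs ∈ closure Ω)
    (hxs₁ : xs ∈ Metric.ball x₁ r)
    (hxl : Tendsto x atTop (𝓝 xs)) (hyl : Tendsto y atTop (𝓝 xs)) (hn : ∀ k, 1 ≤ n k)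
    (hnt : Tendsto n atTop atTop) (hnxy : Tendsto (fun k => n k * ‖x k - y k‖) atTop (𝓝 0))
    (hdd : ∀ᶠ k in atTop, |d (x k) - d (y k)| ≤ smoothScale σ (n k)) :
    Tendsto (fun k => ∫ z in mismatch Ω j (x k) (y k), weight (n k) z * kernel N σ z)
      atTop (𝓝 0) := by
  have hΛ := h.one_le
  have hL := hd.nonneg_const
  have h1σ := h.order_lt_one
  have hM := kernelMass_nonneg N σ
  obtain ⟨s, hs1, hs2⟩ := exists_between (Metric.mem_ball.1 hxs₁)
  set δ : ℝ := (r - s) / Λ with hδdef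
  have hδ : 0 < δ := div_pos (by linarith) (by linarith)
  have hΛδ : Λ * δ = r - s := by rw [hδdef]; field_simp
  have hs0 : 0 < s := lt_of_le_of_lt dist_nonneg hs1
  obtain ⟨C, hC, hC'⟩ := setIntegral_weight_mul_kernel_le_of_volume_le (N := N) h.dim_pos
    h.order_pos h.order_lt_one hδ
  have hfar := tendsto_integral_mismatch_far (n := n) h hΩ hfr hx hy hxs hxl hyl
    (fun k => by linarith [hn k]) hδ
  have hninv : Tendsto (fun k => (n k)⁻¹) atTop (𝓝 0) := hnt.inv_tendsto_atTop
  have hbound : Tendsto (fun k => kernelMass N σ * (n k)⁻¹ +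
      C * (L * Λ ^ N * Λ ^ N) * ((n k)⁻¹ + 2 * L * Λ * (n k * ‖x k - y k‖)) +
      ∫ z in mismatch Ω j (x k) (y k) ∩ {z | δ ≤ ‖z‖}, weight (n k) z * kernel N σ z)
      atTop (𝓝 0) := by
    simpa using ((hninv.const_mul (kernelMass N σ)).add
      ((hninv.add (hnxy.const_mul (2 * L * Λ))).const_mul (C * (L * Λ ^ N * Λ ^ N)))).add hfar
  have hxe := hxl.eventually_mem (Metric.isOpen_ball.mem_nhds (x := xs) (s := Metric.ball x₁ s) hs1)
  have hye := hyl.eventually_mem (Metric.isOpen_ball.mem_nhds (x := xs) (s := Metric.ball x₁ s) hs1)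
  refine tendsto_of_tendsto_of_tendsto_of_le_of_le' tendsto_const_nhds hbound
    (Eventually.of_forall fun k => integral_nonneg fun z => mul_nonneg
      (weight_nonneg (by linarith [hn k]) z) (kernel_nonneg σ z)) ?_
  filter_upwards [hxe, hye, hdd] with k hxk hyk hdk
  have hnk : 0 < n k := by linarith [hn k]
  set t := smallScale σ (n k) with ht
  have ht0 : 0 < t := smallScale_pos hnk
  set m := mismatch Ω j (x k) (y k) with hmdef
  have hmm : MeasurableSet m := h.measurableSet_mismatch (hx k) (hy k)
  set f : Space N → ℝ := fun z => weight (n k) z * kernel N σ z with hf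
  have hf0 : ∀ z, 0 ≤ f z := fun z => mul_nonneg (weight_nonneg hnk.le z) (kernel_nonneg σ z)
  have hfi : Integrable f :=
    integrable_weight_mul_kernel h.dim_pos h.order_pos h.order_lt_one hnk
  have hm1 : MeasurableSet {z : Space N | ‖z‖ < t} :=
    measurableSet_lt measurable_norm measurable_const
  have hm2 : MeasurableSet {z : Space N | t ≤ ‖z‖} :=
    measurableSet_le measurable_const measurable_norm
  have hm3 : MeasurableSet {z : Space N | ‖z‖ < δ} :=
    measurableSet_lt measurable_norm measurable_const
  have hm4 : MeasurableSet {z : Space N | δ ≤ ‖z‖} :=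
    measurableSet_le measurable_const measurable_norm
  have hsplit : ∫ z in m, f z ≤ (∫ z in {z : Space N | ‖z‖ < t}, f z) +
      (∫ z in (m ∩ {z | t ≤ ‖z‖}) ∩ {z | ‖z‖ < δ}, f z) +
      ∫ z in m ∩ {z | δ ≤ ‖z‖}, f z := by
    rw [← integral_indicator hmm, ← integral_indicator hm1,
      ← integral_indicator ((hmm.inter hm2).inter hm3), ← integral_indicator (hmm.inter hm4),
      ← integral_add' (hfi.indicator hm1) (hfi.indicator ((hmm.inter hm2).inter hm3)),
      ← integral_add' ((hfi.indicator hm1).add (hfi.indicator ((hmm.inter hm2).inter hm3)))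
        (hfi.indicator (hmm.inter hm4))]
    refine integral_mono (hfi.indicator hmm) (((hfi.indicator hm1).add
      (hfi.indicator ((hmm.inter hm2).inter hm3))).add (hfi.indicator (hmm.inter hm4)))
      fun z => ?_
    have i1 : 0 ≤ {z : Space N | ‖z‖ < t}.indicator f z := indicator_nonneg (fun z _ => hf0 z) z
    have i2 : 0 ≤ ((m ∩ {z | t ≤ ‖z‖}) ∩ {z | ‖z‖ < δ}).indicator f z :=
      indicator_nonneg (fun z _ => hf0 z) z
    have i3 : 0 ≤ (m ∩ {z | δ ≤ ‖z‖}).indicator f z := indicator_nonneg (fun z _ => hf0 z) z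
    simp only [Pi.add_apply]
    by_cases hz : z ∈ m
    · rw [indicator_of_mem hz]
      by_cases hz1 : ‖z‖ < t
      · rw [indicator_of_mem (show z ∈ {z : Space N | ‖z‖ < t} from hz1)]; linarith
      · by_cases hz2 : ‖z‖ < δ
        · rw [indicator_of_mem (show z ∈ (m ∩ {z | t ≤ ‖z‖}) ∩ {z | ‖z‖ < δ} from
            ⟨⟨hz, not_lt.1 hz1⟩, hz2⟩)]
          linarith
        · rw [indicator_of_mem (show z ∈ m ∩ {z | δ ≤ ‖z‖} from ⟨hz, not_lt.1 hz2⟩)]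
          linarith
    · rw [indicator_of_notMem hz]; positivity
  have hI1 : ∫ z in {z : Space N | ‖z‖ < t}, f z ≤ kernelMass N σ * (n k)⁻¹ := by
    obtain ⟨hi, hle⟩ := integrableOn_norm_mul_kernel_and_le (N := N) h.dim_pos h.order_pos
      h.order_lt_one ht0
    calc _ ≤ ∫ z in {z : Space N | ‖z‖ < t}, n k * (‖z‖ * kernel N σ z) := by
          refine setIntegral_mono hfi.integrableOn (hi.const_mul _) fun z => ?_
          have := mul_le_mul_of_nonneg_right (weight_le_mul (n k) z) (kernel_nonneg σ z)
          simp only [hf]; linarith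
      _ ≤ n k * (t ^ (1 - σ) * kernelMass N σ) := by
          rw [integral_const_mul]; gcongr
      _ = _ := by rw [← mul_assoc, ht, smallScale_rpow h1σ hnk, mul_comm]
  -- Relative width of the strip. The first term is `smoothScale / smallScale`, the second comes
  -- from the second difference of `d`.
  set w : ℝ := ((n k) ^ 2)⁻¹ + 2 * L * Λ * ‖x k - y k‖ with hw
  have hw0 : 0 ≤ w := by positivity
  have hI2 : ∫ z in (m ∩ {z | t ≤ ‖z‖}) ∩ {z | ‖z‖ < δ}, f z ≤
      C * (L * Λ ^ N * Λ ^ N) * ((n k)⁻¹ + 2 * L * Λ * (n k * ‖x k - y k‖)) := by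
    have hkey := hC' (m ∩ {z | t ≤ ‖z‖}) (L * Λ ^ N * Λ ^ N * w) (by positivity)
      (hmm.inter hm2) (by
        intro q hq hqδ
        have hΛq : Λ * q ≤ r - s := by rw [← hΛδ]; gcongr
        refine (measure_mono ?_).trans (volume_strip_jump_le h hd (hy k)
          (lt_trans hyk hs2) hq (by linarith) hw0)
        rintro z ⟨⟨hzm, hzt⟩, hzq⟩
        have hzq' : ‖z‖ ≤ q := by simpa using hzq
        have hzt' : t ≤ ‖z‖ := hzt
        refine ⟨hzq', ?_⟩
        have hΛz : Λ * ‖z‖ ≤ Λ * q := by gcongr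
        refine (abs_le_of_mem_mismatch h hd (hx k) (hy k) hxk hyk (by linarith) hzm).trans ?_
        have hsm : smoothScale σ (n k) = t * ((n k) ^ 2)⁻¹ := rfl
        -- Here `t ≤ ‖z‖ ≤ q`: removing the small jumps is what turns the absolute width
        -- `smoothScale` into a width relative to `q`.
        have e1 : t * ((n k) ^ 2)⁻¹ ≤ q * ((n k) ^ 2)⁻¹ := by gcongr; linarith
        have e2 : 2 * L * Λ * ‖z‖ * ‖x k - y k‖ ≤ 2 * L * Λ * q * ‖x k - y k‖ := by gcongr
        rw [hw]
        linarith)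
      (n k) (hn k)
    refine hkey.trans ?_
    -- At most linear growth is affordable because `n * w` is `1/n` plus a multiple of `n‖x - y‖`.
    have hpow : (n k) ^ ((1 + σ) / 2) ≤ n k := by
      calc _ ≤ (n k) ^ (1 : ℝ) := Real.rpow_le_rpow_of_exponent_le (hn k) (by linarith)
        _ = _ := Real.rpow_one _
    calc _ ≤ C * n k * (L * Λ ^ N * Λ ^ N * w) := by gcongr
      _ = _ := by rw [hw]; field_simp
  linarith

end Mismatch

/-! ### Calculus of gradients -/

section Gradient

variable {N : ℕ} {f g : Space N → ℝ} {p q x : Space N}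

lemma hasGradientAt_add (hf : HasGradientAt f p x) (hg : HasGradientAt g q x) :
    HasGradientAt (fun y => f y + g y) (p + q) x := by
  rw [hasGradientAt_iff_hasFDerivAt] at *
  rw [map_add]; exact hf.add hg

lemma hasGradientAt_scalar_comp {F : ℝ → ℝ} {F' : ℝ} (hF : HasDerivAt F F' (f x))
    (hf : HasGradientAt f p x) : HasGradientAt (fun y => F (f y)) (F' • p) x := by
  rw [hasGradientAt_iff_hasFDerivAt] at *
  rw [map_smul]; exact hF.comp_hasFDerivAt x hf

lemma hasGradientAt_norm_sub_sq (a x : Space N) :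
    HasGradientAt (fun y => ‖y - a‖ ^ 2) ((2 : ℝ) • (x - a)) x := by
  rw [hasGradientAt_iff_hasFDerivAt]
  have h : HasFDerivAt (fun y : Space N => ‖y - a‖ ^ 2) _ x :=
    ((hasFDerivAt_id x).sub_const a).norm_sq
  refine h.congr_fderiv ?_
  ext v
  simp

lemma contDiff_norm_sub_sq (a : Space N) : ContDiff ℝ 1 (fun y : Space N => ‖y - a‖ ^ 2) :=
  (contDiff_id.sub contDiff_const).norm_sq ℝ

end Gradient

/-! ### Localization -/

lemma abs_min_sq_sub_min_sq_le {a b : ℝ} (ha : 0 ≤ a) (hb : 0 ≤ b) :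
    |min (a ^ 2) 1 - min (b ^ 2) 1| ≤ 2 * |a - b| := by
  have key : ∀ c : ℝ, 0 ≤ c → min (c ^ 2) 1 = (min c 1) ^ 2 := by
    intro c hc
    rcases le_total c 1 with h | h
    · rw [min_eq_left h, min_eq_left (by nlinarith)]
    · rw [min_eq_right h, min_eq_right (by nlinarith), one_pow]
  rw [key a ha, key b hb, sq_sub_sq, abs_mul]
  have h1 : |min a 1 - min b 1| ≤ |a - b| := by
    have := abs_min_sub_min_le_max a 1 b 1
    simpa using this
  have h2 : |min a 1 + min b 1| ≤ 2 := by
    rw [abs_of_nonneg (by positivity)]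
    linarith [min_le_right a 1, min_le_right b 1]
  have := abs_nonneg (min a 1 - min b 1)
  gcongr

/-- The truncated squared distance `min(λ²|x-a|², 1)`. -/
noncomputable def truncSq {N : ℕ} (l : ℝ) (a x : Space N) : ℝ := min ((l * ‖x - a‖) ^ 2) 1

section TruncSq

variable {N : ℕ} {l : ℝ} (a x y : Space N)

lemma truncSq_nonneg : 0 ≤ truncSq l a x := le_min (sq_nonneg _) zero_le_one

lemma truncSq_le_one : truncSq l a x ≤ 1 := min_le_right _ _

lemma truncSq_self : truncSq l a a = 0 := by simp [truncSq]

lemma abs_truncSq_sub_le (hl : 0 ≤ l) : |truncSq l a x - truncSq l a y| ≤ 2 * l * ‖x - y‖ := by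
  refine (abs_min_sq_sub_min_sq_le (by positivity) (by positivity)).trans ?_
  rw [← mul_sub, abs_mul, abs_of_nonneg hl, ← mul_assoc]
  gcongr
  have := abs_norm_sub_norm_le (x - a) (y - a)
  simpa using this

lemma continuous_truncSq : Continuous (truncSq l a) := by unfold truncSq; fun_prop

variable {a x}

lemma lt_one_of_truncSq_lt_one (h : truncSq l a x < 1) : l * ‖x - a‖ < 1 := by
  have : (l * ‖x - a‖) ^ 2 < 1 := by
    rcases min_lt_iff.1 h with h | h
    · exact h
    · exact absurd h (lt_irrefl _)
  nlinarith

lemma truncSq_eventuallyEq (h : l * ‖x - a‖ < 1) (hl : 0 ≤ l) :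
    truncSq l a =ᶠ[𝓝 x] fun y => l ^ 2 * ‖y - a‖ ^ 2 := by
  have hc : Continuous fun y : Space N => l * ‖y - a‖ := by fun_prop
  filter_upwards [hc.continuousAt.eventually_lt_const h] with y hy
  have h0 : 0 ≤ l * ‖y - a‖ := by positivity
  unfold truncSq
  rw [min_eq_left (by nlinarith), mul_pow]

end TruncSq

/-- A localizing perturbation of size `l`: it is of class `C¹` on `W`, has slope of order `l`,
and its normal derivative on the boundary is at least `2l`. -/
structure IsLocalizer {N : ℕ} (Ω W : Set (Space N)) (K l : ℝ) (G : Space N → ℝ) : Prop where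
  continuousOn : ContinuousOn G (closure Ω)
  lip : ∀ p ∈ closure Ω, ∀ q ∈ closure Ω, |G p - G q| ≤ 22 * K * l * ‖p - q‖
  osc : ∀ p ∈ closure Ω, ∀ q ∈ closure Ω, |G p - G q| ≤ 53 * K
  isOpen : IsOpen W
  smooth : ∀ x ∈ W, ContDiffAt ℝ 1 G x
  norm_gradient_le : ∀ x ∈ W, x ∈ closure Ω → ‖gradient G x‖ ≤ 22 * K * l
  normal : ∀ x ∈ W, x ∈ frontier Ω → 2 * l ≤ inner ℝ (gradient G x) (outerNormal Ω x)

/-- Tilting of the penalization towards the boundary. -/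
noncomputable def boundaryTilt {N : ℕ} (τ : ℝ) (d : Space N → ℝ) (x : Space N) : ℝ :=
  τ * Real.arctan (d x / τ)

/-- The slope is `1` at `t = 0` for every `τ`, while the function itself is of size `τ`: the tilt
changes the normal derivative on the boundary at negligible cost in value. -/
lemma hasDerivAt_mul_arctan_div {τ : ℝ} (hτ : 0 < τ) (t : ℝ) :
    HasDerivAt (fun t => τ * Real.arctan (t / τ)) (1 / (1 + (t / τ) ^ 2)) t := by
  have h : HasDerivAt (fun t => τ * Real.arctan (t / τ))
      (τ * (1 / (1 + (t / τ) ^ 2) * (1 / τ))) t :=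
    (((hasDerivAt_id t).div_const τ).arctan).const_mul τ
  exact h.congr_deriv (by field_simp)

lemma abs_mul_arctan_sub_le {τ : ℝ} (hτ : 0 < τ) (s t : ℝ) :
    |τ * Real.arctan (s / τ) - τ * Real.arctan (t / τ)| ≤ |s - t| := by
  have := (convex_univ).norm_image_sub_le_of_norm_hasDerivWithin_le
    (f := fun t => τ * Real.arctan (t / τ)) (f' := fun t => 1 / (1 + (t / τ) ^ 2)) (C := 1)
    (fun x _ => (hasDerivAt_mul_arctan_div hτ x).hasDerivWithinAt) (fun x _ => by
      rw [Real.norm_of_nonneg (by positivity)]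
      exact div_le_one_of_le₀ (by nlinarith [sq_nonneg (x / τ)]) (by positivity))
    (mem_univ t) (mem_univ s)
  simpa using this

section BoundaryTilt

variable {N : ℕ} {Ω : Set (Space N)} {x₁ : Space N} {r L τ : ℝ} {d : Space N → ℝ}

lemma boundaryTilt_nonneg (hd : IsLocalDistance Ω x₁ r L d) (hτ : 0 < τ) {x : Space N}
    (hx : x ∈ closure Ω) : 0 ≤ boundaryTilt τ d x :=
  mul_nonneg hτ.le (Real.arctan_nonneg.2 (div_nonneg (hd.nonneg x hx) hτ.le))

lemma boundaryTilt_le (hτ : 0 < τ) (x : Space N) : boundaryTilt τ d x ≤ 2 * τ := by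
  have h1 := Real.arctan_lt_pi_div_two (d x / τ)
  have h2 := Real.pi_lt_four
  unfold boundaryTilt
  nlinarith

end BoundaryTilt

/-- The first term confines to a ball of radius `1/l` around `x₀`, the second pins the maximum near
`x₁`, and the tilt produces the positive normal derivative. The estimates are uniform in `τ`, which
stays free to be chosen after `x₁` and `r`. -/
lemma isLocalizer_of_isLocalDistance {N : ℕ} {Ω : Set (Space N)} {x₀ x₁ : Space N} {r L : ℝ}
    {d : Space N → ℝ} (hd : IsLocalDistance Ω x₁ r L d) {K l τ : ℝ} (hK : 1 ≤ K) (hl : 0 < l)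
    (hl1 : l ≤ 1) (hτ : 0 < τ) (hτ1 : τ ≤ 1) :
    IsLocalizer Ω {x | l * ‖x - x₀‖ < 1 ∧ ‖x - x₁‖ < 1 ∧ x ∈ Metric.ball x₁ r} K l
      (fun x => 4 * K * truncSq l x₀ x + l * truncSq 1 x₁ x -
        (8 * K + 4) * l * boundaryTilt τ d x) := by
  have hK0 : 0 < K := by linarith
  have hlip : ∀ p ∈ closure Ω, ∀ q ∈ closure Ω,
      |boundaryTilt τ d p - boundaryTilt τ d q| ≤ ‖p - q‖ := fun p hp q hq =>
    (abs_mul_arctan_sub_le hτ _ _).trans (hd.lip_closure p hp q hq)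
  have hgrad : ∀ x, l * ‖x - x₀‖ < 1 → ‖x - x₁‖ < 1 → x ∈ Metric.ball x₁ r →
      HasGradientAt (fun x => 4 * K * truncSq l x₀ x + l * truncSq 1 x₁ x -
        (8 * K + 4) * l * boundaryTilt τ d x)
        ((4 * K * l ^ 2) • ((2:ℝ) • (x - x₀)) + l • ((2:ℝ) • (x - x₁)) +
          (-((8 * K + 4) * l) * (1 / (1 + (d x / τ) ^ 2))) • gradient d x) x := by
    intro x h0 h1 hx
    have e1 := hasGradientAt_scalar_comp (F := fun t => 4 * K * l ^ 2 * t)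
      (by simpa using (hasDerivAt_id (‖x - x₀‖ ^ 2)).const_mul (4 * K * l ^ 2))
      (hasGradientAt_norm_sub_sq x₀ x)
    have e2 := hasGradientAt_scalar_comp (F := fun t => l * t)
      (by simpa using (hasDerivAt_id (‖x - x₁‖ ^ 2)).const_mul l)
      (hasGradientAt_norm_sub_sq x₁ x)
    have e3 := hasGradientAt_scalar_comp
      ((hasDerivAt_mul_arctan_div hτ (d x)).const_mul (-((8 * K + 4) * l)))
      (hd.differentiableAt hx).hasGradientAt
    refine (hasGradientAt_add (hasGradientAt_add e1 e2) e3).congr_of_eventuallyEq ?_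
    filter_upwards [truncSq_eventuallyEq h0 hl.le,
      truncSq_eventuallyEq (l := 1) (by simpa using h1) zero_le_one] with y hy1 hy2
    rw [hy1, hy2]
    unfold boundaryTilt
    ring
  refine ⟨?_, ?_, ?_, ?_, ?_, ?_, ?_⟩
  · have hdc : ContinuousOn d (closure Ω) := by
      refine (LipschitzOnWith.of_dist_le_mul (K := 1) fun a ha b hb => ?_).continuousOn
      rw [Real.dist_eq, dist_eq_norm, NNReal.coe_one, one_mul]
      exact hd.lip_closure a ha b hb
    have ht : ContinuousOn (boundaryTilt τ d) (closure Ω) :=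
      continuousOn_const.mul (Real.continuous_arctan.comp_continuousOn (hdc.div_const τ))
    exact (((continuous_truncSq x₀).continuousOn.const_smul (4 * K)).add
      ((continuous_truncSq x₁).continuousOn.const_smul l)).sub
      (ht.const_smul ((8 * K + 4) * l))
  -- The three slopes are `8Kl`, `2l` and `(8K+4)l`, in total `16Kl + 6l ≤ 22Kl` since `K ≥ 1`.
  · intro p hp q hq
    have h1 := abs_le.1 (abs_truncSq_sub_le x₀ p q hl.le)
    have h2 := abs_le.1 (abs_truncSq_sub_le (l := 1) x₁ p q zero_le_one)
    have h3 := abs_le.1 (hlip p hp q hq)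
    have hn := norm_nonneg (p - q)
    have m1 := mul_le_mul_of_nonneg_left h1.1 (by positivity : 0 ≤ 4 * K)
    have m1' := mul_le_mul_of_nonneg_left h1.2 (by positivity : 0 ≤ 4 * K)
    have m2 := mul_le_mul_of_nonneg_left h2.1 hl.le
    have m2' := mul_le_mul_of_nonneg_left h2.2 hl.le
    have m3 := mul_le_mul_of_nonneg_left h3.1 (by positivity : 0 ≤ (8 * K + 4) * l)
    have m3' := mul_le_mul_of_nonneg_left h3.2 (by positivity : 0 ≤ (8 * K + 4) * l)
    have hln : 0 ≤ l * ‖p - q‖ := by positivity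
    have hKln : l * ‖p - q‖ ≤ K * (l * ‖p - q‖) := le_mul_of_one_le_left hln hK
    rw [abs_le]
    constructor <;> nlinarith
  · intro p hp q hq
    have a1 := truncSq_nonneg (l := l) x₀ p
    have a2 := truncSq_le_one (l := l) x₀ p
    have a3 := truncSq_nonneg (l := l) x₀ q
    have a4 := truncSq_le_one (l := l) x₀ q
    have b1 := truncSq_nonneg (l := 1) x₁ p
    have b2 := truncSq_le_one (l := 1) x₁ p
    have b3 := truncSq_nonneg (l := 1) x₁ q
    have b4 := truncSq_le_one (l := 1) x₁ q
    have c1 := boundaryTilt_nonneg hd hτ hp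
    have c2 := boundaryTilt_le (d := d) hτ p
    have c3 := boundaryTilt_nonneg hd hτ hq
    have c4 := boundaryTilt_le (d := d) hτ q
    have t1 : |4 * K * (truncSq l x₀ p - truncSq l x₀ q)| ≤ 4 * K := by
      rw [abs_mul, abs_of_pos (by positivity : 0 < 4 * K)]
      exact mul_le_of_le_one_right (by positivity) (abs_le.2 ⟨by linarith, by linarith⟩)
    have t2 : |l * (truncSq 1 x₁ p - truncSq 1 x₁ q)| ≤ 1 := by
      rw [abs_mul, abs_of_pos hl]
      exact mul_le_one₀ hl1 (abs_nonneg _) (abs_le.2 ⟨by linarith, by linarith⟩)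
    have t3 : |(8 * K + 4) * l * (boundaryTilt τ d p - boundaryTilt τ d q)| ≤
        (8 * K + 4) * 1 * 2 := by
      rw [abs_mul, abs_of_pos (by positivity : 0 < (8 * K + 4) * l)]
      gcongr
      exact abs_le.2 ⟨by linarith, by linarith⟩
    rw [abs_le] at *
    constructor <;> linarith [t1.1, t1.2, t2.1, t2.2, t3.1, t3.2]
  · have h1 : IsOpen {x : Space N | l * ‖x - x₀‖ < 1} :=
      isOpen_lt (by fun_prop) continuous_const
    have h2 : IsOpen {x : Space N | ‖x - x₁‖ < 1} := isOpen_lt (by fun_prop) continuous_const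
    exact h1.inter (h2.inter Metric.isOpen_ball)
  · rintro x ⟨h0, h1, hx⟩
    have hdx : ContDiffAt ℝ 1 d x := hd.contDiffOn.contDiffAt (Metric.isOpen_ball.mem_nhds hx)
    have ht : ContDiffAt ℝ 1 (fun y => τ * Real.arctan (d y / τ)) x :=
      contDiffAt_const.mul (Real.contDiff_arctan.contDiffAt.comp x (hdx.div_const τ))
    have hs : ContDiffAt ℝ 1 (fun y => 4 * K * (l ^ 2 * ‖y - x₀‖ ^ 2) +
        l * (1 ^ 2 * ‖y - x₁‖ ^ 2) - (8 * K + 4) * l * (τ * Real.arctan (d y / τ))) x :=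
      ((contDiffAt_const.mul (contDiffAt_const.mul (contDiff_norm_sub_sq x₀).contDiffAt)).add
        (contDiffAt_const.mul (contDiffAt_const.mul (contDiff_norm_sub_sq x₁).contDiffAt))).sub
        (contDiffAt_const.mul ht)
    refine hs.congr_of_eventuallyEq ?_
    filter_upwards [truncSq_eventuallyEq h0 hl.le,
      truncSq_eventuallyEq (l := 1) (by simpa using h1) zero_le_one] with y hy1 hy2
    rw [hy1, hy2]
    rfl
  · rintro x ⟨h0, h1, hx⟩ hxc
    rw [(hgrad x h0 h1 hx).gradient]
    have n1 : ‖(4 * K * l ^ 2) • ((2:ℝ) • (x - x₀))‖ ≤ 8 * K * l := by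
      rw [norm_smul, norm_smul, Real.norm_of_nonneg (by positivity), Real.norm_of_nonneg (by norm_num)]
      have : 8 * K * l * (l * ‖x - x₀‖) ≤ 8 * K * l * 1 := by gcongr
      linarith
    have n2 : ‖l • ((2:ℝ) • (x - x₁))‖ ≤ 2 * l := by
      rw [norm_smul, norm_smul, Real.norm_of_nonneg hl.le, Real.norm_of_nonneg (by norm_num)]
      nlinarith
    have n3 : ‖(-((8 * K + 4) * l) * (1 / (1 + (d x / τ) ^ 2))) • gradient d x‖ ≤
        (8 * K + 4) * l := by
      rw [norm_smul, norm_mul, norm_neg, Real.norm_of_nonneg (by positivity),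
        Real.norm_of_nonneg (by positivity)]
      have e1 : 1 / (1 + (d x / τ) ^ 2) ≤ 1 :=
        div_le_one_of_le₀ (by nlinarith [sq_nonneg (d x / τ)]) (by positivity)
      calc _ ≤ (8 * K + 4) * l * 1 * 1 := by
            gcongr
            exact hd.norm_le x hx hxc
        _ = _ := by ring
    refine (norm_add_le _ _).trans ?_
    have := norm_add_le ((4 * K * l ^ 2) • ((2:ℝ) • (x - x₀))) (l • ((2:ℝ) • (x - x₁)))
    nlinarith
  -- The tilt contributes `(8K+4)l`, while the two quadratic terms take away at most `8Kl` and `2l`;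
  -- at least `2l` remains. This explains the coefficient `8K+4`.
  · rintro x ⟨h0, h1, hx⟩ hxf
    have hn : outerNormal Ω x = - gradient d x := by rw [hd.gradient_eq x hx hxf, neg_neg]
    rw [(hgrad x h0 h1 hx).gradient, hn, hd.eq_zero x hx hxf]
    have hnorm := hd.norm_eq x hx hxf
    simp only [inner_add_left, real_inner_smul_left, inner_neg_right, real_inner_self_eq_norm_sq,
      hnorm, zero_div, zero_pow two_ne_zero, add_zero, div_one, one_pow, mul_one]
    have i1 := (abs_le.1 (abs_real_inner_le_norm (x - x₀) (gradient d x))).2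
    have i2 := (abs_le.1 (abs_real_inner_le_norm (x - x₁) (gradient d x))).2
    rw [hnorm, mul_one] at i1 i2
    have j1 : l * inner ℝ (x - x₀) (gradient d x) ≤ 1 :=
      (mul_le_mul_of_nonneg_left i1 hl.le).trans h0.le
    have j2 : inner ℝ (x - x₁) (gradient d x) ≤ 1 := i2.trans h1.le
    have j3 : 8 * K * l * (l * inner ℝ (x - x₀) (gradient d x)) ≤ 8 * K * l * 1 := by gcongr
    have j4 : 2 * l * inner ℝ (x - x₁) (gradient d x) ≤ 2 * l * 1 := by gcongr
    nlinarith

/-! ### Doubling of variables -/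

lemma UpperSemicontinuousOn.sub_sub_of_continuousOn {X : Type*} [TopologicalSpace X] {S : Set X}
    {a b g : X → ℝ} (ha : UpperSemicontinuousOn a S) (hb : LowerSemicontinuousOn b S)
    (hg : ContinuousOn g S) : UpperSemicontinuousOn (fun x => a x - b x - g x) S := by
  intro x hx c hc
  set e := (c - (a x - b x - g x)) / 3 with he
  have he0 : 0 < e := by
    have : a x - b x - g x < c := hc
    rw [he]; linarith
  filter_upwards [ha x hx (a x + e) (by linarith), hb x hx (b x - e) (by linarith),
    (hg x hx).eventually_const_lt (show g x - e < g x by linarith)] with y h1 h2 h3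
  have : c = a x - b x - g x + 3 * e := by rw [he]; ring
  linarith

lemma UpperSemicontinuousOn.eventually_lt_add {X : Type*} [TopologicalSpace X] {S : Set X}
    {a : X → ℝ} (ha : UpperSemicontinuousOn a S) {x : ℕ → X} {xs : X} (hxs : xs ∈ S)
    (hx : ∀ k, x k ∈ S) (hl : Tendsto x atTop (𝓝 xs)) {e : ℝ} (he : 0 < e) :
    ∀ᶠ k in atTop, a (x k) < a xs + e :=
  (tendsto_nhdsWithin_iff.2 ⟨hl, Eventually.of_forall hx⟩).eventually
    (ha xs hxs (a xs + e) (by linarith))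

/-- A family of penalizations, becoming infinite off the diagonal. -/
structure IsPenalization {N : ℕ} (F : Set (Space N)) (φ : ℕ → Space N → Space N → ℝ) : Prop where
  continuousOn : ∀ n, ContinuousOn (fun q : Space N × Space N => φ n q.1 q.2) (F ×ˢ F)
  self : ∀ n, ∀ x ∈ F, φ n x x = 0
  nonneg : ∀ n, ∀ x ∈ F, ∀ y ∈ F, 0 ≤ φ n x y
  ge : ∀ n : ℕ, ∀ x ∈ F, ∀ y ∈ F, ((n : ℝ) + 1) * ‖x - y‖ - 1 ≤ φ n x y

/-- `hfar` says that pairs with a component outside the ball do not beat the diagonal pair at `x₁`,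
so the maximum over a compact set is global. Boundedness of the penalization along maximizers forces
the two components together. -/
lemma exists_maximizers {N : ℕ} {F : Set (Space N)} (hF : IsClosed F) {u v : Space N → ℝ}
    (hu : UpperSemicontinuousOn u F) (hv : LowerSemicontinuousOn v F) {K : ℝ}
    (huK : ∀ x ∈ F, |u x| ≤ K) (hvK : ∀ x ∈ F, |v x| ≤ K) {G : Space N → ℝ}
    (hG : ContinuousOn G F) {c : ℝ} (hGc : ∀ x ∈ F, -c ≤ G x)
    {φ : ℕ → Space N → Space N → ℝ} (hφ : IsPenalization F φ) {x₀ x₁ : Space N} {R : ℝ}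
    (hx₁ : x₁ ∈ F) (hx₁R : dist x₁ x₀ ≤ R)
    (hfar : ∀ x ∈ F, ∀ y ∈ F, (R < dist x x₀ ∨ R < dist y x₀) →
      u x - v y - G x - G y ≤ u x₁ - v x₁ - 2 * G x₁) :
    ∃ (ns : ℕ → ℕ) (x y : ℕ → Space N) (xs : Space N), StrictMono ns ∧ xs ∈ F ∧
      (∀ k, x k ∈ F) ∧ (∀ k, y k ∈ F) ∧ Tendsto x atTop (𝓝 xs) ∧ Tendsto y atTop (𝓝 xs) ∧
      Tendsto (fun k => φ (ns k) (x k) (y k)) atTop (𝓝 0) ∧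
      (∀ k, ∀ p ∈ F, ∀ q ∈ F, u p - v q - φ (ns k) p q - G p - G q ≤
        u (x k) - v (y k) - φ (ns k) (x k) (y k) - G (x k) - G (y k)) ∧
      u x₁ - v x₁ - 2 * G x₁ ≤ u xs - v xs - 2 * G xs := by
  set Q : Set (Space N) := Metric.closedBall x₀ R ∩ F with hQ
  have hQF : Q ⊆ F := inter_subset_right
  have hQc : IsCompact Q := (isCompact_closedBall x₀ R).inter_right hF
  have hx₁Q : x₁ ∈ Q := ⟨hx₁R, hx₁⟩
  have hex : ∀ n, ∃ q ∈ Q ×ˢ Q, ∀ p ∈ F, ∀ p' ∈ F, u p - v p' - φ n p p' - G p - G p' ≤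
      u q.1 - v q.2 - φ n q.1 q.2 - G q.1 - G q.2 := by
    intro n
    have husc : UpperSemicontinuousOn (fun q : Space N × Space N =>
        u q.1 - v q.2 - (φ n q.1 q.2 + G q.1 + G q.2)) (F ×ˢ F) := by
      refine UpperSemicontinuousOn.sub_sub_of_continuousOn (a := fun q : Space N × Space N => u q.1)
        (b := fun q => v q.2) (g := fun q => φ n q.1 q.2 + G q.1 + G q.2)
        (fun q hq c hc => ?_) (fun q hq c hc => ?_) ?_
      · exact (continuousWithinAt_fst.tendsto_nhdsWithin fun p hp => hp.1).eventually
          (hu q.1 hq.1 c hc)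
      · exact (continuousWithinAt_snd.tendsto_nhdsWithin fun p hp => hp.2).eventually
          (hv q.2 hq.2 c hc)
      · exact ((hφ.continuousOn n).add (hG.comp continuousOn_fst fun q hq => hq.1)).add
          (hG.comp continuousOn_snd fun q hq => hq.2)
    have husc' : UpperSemicontinuousOn _ (Q ×ˢ Q) := husc.mono (prod_mono hQF hQF)
    obtain ⟨q, hqQ, hq⟩ := husc'.exists_isMaxOn
      (Set.Nonempty.prod ⟨x₁, hx₁Q⟩ ⟨x₁, hx₁Q⟩) (hQc.prod hQc)
    refine ⟨q, hqQ, fun p hp p' hp' => ?_⟩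
    have hq1 := hq (show (x₁, x₁) ∈ Q ×ˢ Q from ⟨hx₁Q, hx₁Q⟩)
    simp only [mem_ofPred_eq, hφ.self n x₁ hx₁] at hq1
    by_cases hfr : R < dist p x₀ ∨ R < dist p' x₀
    · have := hfar p hp p' hp' hfr
      have := hφ.nonneg n p hp p' hp'
      linarith
    · push Not at hfr
      have := hq (show (p, p') ∈ Q ×ˢ Q from ⟨⟨hfr.1, hp⟩, ⟨hfr.2, hp'⟩⟩)
      simp only [mem_ofPred_eq] at this
      linarith
  choose q hqQ hq using hex
  obtain ⟨xs, hxsQ, ns, hns, hlim⟩ := hQc.tendsto_subseq fun n => (hqQ n).1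
  set x : ℕ → Space N := fun k => (q (ns k)).1 with hx
  set y : ℕ → Space N := fun k => (q (ns k)).2 with hy
  have hxF : ∀ k, x k ∈ F := fun k => hQF (hqQ (ns k)).1
  have hyF : ∀ k, y k ∈ F := fun k => hQF (hqQ (ns k)).2
  have hxsF : xs ∈ F := hQF hxsQ
  have hlim' : Tendsto x atTop (𝓝 xs) := hlim
  set C : ℝ := 2 * K + 2 * c - (u x₁ - v x₁ - 2 * G x₁) + 1 with hC
  have hval : ∀ k, φ (ns k) (x k) (y k) ≤ C - 1 := by
    intro k
    have h1 := hq (ns k) x₁ hx₁ x₁ hx₁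
    rw [hφ.self _ x₁ hx₁] at h1
    have h2 := hGc _ (hxF k)
    have h3 := hGc _ (hyF k)
    have h4 := abs_le.1 (huK _ (hxF k))
    have h5 := abs_le.1 (hvK _ (hyF k))
    simp only [hx, hy] at *
    linarith
  have hdist : Tendsto (fun k => ‖x k - y k‖) atTop (𝓝 0) := by
    have hn : Tendsto (fun k => C / ((ns k : ℝ) + 1)) atTop (𝓝 0) :=
      (tendsto_const_div_atTop_nhds_zero_nat C |>.comp (tendsto_add_atTop_nat 1)).comp
        hns.tendsto_atTop |>.congr fun k => by simp
    refine squeeze_zero (fun _ => norm_nonneg _) (fun k => ?_) hn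
    have h1 := hφ.ge (ns k) _ (hxF k) _ (hyF k)
    have h2 := hval k
    rw [le_div_iff₀ (by positivity)]
    linarith
  have hylim : Tendsto y atTop (𝓝 xs) := by
    have : Tendsto (fun k => x k - (x k - y k)) atTop (𝓝 (xs - 0)) :=
      hlim'.sub (tendsto_zero_iff_norm_tendsto_zero.2 hdist)
    simpa using this
  have husc : ∀ e > 0, ∀ᶠ k in atTop, u (x k) - v (y k) - G (x k) - G (y k) <
      u xs - v xs - 2 * G xs + e := by
    intro e he
    have hvl : UpperSemicontinuousOn (fun p => - v p) F := fun p hp a ha => by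
      filter_upwards [hv p hp (-a) (by linarith)] with p' hp'
      linarith
    have hGl : UpperSemicontinuousOn (fun p => - G p) F := fun p hp a ha =>
      (hG.neg p hp).eventually_lt_const ha
    filter_upwards [UpperSemicontinuousOn.eventually_lt_add hu hxsF hxF hlim'
        (e := e / 4) (by positivity),
      UpperSemicontinuousOn.eventually_lt_add hvl hxsF hyF hylim (e := e / 4) (by positivity),
      UpperSemicontinuousOn.eventually_lt_add hGl hxsF hxF hlim' (e := e / 4) (by positivity),
      UpperSemicontinuousOn.eventually_lt_add hGl hxsF hyF hylim (e := e / 4) (by positivity)]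
      with k h1 h2 h3 h4
    linarith
  refine ⟨ns, x, y, xs, hns, hxsF, hxF, hyF, hlim', hylim, ?_, fun k => hq (ns k), ?_⟩
  -- Comparison with the diagonal pair at the limit `xs`: upper semicontinuity prevents the
  -- unpenalized value from exceeding its value at `xs` in the limit, so nothing is left for the
  -- penalization.
  · rw [Metric.tendsto_atTop']
    intro e he
    obtain ⟨k₀, hk₀⟩ := eventually_atTop.1 (husc e he)
    refine ⟨k₀, fun k hk => ?_⟩
    have h1 := hq (ns k) xs hxsF xs hxsF
    rw [hφ.self _ xs hxsF] at h1
    have h2 := hk₀ k (le_of_lt hk)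
    have h3 := hφ.nonneg (ns k) _ (hxF k) _ (hyF k)
    rw [Real.dist_eq, sub_zero, abs_of_nonneg h3]
    simp only [hx, hy] at *
    linarith
  · refine le_of_forall_pos_lt_add fun e he => ?_
    obtain ⟨k, hk⟩ := (husc e he).exists
    have h1 := hq (ns k) x₁ hx₁ x₁ hx₁
    rw [hφ.self _ x₁ hx₁] at h1
    have h3 := hφ.nonneg (ns k) _ (hxF k) _ (hyF k)
    simp only [hx, hy] at *
    linarith

/-- Maximum points of a penalized difference of `u` and `v`, along a subsequence. -/
structure IsDoublingSequence {N : ℕ} (Ω W : Set (Space N)) (u v G : Space N → ℝ)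
    (φ : ℕ → Space N → Space N → ℝ) (m : ℝ) (ns : ℕ → ℕ) (x y : ℕ → Space N) (xs : Space N) :
    Prop where
  strictMono : StrictMono ns
  limit_mem : xs ∈ closure Ω
  limit_mem' : xs ∈ W
  left_mem : ∀ k, x k ∈ closure Ω
  right_mem : ∀ k, y k ∈ closure Ω
  tendsto_left : Tendsto x atTop (𝓝 xs)
  tendsto_right : Tendsto y atTop (𝓝 xs)
  tendsto_penalization : Tendsto (fun k => φ (ns k) (x k) (y k)) atTop (𝓝 0)
  isMax : ∀ k, ∀ p ∈ closure Ω, ∀ q ∈ closure Ω,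
    u p - v q - φ (ns k) p q - G p - G q ≤
      u (x k) - v (y k) - φ (ns k) (x k) (y k) - G (x k) - G (y k)
  gap : ∀ k, m / 2 ≤ u (x k) - v (y k)

/-- The penalization may involve a local distance `d`, so the place of concentration must be known
before doubling. A maximum point `x₁` of the singly penalized difference is found first, `d` is
attached to `x₁`, and the localizer then forces the doubled sequence to converge inside the ball of
`x₁`. The predicate `Q` transports further local information about `x₁`. -/
lemma exists_localized_doubling {N : ℕ} {Ω : Set (Space N)}
    {Q : Space N → ℝ → (Space N → ℝ) → Prop}
    (hloc : ∀ x₁ ∈ closure Ω, ∃ r L d, IsLocalDistance Ω x₁ r L d ∧ Q x₁ r d) {u v : Space N → ℝ}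
    (hu : UpperSemicontinuousOn u (closure Ω)) (hv : LowerSemicontinuousOn v (closure Ω)) {K : ℝ}
    (hK : 1 ≤ K) (huK : ∀ x ∈ closure Ω, |u x| ≤ K) (hvK : ∀ x ∈ closure Ω, |v x| ≤ K)
    {x₀ : Space N} (hx₀ : x₀ ∈ closure Ω) {m : ℝ} (hm : 0 < m) (hmu : m ≤ u x₀ - v x₀)
    {l : ℝ} (hl : 0 < l) (hl1 : l ≤ 1) :
    ∃ (x₁ : Space N) (r L : ℝ) (d : Space N → ℝ) (W : Set (Space N)) (G : Space N → ℝ),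
      IsLocalDistance Ω x₁ r L d ∧ Q x₁ r d ∧
      W ⊆ Metric.ball x₁ r ∧ IsLocalizer Ω W K l G ∧
      ∀ φ, IsPenalization (closure Ω) φ →
        ∃ ns x y xs, IsDoublingSequence Ω W u v G φ m ns x y xs := by
  have hK0 : 0 < K := by linarith
  set R := l⁻¹ with hR
  have hR0 : 0 < R := inv_pos.2 hl
  have hout : ∀ x : Space N, R < dist x x₀ → truncSq l x₀ x = 1 := by
    intro x hx
    have : 1 < l * ‖x - x₀‖ := by
      rw [← dist_eq_norm]
      calc 1 = l * R := (mul_inv_cancel₀ hl.ne').symm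
        _ < _ := by gcongr
    unfold truncSq
    exact min_eq_right (by nlinarith)
  obtain ⟨x₁, hx₁, hx₁R, hmax⟩ : ∃ x₁ ∈ closure Ω, dist x₁ x₀ ≤ R ∧ ∀ x ∈ closure Ω,
      u x - v x - 8 * K * truncSq l x₀ x ≤ u x₁ - v x₁ - 8 * K * truncSq l x₀ x₁ := by
    have husc := UpperSemicontinuousOn.sub_sub_of_continuousOn hu hv
      (((continuous_truncSq (l := l) x₀).const_smul (8 * K)).continuousOn)
    have hx₀Q : x₀ ∈ Metric.closedBall x₀ R ∩ closure Ω :=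
      ⟨Metric.mem_closedBall_self hR0.le, hx₀⟩
    obtain ⟨x₁, hx₁, hmax⟩ := (husc.mono (s := closure Ω)
      (t := Metric.closedBall x₀ R ∩ closure Ω) inter_subset_right).exists_isMaxOn ⟨x₀, hx₀Q⟩
      ((isCompact_closedBall x₀ R).inter_right isClosed_closure)
    refine ⟨x₁, hx₁.2, hx₁.1, fun x hx => ?_⟩
    have h0 := hmax hx₀Q
    simp only [mem_ofPred_eq, Pi.smul_apply, smul_eq_mul, truncSq_self, mul_zero, sub_zero] at h0
    by_cases hxR : R < dist x x₀
    · have h1 := abs_le.1 (huK x hx)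
      have h2 := abs_le.1 (hvK x hx)
      rw [hout x hxR]
      linarith
    · exact hmax (show x ∈ _ from ⟨not_lt.1 hxR, hx⟩)
  have hm₁ : m ≤ u x₁ - v x₁ - 8 * K * truncSq l x₀ x₁ := by
    have := hmax x₀ hx₀
    rw [truncSq_self] at this
    linarith
  obtain ⟨r, L, d, hd, hd'⟩ := hloc x₁ hx₁
  have hr := hd.pos
  set q : ℝ := 8 * K + 4 with hq
  have hq0 : 0 < q := by positivity
  -- The three bounds serve in turn: `1/48` gives `4qτ ≤ K`, so the tilt cannot undo the
  -- confinement; the second puts the limit within `min r 1` of `x₁`; the third leaves a gap of `m /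
  -- 2`.
  set τ : ℝ := min (1 / 48) (min ((min r 1) ^ 2 / (4 * q)) (m / (8 * q))) with hτdef
  have hr1 : 0 < min r 1 := by positivity
  have hτ : 0 < τ := by positivity
  have hτ1 : τ ≤ 1 / 48 := min_le_left _ _
  have hτ2 : 4 * q * τ ≤ (min r 1) ^ 2 := by
    have : τ ≤ (min r 1) ^ 2 / (4 * q) := (min_le_right _ _).trans (min_le_left _ _)
    rw [le_div_iff₀ (by positivity)] at this
    linarith
  have hτ3 : 8 * q * τ ≤ m := by
    have : τ ≤ m / (8 * q) := (min_le_right _ _).trans (min_le_right _ _)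
    rw [le_div_iff₀ (by positivity)] at this
    linarith
  have hqτ : 4 * q * τ ≤ K := by rw [hq]; nlinarith
  have hG := isLocalizer_of_isLocalDistance (x₀ := x₀) hd hK hl hl1 hτ (by linarith)
  set G : Space N → ℝ := fun x => 4 * K * truncSq l x₀ x + l * truncSq 1 x₁ x -
        (8 * K + 4) * l * boundaryTilt τ d x with hGdef
  have htilt : ∀ x ∈ closure Ω, 0 ≤ q * l * boundaryTilt τ d x ∧
      q * l * boundaryTilt τ d x ≤ 2 * q * τ * l := by
    intro x hx
    have h1 := boundaryTilt_nonneg hd hτ hx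
    have h2 := boundaryTilt_le (d := d) hτ x
    refine ⟨by positivity, ?_⟩
    calc _ ≤ q * l * (2 * τ) := by gcongr
      _ = _ := by ring
  have hql : 2 * q * τ * l ≤ 2 * q * τ := mul_le_of_le_one_right (by positivity) hl1
  have hGlow : ∀ x ∈ closure Ω, 4 * K * truncSq l x₀ x - 2 * q * τ ≤ G x := by
    intro x hx
    have := (htilt x hx).2
    have := mul_nonneg hl.le (truncSq_nonneg (l := 1) x₁ x)
    simp only [hGdef]
    linarith
  have hGx₁ : u x₁ - v x₁ - 8 * K * truncSq l x₀ x₁ ≤ u x₁ - v x₁ - 2 * G x₁ := by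
    have := (htilt x₁ hx₁).1
    simp only [hGdef, truncSq_self]
    linarith
  refine ⟨x₁, r, L, d, _, G, hd, hd', fun x hx => hx.2.2, hG, fun φ hφ => ?_⟩
  obtain ⟨ns, x, y, xs, hns, hxs, hx, hy, hxl, hyl, hφl, hkmax, hkxs⟩ := exists_maximizers
    isClosed_closure hu hv huK hvK hG.continuousOn (c := 2 * q * τ)
    (fun x hx => by
      have := hGlow x hx
      have := mul_nonneg (by positivity : 0 ≤ 4 * K) (truncSq_nonneg (l := l) x₀ x)
      linarith) hφ hx₁ hx₁R
    (by
      intro x hx y hy hxy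
      have h1 := hGlow x hx
      have h2 := hGlow y hy
      have h3 := abs_le.1 (huK x hx)
      have h4 := abs_le.1 (hvK y hy)
      have h5 := mul_nonneg (by positivity : 0 ≤ 4 * K) (truncSq_nonneg (l := l) x₀ x)
      have h6 := mul_nonneg (by positivity : 0 ≤ 4 * K) (truncSq_nonneg (l := l) x₀ y)
      rcases hxy with h | h
      · rw [hout x h] at h1; linarith
      · rw [hout y h] at h2; linarith)
  refine ⟨ns, x, y, xs, hns, hxs, ?_, hx, hy, hxl, hyl, hφl, hkmax, ?_⟩
  · have h1 := hmax xs hxs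
    have h2 := (htilt xs hxs).2
    -- Maximality of `x₁` cancels the confining terms. Both sides carry the factor `l`, so the bound
    -- on `truncSq 1 x₁ xs` does not deteriorate for small `l`.
    have h3 : l * truncSq 1 x₁ xs ≤ 2 * q * τ * l := by
      simp only [hGdef] at hkxs hGx₁
      linarith
    have h4 : truncSq 1 x₁ xs ≤ 2 * q * τ := by
      rw [mul_comm] at h3
      exact le_of_mul_le_mul_right h3 hl
    have hr2 : (min r 1) ^ 2 ≤ 1 := pow_le_one₀ hr1.le (min_le_right _ _)
    have h5 : truncSq 1 x₁ xs < (min r 1) ^ 2 := by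
      have : 0 < q * τ := by positivity
      linarith
    have h6 := lt_one_of_truncSq_lt_one (h5.trans_le hr2)
    rw [one_mul] at h6
    have h7 : ‖xs - x₁‖ < min r 1 := by
      unfold truncSq at h5
      rw [one_mul, min_eq_left (pow_le_one₀ (norm_nonneg _) h6.le)] at h5
      exact lt_of_pow_lt_pow_left₀ 2 hr1.le h5
    refine ⟨?_, h6, ?_⟩
    · refine lt_one_of_truncSq_lt_one ?_
      have h8 := hGlow xs hxs
      have h9 := abs_le.1 (huK xs hxs)
      have h10 := abs_le.1 (hvK xs hxs)
      nlinarith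
    · rw [Metric.mem_ball, dist_eq_norm]
      exact h7.trans_le (min_le_left _ _)
  · intro k
    have h1 := hkmax k x₁ hx₁ x₁ hx₁
    rw [hφ.self _ x₁ hx₁] at h1
    have h2 := hφ.nonneg (ns k) _ (hx k) _ (hy k)
    have h3 := hGlow _ (hx k)
    have h4 := hGlow _ (hy k)
    have h5 := mul_nonneg (by positivity : 0 ≤ 4 * K) (truncSq_nonneg (l := l) x₀ (x k))
    have h6 := mul_nonneg (by positivity : 0 ≤ 4 * K) (truncSq_nonneg (l := l) x₀ (y k))
    linarith

/-! ### The viscosity inequalities at the maximum points -/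

/-- The gradient scale of the `k`-th penalization of a subsequence. -/
def scale (ns : ℕ → ℕ) (k : ℕ) : ℝ := (ns k : ℝ) + 1

lemma one_le_scale (ns : ℕ → ℕ) (k : ℕ) : 1 ≤ scale ns k := by
  have : (0:ℝ) ≤ ns k := Nat.cast_nonneg _
  unfold scale; linarith

lemma scale_pos (ns : ℕ → ℕ) (k : ℕ) : 0 < scale ns k := by linarith [one_le_scale ns k]

lemma tendsto_scale {ns : ℕ → ℕ} (hns : StrictMono ns) : Tendsto (scale ns) atTop atTop :=
  tendsto_atTop_add_const_right _ _ (tendsto_natCast_atTop_atTop.comp hns.tendsto_atTop)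

/-- Properties of the first partial maps of the penalizations along a sequence: they are `C¹`,
with increments controlled by the scale and almost nonnegative normal derivative. -/
structure IsRegularPenalization {N : ℕ} (Ω : Set (Space N)) (φ : ℕ → Space N → Space N → ℝ)
    (l : ℝ) (ns : ℕ → ℕ) (x y p : ℕ → Space N) : Prop where
  incr : ∀ᶠ k in atTop, ∀ q ∈ closure Ω, scale ns k * ‖q - x k‖ ≤ 1 →
    φ (ns k) q (y k) - φ (ns k) (x k) (y k) ≤ 4 * (scale ns k * ‖q - x k‖)
  contDiffAt : ∀ᶠ k in atTop, ContDiffAt ℝ 1 (fun s => φ (ns k) s (y k)) (x k)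
  hasGradientAt : ∀ᶠ k in atTop, HasGradientAt (fun s => φ (ns k) s (y k)) (p k) (x k)
  normal : ∀ᶠ k in atTop, x k ∈ frontier Ω → -l ≤ inner ℝ (p k) (outerNormal Ω (x k))

/-! ### Consequences of the inequality for one solution at the maximum points. -/

section OneSided

variable {N : ℕ} {Ω W : Set (Space N)} {μ : Space N → Measure (Space N)}
  {j : Space N → Space N → Space N} {σ Cj Λ : ℝ} {ρ : Space N → Space N → ℝ}
  {H : Space N → Space N → ℝ} {u G : Space N → ℝ} {K l : ℝ}
  {φ : ℕ → Space N → Space N → ℝ} {ns : ℕ → ℕ} {x y p : ℕ → Space N} {xs : Space N}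

/-- The test function is the penalization plus the localizer; its normal derivative is at least `-l
+ 2l > 0` at boundary points, so the equation is the active inequality. -/
lemma eventually_outerPart_le (h : IsJumpOperator Ω μ j σ Cj ρ Λ)
    (hu : IsViscositySubsolution Ω μ j Cj H u) (hl : 0 < l)
    (hG : IsLocalizer Ω W K l G) (hφ : IsRegularPenalization Ω φ l ns x y p)
    (hx : ∀ k, x k ∈ closure Ω) (hxl : Tendsto x atTop (𝓝 xs)) (hxs : xs ∈ W)
    (hmax : ∀ k, ∀ q ∈ closure Ω, u q - φ (ns k) q (y k) - G q ≤
      u (x k) - φ (ns k) (x k) (y k) - G (x k)) :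
    ∀ᶠ k in atTop, ∀ e > 0, ∀ᶠ ξ in 𝓝[>] (0 : ℝ),
      u (x k) - outerPart Ω μ j ξ u (x k) + H (x k) (p k + gradient G (x k)) ≤ e := by
  filter_upwards [hφ.contDiffAt, hφ.hasGradientAt, hφ.normal,
    hxl.eventually_mem (hG.isOpen.mem_nhds hxs)] with k h1 h2 h3 hW e he
  have hgG : HasGradientAt G (gradient G (x k)) (x k) :=
    ((hG.smooth _ hW).differentiableAt one_ne_zero).hasGradientAt
  have hg := (hasGradientAt_add h2 hgG).gradient
  have key := hu.eventually_le h (hx k) (h1.add (hG.smooth _ hW)) (by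
    filter_upwards [self_mem_nhdsWithin] with q hq
    have := hmax k q hq
    show u q - (φ (ns k) q (y k) + G q) ≤ u (x k) - (φ (ns k) (x k) (y k) + G (x k))
    linarith) (fun hf => by
    unfold normalDeriv
    have e1 := hG.normal _ hW hf
    have e2 := h3 hf
    rw [hg, inner_add_left]
    linarith) he
  rwa [hg] at key

/-- Short jumps are controlled by the maximum property and the slopes of penalization and localizer,
long ones by boundedness of `u`. The constant `200` is not optimized. -/
lemma eventually_incr_le (h : IsJumpOperator Ω μ j σ Cj ρ Λ) (hK : 1 ≤ K)
    (huK : ∀ x ∈ closure Ω, |u x| ≤ K) (hl1 : l ≤ 1)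
    (hG : IsLocalizer Ω W K l G) (hφ : IsRegularPenalization Ω φ l ns x y p)
    (hx : ∀ k, x k ∈ closure Ω)
    (hmax : ∀ k, ∀ q ∈ closure Ω, u q - φ (ns k) q (y k) - G q ≤
      u (x k) - φ (ns k) (x k) (y k) - G (x k)) :
    ∀ᶠ k in atTop, ∀ z, x k + j (x k) z ∈ closure Ω →
      u (x k + j (x k) z) - u (x k) ≤ 200 * K * Λ * weight (scale ns k) z := by
  filter_upwards [hφ.incr] with k hk z hz
  have hn := one_le_scale ns k
  have hΛ := h.one_le
  set n := scale ns k
  have hj := h.norm_jump_le (hx k) z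
  have b1 := abs_le.1 (huK _ hz)
  have b2 := abs_le.1 (huK _ (hx k))
  have hKΛ : K ≤ K * Λ := le_mul_of_one_le_right (by linarith) hΛ
  have hn0 : 0 ≤ n * ‖z‖ := by positivity
  have hKn : 0 ≤ K * Λ * (n * ‖z‖) := by positivity
  refine le_mul_weight ?_ (by linarith)
  have hk' := hk _ hz
  rw [add_sub_cancel_left] at hk'
  by_cases hle : n * ‖j (x k) z‖ ≤ 1
  · have h1 := hk' hle
    have h2 := hmax k _ hz
    have h3 := (abs_le.1 (hG.lip _ hz _ (hx k))).2
    rw [add_sub_cancel_left] at h3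
    have h4 : n * ‖j (x k) z‖ ≤ Λ * (n * ‖z‖) := by
      calc _ ≤ n * (Λ * ‖z‖) := by gcongr
        _ = _ := by ring
    have h5 : 22 * K * l * ‖j (x k) z‖ ≤ 22 * (K * Λ * (n * ‖z‖)) := by
      calc _ ≤ 22 * K * 1 * (Λ * ‖z‖) := by gcongr
        _ = 22 * (K * Λ * (1 * ‖z‖)) := by ring
        _ ≤ _ := by gcongr
    have h6 : Λ * (n * ‖z‖) ≤ K * Λ * (n * ‖z‖) := by
      rw [mul_assoc]
      exact le_mul_of_one_le_left (by positivity) hK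
    linarith
  · have h4 : 1 ≤ Λ * (n * ‖z‖) := by
      calc 1 ≤ n * ‖j (x k) z‖ := (not_le.1 hle).le
        _ ≤ n * (Λ * ‖z‖) := by gcongr
        _ = _ := by ring
    have h5 : K * 1 ≤ K * (Λ * (n * ‖z‖)) := by gcongr
    linarith

/-- Increments of slope `n` give a nonlocal term of order `n^σ`, and the equation transfers this
bound to the Hamiltonian. Growth of `H` faster than `n^σ` then becomes contradictory. -/
lemma eventually_hamiltonian_le (h : IsJumpOperator Ω μ j σ Cj ρ Λ)
    (hu : IsViscositySubsolution Ω μ j Cj H u) (hK : 1 ≤ K)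
    (huK : ∀ x ∈ closure Ω, |u x| ≤ K) (hl : 0 < l) (hl1 : l ≤ 1)
    (hG : IsLocalizer Ω W K l G) (hφ : IsRegularPenalization Ω φ l ns x y p)
    (hx : ∀ k, x k ∈ closure Ω) (hxl : Tendsto x atTop (𝓝 xs)) (hxs : xs ∈ W)
    (hmax : ∀ k, ∀ q ∈ closure Ω, u q - φ (ns k) q (y k) - G q ≤
      u (x k) - φ (ns k) (x k) (y k) - G (x k)) :
    ∀ᶠ k in atTop, H (x k) (p k + gradient G (x k)) ≤
      (2 * K + 200 * K * Λ * Λ * kernelMass N σ) * scale ns k ^ σ := by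
  filter_upwards [eventually_outerPart_le h hu hl hG hφ hx hxl hxs hmax,
    eventually_incr_le h hK huK hl1 hG hφ hx hmax] with k h1 h2
  obtain ⟨ξ, hξ, hξ0⟩ := ((h1 K (by linarith)).and self_mem_nhdsWithin).exists
  have hξ0' : 0 < ξ := hξ0
  have hΛ := h.one_le
  have h3 := h.outerPart_le (hx k) hξ0'
    (measurable_indicator_of_upperSemicontinuousOn isClosed_closure hu.2.1) huK
    (scale_pos ns k) (by positivity) h2
  have h4 : 1 ≤ scale ns k ^ σ := Real.one_le_rpow (one_le_scale ns k) h.order_pos.le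
  have h5 := (abs_le.1 (huK _ (hx k))).1
  have h6 : 2 * K * 1 ≤ 2 * K * scale ns k ^ σ := by gcongr
  linarith

end OneSided

/-- The comparison inequality at the maximum points of the penalized difference. -/
lemma eventually_gap_le {N : ℕ} {Ω W : Set (Space N)} {μ : Space N → Measure (Space N)}
    {j : Space N → Space N → Space N} {σ Cj Λ : ℝ} {ρ : Space N → Space N → ℝ}
    {H₁ H₂ : Space N → Space N → ℝ} {u v G d : Space N → ℝ} {K l m r L : ℝ} {x₁ : Space N}
    {φ : ℕ → Space N → Space N → ℝ} {ns : ℕ → ℕ} {x y p p' : ℕ → Space N} {xs : Space N}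
    (h : IsJumpOperator Ω μ j σ Cj ρ Λ) (hΩ : IsOpen Ω) (hO : DomainClassW2Infty Ω)
    (hu : IsViscositySubsolution Ω μ j Cj H₁ u) (hv : IsViscositySupersolution Ω μ j Cj H₂ v)
    (hK : 1 ≤ K) (huK : ∀ x ∈ closure Ω, |u x| ≤ K) (hvK : ∀ x ∈ closure Ω, |v x| ≤ K)
    (hm : 0 < m) (hl : 0 < l) (hl1 : l ≤ 1) (hd : IsLocalDistance Ω x₁ r L d)
    (hW : W ⊆ Metric.ball x₁ r) (hG : IsLocalizer Ω W K l G)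
    (hs : IsDoublingSequence Ω W u v G φ m ns x y xs)
    (hφs : ∀ n x y, φ n x y = φ n y x)
    (hφ : IsRegularPenalization Ω φ l ns x y p) (hφ' : IsRegularPenalization Ω φ l ns y x p')
    (hnxy : Tendsto (fun k => scale ns k * ‖x k - y k‖) atTop (𝓝 0))
    (hdd : ∀ᶠ k in atTop, |d (x k) - d (y k)| ≤ smoothScale σ (scale ns k))
    {θ : ℕ → ℝ} (hθ0 : ∀ k, 0 < θ k) (hθ : Tendsto θ atTop (𝓝 0))
    (hinc : ∀ᶠ k in atTop, ∀ z, x k + j (x k) z ∈ closure Ω → y k + j (y k) z ∈ closure Ω →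
      θ k * ‖z‖ ≤ 1 → φ (ns k) (x k + j (x k) z) (y k + j (y k) z) - φ (ns k) (x k) (y k) ≤
        θ k * ‖z‖) :
    ∀ᶠ k in atTop, m / 4 ≤ H₂ (y k) (-(p' k + gradient G (y k))) -
      H₁ (x k) (p k + gradient G (x k)) + 200 * K * Λ * Λ * kernelMass N σ * l ^ σ := by
  have hv' := hv.neg
  have hvK' : ∀ x ∈ closure Ω, |(-v x)| ≤ K := fun x hx => by rw [abs_neg]; exact hvK x hx
  have hmaxL : ∀ k, ∀ q ∈ closure Ω, u q - φ (ns k) q (y k) - G q ≤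
      u (x k) - φ (ns k) (x k) (y k) - G (x k) := fun k q hq => by
    have := hs.isMax k q hq (y k) (hs.right_mem k)
    linarith
  have hmaxR : ∀ k, ∀ q ∈ closure Ω, -v q - φ (ns k) q (x k) - G q ≤
      -v (y k) - φ (ns k) (y k) (x k) - G (y k) := fun k q hq => by
    have := hs.isMax k (x k) (hs.left_mem k) q hq
    rw [hφs _ q, hφs _ (y k)]
    linarith
  have hΛ := h.one_le
  have hM := kernelMass_nonneg N σ
  have hσ := h.order_pos
  set B : ℝ := 200 * K * Λ with hB
  have hKΛ : K ≤ K * Λ := le_mul_of_one_le_right (by linarith) hΛ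
  have hB0 : 0 ≤ B := by positivity
  have hmis := tendsto_integral_mismatch h hd hΩ (volume_frontier_eq_zero h.dim_pos hΩ hO)
    hs.left_mem hs.right_mem hs.limit_mem (hW hs.limit_mem') hs.tendsto_left hs.tendsto_right
    (one_le_scale ns) (tendsto_scale hs.strictMono) hnxy hdd
  have hθσ : Tendsto (fun k => θ k ^ σ) atTop (𝓝 0) := by
    have := (Real.continuous_rpow_const hσ.le).tendsto' 0 0 (Real.zero_rpow hσ.ne')
    exact this.comp hθ
  have hnσ : Tendsto (fun k => ‖x k - y k‖ * scale ns k ^ σ) atTop (𝓝 0) := by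
    refine squeeze_zero (fun k => mul_nonneg (norm_nonneg _)
      (Real.rpow_nonneg (scale_pos ns k).le _)) (fun k => ?_) hnxy
    rw [mul_comm]
    gcongr
    calc _ ≤ scale ns k ^ (1:ℝ) :=
          Real.rpow_le_rpow_of_exponent_le (one_le_scale ns k) h.order_lt_one.le
      _ = _ := Real.rpow_one _
  have hsmall : Tendsto (fun k => B * Λ * kernelMass N σ * (θ k ^ σ + ‖x k - y k‖ * scale ns k ^ σ) +
      B * Λ * ∫ z in mismatch Ω j (x k) (y k), weight (scale ns k) z * kernel N σ z)
      atTop (𝓝 0) := by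
    simpa using ((hθσ.add hnσ).const_mul (B * Λ * kernelMass N σ)).add (hmis.const_mul (B * Λ))
  filter_upwards [eventually_outerPart_le h hu hl hG hφ hs.left_mem hs.tendsto_left
      hs.limit_mem' hmaxL,
    eventually_outerPart_le h hv' hl hG hφ' hs.right_mem hs.tendsto_right hs.limit_mem' hmaxR,
    eventually_incr_le h hK huK hl1 hG hφ hs.left_mem hmaxL,
    eventually_incr_le h hK hvK' hl1 hG hφ' hs.right_mem hmaxR, hinc,
    hsmall.eventually_lt_const (show 0 < m / 8 by positivity)] with k a1 a2 i1 i2 hk hsm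
  -- A common truncation for both inequalities. The two errors `m / 16` and the vanishing error `m /
  -- 8` reduce the gap `m / 2` to `m / 4`.
  obtain ⟨ξ, ⟨e1, e2⟩, hξ⟩ := (((a1 (m / 16) (by positivity)).and
    (a2 (m / 16) (by positivity))).and self_mem_nhdsWithin).exists
  have hξ0 : 0 < ξ := hξ
  have hxk := hs.left_mem k
  have hyk := hs.right_mem k
  have hneg : outerPart Ω μ j ξ (fun q => - v q) (y k) = - outerPart Ω μ j ξ v (y k) := by
    unfold outerPart
    rw [← integral_neg]
    congr 1; ext z; ring
  rw [hneg] at e2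
  have hvm : Measurable ((closure Ω).indicator v) := by
    have := (measurable_indicator_of_upperSemicontinuousOn isClosed_closure hv'.2.1).neg
    convert this using 1
    ext q
    by_cases hq : q ∈ closure Ω
    · simp [hq]
    · simp [hq]
  have hdiff := h.outerPart_sub_outerPart_le hxk hyk hξ0
    (measurable_indicator_of_upperSemicontinuousOn isClosed_closure hu.2.1) hvm huK hvK
    -- `a` is the one-sided slope, `b` the slope of the penalization along simultaneous jumps, `c`
    -- that of the localizer. After integration `b^σ` vanishes and only `l^σ` survives.
    (a := scale ns k) (b := θ k) (c := l) (B := B) (scale_pos ns k) (hθ0 k) hl hB0 i1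
    (fun z hz => by have := i2 z hz; linarith) (fun z hz hz' => by
      have g1 := hs.isMax k _ hz _ hz'
      have b1 := abs_le.1 (huK _ hz)
      have b2 := abs_le.1 (huK _ hxk)
      have b3 := abs_le.1 (hvK _ hz')
      have b4 := abs_le.1 (hvK _ hyk)
      have wθ : 0 ≤ B * weight (θ k) z := mul_nonneg hB0 (weight_nonneg (hθ0 k).le z)
      have wl : 0 ≤ B * weight l z := mul_nonneg hB0 (weight_nonneg hl.le z)
      by_cases hle : θ k * ‖z‖ ≤ 1
      · have g2 := hk z hz hz' hle
        have g3 : θ k * ‖z‖ ≤ B * weight (θ k) z := by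
          have : weight (θ k) z = θ k * ‖z‖ := min_eq_left hle
          rw [this]
          have h0 : 0 ≤ θ k * ‖z‖ := mul_nonneg (hθ0 k).le (norm_nonneg z)
          have : 1 ≤ B := by linarith
          exact le_mul_of_one_le_left h0 this
        have l1 := (abs_le.1 (hG.lip _ hz _ hxk)).2
        have l2 := (abs_le.1 (hG.lip _ hz' _ hyk)).2
        have o1 := (abs_le.1 (hG.osc _ hz _ hxk)).2
        have o2 := (abs_le.1 (hG.osc _ hz' _ hyk)).2
        rw [add_sub_cancel_left] at l1 l2
        have c1 : 22 * K * l * ‖j (x k) z‖ ≤ 22 * K * l * (Λ * ‖z‖) := by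
          gcongr; exact h.norm_jump_le hxk z
        have c2 : 22 * K * l * ‖j (y k) z‖ ≤ 22 * K * l * (Λ * ‖z‖) := by
          gcongr; exact h.norm_jump_le hyk z
        have hKl : 0 ≤ K * Λ * (l * ‖z‖) := by positivity
        have g4 : (G (x k + j (x k) z) - G (x k)) + (G (y k + j (y k) z) - G (y k)) ≤
            B * weight l z := by
          refine le_mul_weight ?_ (by linarith)
          rw [hB]
          linarith
        linarith
      · have g3 : weight (θ k) z = 1 := min_eq_right (not_le.1 hle).le
        rw [g3] at wθ ⊢
        linarith)
  have hgap := hs.gap k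
  rw [hB] at hdiff hsm
  linarith

/-! ### The two penalizations -/

lemma abs_sqrt_sq_add_sub_le (τ a b : ℝ) :
    |√(a ^ 2 + τ ^ 2) - √(b ^ 2 + τ ^ 2)| ≤ |a - b| := by
  have key : ∀ a b : ℝ, √(a ^ 2 + τ ^ 2) ≤ |a - b| + √(b ^ 2 + τ ^ 2) := by
    intro a b
    have hb : 0 ≤ b ^ 2 + τ ^ 2 := by positivity
    have h1 : |b| ≤ √(b ^ 2 + τ ^ 2) := Real.abs_le_sqrt (by nlinarith [sq_nonneg τ])
    refine Real.sqrt_le_iff.2 ⟨by positivity, ?_⟩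
    rw [add_sq, Real.sq_sqrt hb, sq_abs]
    have h2 : b * (a - b) ≤ |a - b| * √(b ^ 2 + τ ^ 2) := by
      calc _ ≤ |b * (a - b)| := le_abs_self _
        _ = |a - b| * |b| := by rw [abs_mul, mul_comm]
        _ ≤ _ := by gcongr
    nlinarith
  rw [abs_le]
  have h1 := key a b
  have h2 := key b a
  rw [abs_sub_comm b a] at h2
  constructor <;> linarith

lemma abs_sqrt_norm_sub_le {N : ℕ} (τ : ℝ) (a b : Space N) :
    |√(‖a‖ ^ 2 + τ ^ 2) - √(‖b‖ ^ 2 + τ ^ 2)| ≤ ‖a - b‖ :=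
  (abs_sqrt_sq_add_sub_le τ _ _).trans (abs_norm_sub_norm_le a b)

lemma le_sqrt_sq_add (t τ : ℝ) : |t| ≤ √(t ^ 2 + τ ^ 2) :=
  Real.abs_le_sqrt (by nlinarith [sq_nonneg τ])

lemma self_le_sqrt_sq_add (t τ : ℝ) : τ ≤ √(t ^ 2 + τ ^ 2) :=
  Real.le_sqrt_of_sq_le (by nlinarith [sq_nonneg t])

lemma half_le_div_sqrt {t τ : ℝ} (hτ : 0 < τ) (h : τ < t) : 1 / 2 ≤ t / √(t ^ 2 + τ ^ 2) := by
  have hpos : 0 < √(t ^ 2 + τ ^ 2) := Real.sqrt_pos.2 (by positivity)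
  rw [div_le_div_iff₀ two_pos hpos, one_mul]
  refine Real.sqrt_le_iff.2 ⟨by linarith, by nlinarith⟩

lemma hasDerivAt_sqrt_add {τ : ℝ} (hτ : 0 < τ) (n : ℝ) {q : ℝ} (hq : 0 ≤ q) :
    HasDerivAt (fun q => n * (√(q + τ ^ 2) - τ)) (n / (2 * √(q + τ ^ 2))) q := by
  have h0 : q + τ ^ 2 ≠ 0 := by positivity
  have h := ((((hasDerivAt_id q).add_const (τ ^ 2)).sqrt h0).sub_const τ).const_mul n
  exact h.congr_deriv (by simp [div_eq_mul_inv])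

lemma hasDerivAt_sqrt_sq_add {τ : ℝ} (hτ : 0 < τ) (n c t : ℝ) :
    HasDerivAt (fun t => n * (√((t - c) ^ 2 + τ ^ 2) - τ))
      (n * ((t - c) / √((t - c) ^ 2 + τ ^ 2))) t := by
  have h1 : HasDerivAt (fun t => (t - c) ^ 2) (2 * (t - c)) t :=
    (((hasDerivAt_id t).sub_const c).pow 2).congr_deriv (by simp)
  have h := (hasDerivAt_sqrt_add hτ n (sq_nonneg (t - c))).comp t h1
  refine h.congr_deriv ?_
  have : √((t - c) ^ 2 + τ ^ 2) ≠ 0 := (Real.sqrt_pos.2 (by positivity)).ne'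
  field_simp

/-- The smoothed multiple of the distance, used for coercive Hamiltonians. -/
noncomputable def lipPenalty {N : ℕ} (τ : ℕ → ℝ) (n : ℕ) (x y : Space N) : ℝ :=
  ((n : ℝ) + 1) * (√(‖x - y‖ ^ 2 + τ n ^ 2) - τ n)

/-- The gradient of `lipPenalty` in its first variable. -/
noncomputable def lipPenaltyGrad {N : ℕ} (τ : ℕ → ℝ) (n : ℕ) (x y : Space N) : Space N :=
  (((n : ℝ) + 1) / √(‖x - y‖ ^ 2 + τ n ^ 2)) • (x - y)

/-- The penalization used for Bellman Hamiltonians: quadratic, with an additional smoothed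
multiple of the difference of the distances to the boundary. -/
noncomputable def quadPenalty {N : ℕ} (d : Space N → ℝ) (τ : ℕ → ℝ) (n : ℕ) (x y : Space N) : ℝ :=
  ((n : ℝ) + 1) ^ 2 * ‖x - y‖ ^ 2 + ((n : ℝ) + 1) * (√((d x - d y) ^ 2 + τ n ^ 2) - τ n)

/-- The normal speed of `quadPenalty`. -/
noncomputable def quadPenaltySlope {N : ℕ} (d : Space N → ℝ) (τ : ℕ → ℝ) (n : ℕ) (x y : Space N) :
    ℝ := ((n : ℝ) + 1) * ((d x - d y) / √((d x - d y) ^ 2 + τ n ^ 2))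

/-- The gradient of `quadPenalty` in its first variable. -/
noncomputable def quadPenaltyGrad {N : ℕ} (d : Space N → ℝ) (τ : ℕ → ℝ) (n : ℕ) (x y : Space N) :
    Space N :=
  (2 * ((n : ℝ) + 1) ^ 2) • (x - y) + quadPenaltySlope d τ n x y • gradient d x

lemma lipPenalty_comm {N : ℕ} (τ : ℕ → ℝ) (n : ℕ) (x y : Space N) :
    lipPenalty τ n x y = lipPenalty τ n y x := by
  unfold lipPenalty; rw [norm_sub_rev]

lemma quadPenalty_comm {N : ℕ} (d : Space N → ℝ) (τ : ℕ → ℝ) (n : ℕ) (x y : Space N) :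
    quadPenalty d τ n x y = quadPenalty d τ n y x := by
  unfold quadPenalty
  rw [norm_sub_rev, show (d x - d y) ^ 2 = (d y - d x) ^ 2 by ring]

/-! ### Admissibility of the two penalizations. -/

section Penalty

variable {N : ℕ} {Ω : Set (Space N)} {σ : ℝ} {τ : ℕ → ℝ} {d : Space N → ℝ} {x₁ : Space N}
  {r L : ℝ}

lemma scale_mul_smoothing_le (hσ : σ < 1)
    (hτσ : ∀ n : ℕ, τ n ≤ smoothScale σ ((n : ℝ) + 1)) (n : ℕ) :
    ((n : ℝ) + 1) * τ n ≤ ((n : ℝ) + 1)⁻¹ := by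
  have hn : (1:ℝ) ≤ (n : ℝ) + 1 := by linarith [(Nat.cast_nonneg n : (0:ℝ) ≤ n)]
  calc _ ≤ ((n : ℝ) + 1) * (((n : ℝ) + 1) ^ 2)⁻¹ := by
        gcongr
        exact (hτσ n).trans (smoothScale_le hσ hn)
    _ = _ := by field_simp

lemma isPenalization_lipPenalty (hσ : σ < 1)
    (hτσ : ∀ n : ℕ, τ n ≤ smoothScale σ ((n : ℝ) + 1)) (hτ : ∀ n, 0 < τ n) :
    IsPenalization (closure Ω) (lipPenalty τ) := by
  refine ⟨fun n => ?_, fun n x _ => ?_, fun n x _ y _ => ?_, fun n x _ y _ => ?_⟩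
  · unfold lipPenalty; fun_prop
  · simp [lipPenalty, Real.sqrt_sq (hτ n).le]
  · have := self_le_sqrt_sq_add ‖x - y‖ (τ n)
    exact mul_nonneg (by positivity) (by linarith)
  · have h1 := le_sqrt_sq_add ‖x - y‖ (τ n)
    rw [abs_of_nonneg (norm_nonneg _)] at h1
    have h2 := scale_mul_smoothing_le hσ hτσ n
    have h3 : ((n : ℝ) + 1)⁻¹ ≤ 1 := inv_le_one_of_one_le₀ (by simp)
    have h4 : ((n : ℝ) + 1) * ‖x - y‖ ≤ ((n : ℝ) + 1) * √(‖x - y‖ ^ 2 + τ n ^ 2) := by gcongr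
    unfold lipPenalty
    linarith

lemma isPenalization_quadPenalty (hd : IsLocalDistance Ω x₁ r L d) (hτ : ∀ n, 0 < τ n) :
    IsPenalization (closure Ω) (quadPenalty d τ) := by
  have hdc : ContinuousOn d (closure Ω) := by
    refine (LipschitzOnWith.of_dist_le_mul (K := 1) fun a ha b hb => ?_).continuousOn
    rw [Real.dist_eq, dist_eq_norm, NNReal.coe_one, one_mul]
    exact hd.lip_closure a ha b hb
  have hnn : ∀ (n : ℕ) (x y : Space N),
      0 ≤ ((n : ℝ) + 1) * (√((d x - d y) ^ 2 + τ n ^ 2) - τ n) := by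
    intro n x y
    have := self_le_sqrt_sq_add (d x - d y) (τ n)
    exact mul_nonneg (by positivity) (by linarith)
  refine ⟨fun n => ?_, fun n x _ => ?_, fun n x _ y _ => ?_, fun n x _ y _ => ?_⟩
  · have h1 : ContinuousOn (fun q : Space N × Space N => d q.1) (closure Ω ×ˢ closure Ω) :=
      hdc.comp continuousOn_fst fun q hq => hq.1
    have h2 : ContinuousOn (fun q : Space N × Space N => d q.2) (closure Ω ×ˢ closure Ω) :=
      hdc.comp continuousOn_snd fun q hq => hq.2
    exact (continuousOn_const.mul ((continuous_fst.sub continuous_snd).norm.pow 2).continuousOn).add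
      (continuousOn_const.mul
        ((((h1.sub h2).pow 2).add continuousOn_const).sqrt.sub continuousOn_const))
  · simp [quadPenalty, Real.sqrt_sq (hτ n).le]
  · exact add_nonneg (by positivity) (hnn n x y)
  · have := hnn n x y
    unfold quadPenalty
    nlinarith [sq_nonneg (((n : ℝ) + 1) * ‖x - y‖ - 1),
      mul_nonneg (by positivity : (0:ℝ) ≤ (n : ℝ) + 1) (norm_nonneg (x - y))]

lemma hasGradientAt_lipPenalty (hτ : ∀ n, 0 < τ n) (n : ℕ) (x y : Space N) :
    HasGradientAt (fun s => lipPenalty τ n s y) (lipPenaltyGrad τ n x y) x := by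
  have h := hasGradientAt_scalar_comp (hasDerivAt_sqrt_add (hτ n) ((n : ℝ) + 1)
    (sq_nonneg ‖x - y‖)) (hasGradientAt_norm_sub_sq y x)
  have e : lipPenaltyGrad τ n x y =
      (((n : ℝ) + 1) / (2 * √(‖x - y‖ ^ 2 + τ n ^ 2))) • ((2 : ℝ) • (x - y)) := by
    rw [lipPenaltyGrad, smul_smul]
    congr 1
    have : √(‖x - y‖ ^ 2 + τ n ^ 2) ≠ 0 :=
      (Real.sqrt_pos.2 (by have := hτ n; positivity)).ne'
    field_simp
  rw [e]
  exact h

lemma contDiff_lipPenalty (hτ : ∀ n, 0 < τ n) (n : ℕ) (y : Space N) :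
    ContDiff ℝ 1 (fun s => lipPenalty τ n s y) := by
  unfold lipPenalty
  refine contDiff_const.mul (ContDiff.sub (ContDiff.sqrt ((contDiff_norm_sub_sq y).add
    contDiff_const) fun x => ?_) contDiff_const)
  have := hτ n
  positivity

lemma hasGradientAt_quadPenalty (hd : IsLocalDistance Ω x₁ r L d) (hτ : ∀ n, 0 < τ n) (n : ℕ)
    {x : Space N} (hx : x ∈ Metric.ball x₁ r) (y : Space N) :
    HasGradientAt (fun s => quadPenalty d τ n s y) (quadPenaltyGrad d τ n x y) x := by
  have h1 := hasGradientAt_scalar_comp (F := fun t => ((n : ℝ) + 1) ^ 2 * t)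
    (by simpa using (hasDerivAt_id (‖x - y‖ ^ 2)).const_mul (((n : ℝ) + 1) ^ 2))
    (hasGradientAt_norm_sub_sq y x)
  have h2 := hasGradientAt_scalar_comp (hasDerivAt_sqrt_sq_add (hτ n) ((n : ℝ) + 1) (d y) (d x))
    (hd.differentiableAt hx).hasGradientAt
  have h := hasGradientAt_add h1 h2
  have e : quadPenaltyGrad d τ n x y = (((n : ℝ) + 1) ^ 2) • ((2 : ℝ) • (x - y)) +
      (((n : ℝ) + 1) * ((d x - d y) / √((d x - d y) ^ 2 + τ n ^ 2))) • gradient d x := by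
    rw [quadPenaltyGrad, quadPenaltySlope, smul_smul, mul_comm (2:ℝ)]
  rw [e]
  exact h

lemma contDiffAt_quadPenalty (hd : IsLocalDistance Ω x₁ r L d) (hτ : ∀ n, 0 < τ n) (n : ℕ)
    {x : Space N} (hx : x ∈ Metric.ball x₁ r) (y : Space N) :
    ContDiffAt ℝ 1 (fun s => quadPenalty d τ n s y) x := by
  have hdx : ContDiffAt ℝ 1 d x := hd.contDiffOn.contDiffAt (Metric.isOpen_ball.mem_nhds hx)
  unfold quadPenalty
  refine (contDiffAt_const.mul (contDiff_norm_sub_sq y).contDiffAt).add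
    (contDiffAt_const.mul (ContDiffAt.sub (ContDiffAt.sqrt
      (((hdx.sub contDiffAt_const).pow 2).add contDiffAt_const) ?_) contDiffAt_const))
  have := hτ n
  positivity

variable {ns : ℕ → ℕ} {x y : ℕ → Space N} {xs : Space N} {l : ℝ}

/-- The gradient is at most `n/‖x - y‖` times `x - y`, whose component along the outer normal is at
least `-L‖x - y‖²`. The defect is `L n‖x - y‖`, eventually below `l`. -/
lemma isRegularPenalization_lipPenalty (hd : IsLocalDistance Ω x₁ r L d) (hτ : ∀ n, 0 < τ n)
    (hl : 0 < l) (hy : ∀ k, y k ∈ closure Ω)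
    (hxl : Tendsto x atTop (𝓝 xs)) (hyl : Tendsto y atTop (𝓝 xs)) (hxs : xs ∈ Metric.ball x₁ r)
    (hnxy : Tendsto (fun k => scale ns k * ‖x k - y k‖) atTop (𝓝 0)) :
    IsRegularPenalization Ω (lipPenalty τ) l ns x y
      (fun k => lipPenaltyGrad τ (ns k) (x k) (y k)) := by
  refine ⟨Eventually.of_forall fun k q _ _ => ?_,
    Eventually.of_forall fun k => (contDiff_lipPenalty hτ _ _).contDiffAt,
    Eventually.of_forall fun k => hasGradientAt_lipPenalty hτ _ _ _, ?_⟩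
  · have h1 := (abs_le.1 (abs_sqrt_norm_sub_le (τ (ns k)) (q - y k) (x k - y k))).2
    rw [sub_sub_sub_cancel_right] at h1
    have h2 := scale_pos ns k
    have h3 := mul_le_mul_of_nonneg_left h1 h2.le
    have h4 : 0 ≤ scale ns k * ‖q - x k‖ := by positivity
    unfold lipPenalty
    rw [show ((ns k : ℝ) + 1) = scale ns k from rfl]
    linarith
  · have hlim : Tendsto (fun k => L * (scale ns k * ‖x k - y k‖)) atTop (𝓝 0) := by
      simpa using hnxy.const_mul L
    filter_upwards [hlim.eventually_lt_const hl,
      hxl.eventually_mem (Metric.isOpen_ball.mem_nhds hxs),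
      hyl.eventually_mem (Metric.isOpen_ball.mem_nhds hxs)] with k h1 hxk hyk hf
    have hn : outerNormal Ω (x k) = - gradient d (x k) := by
      rw [hd.gradient_eq _ hxk hf, neg_neg]
    have hin := hd.inner_gradient_ge hxk hyk hf (hy k)
    have hS : 0 < √(‖x k - y k‖ ^ 2 + τ (ns k) ^ 2) :=
      Real.sqrt_pos.2 (by have := hτ (ns k); positivity)
    have hS' := le_sqrt_sq_add ‖x k - y k‖ (τ (ns k))
    rw [abs_of_nonneg (norm_nonneg _)] at hS'
    have hL := hd.nonneg_const
    have hsc := scale_pos ns k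
    rw [lipPenaltyGrad, real_inner_smul_left, hn, show ((ns k : ℝ) + 1) = scale ns k from rfl]
    have e : inner ℝ (x k - y k) (-gradient d (x k)) =
        inner ℝ (gradient d (x k)) (y k - x k) := by
      rw [inner_neg_right, ← inner_neg_left, neg_sub, real_inner_comm]
    rw [e]
    set S := √(‖x k - y k‖ ^ 2 + τ (ns k) ^ 2)
    calc -l ≤ -(L * (scale ns k * ‖x k - y k‖)) := by linarith
      _ ≤ -(scale ns k / S * (L * ‖x k - y k‖ ^ 2)) := by
          rw [neg_le_neg_iff, div_mul_eq_mul_div, div_le_iff₀ hS]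
          have : ‖x k - y k‖ * ‖x k - y k‖ ≤ ‖x k - y k‖ * S := by gcongr
          have := mul_le_mul_of_nonneg_left this (by positivity : 0 ≤ scale ns k * L)
          linarith
      _ = scale ns k / S * (-(L * ‖x k - y k‖ ^ 2)) := by ring
      _ ≤ _ := by gcongr

/-- The quadratic part has a normal defect of at most `2L(n‖x - y‖)²`. The distance part has the
favourable sign: on the boundary `d x = 0 ≤ d y`, so its slope along the inner direction `∇d` is
nonpositive. -/
lemma isRegularPenalization_quadPenalty (hd : IsLocalDistance Ω x₁ r L d) (hτ : ∀ n, 0 < τ n)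
    (hl : 0 < l) (hx : ∀ k, x k ∈ closure Ω) (hy : ∀ k, y k ∈ closure Ω)
    (hxl : Tendsto x atTop (𝓝 xs)) (hyl : Tendsto y atTop (𝓝 xs)) (hxs : xs ∈ Metric.ball x₁ r)
    (hnxy : Tendsto (fun k => scale ns k * ‖x k - y k‖) atTop (𝓝 0)) :
    IsRegularPenalization Ω (quadPenalty d τ) l ns x y
      (fun k => quadPenaltyGrad d τ (ns k) (x k) (y k)) := by
  have hxe := hxl.eventually_mem (Metric.isOpen_ball.mem_nhds hxs)
  have hye := hyl.eventually_mem (Metric.isOpen_ball.mem_nhds hxs)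
  refine ⟨?_, hxe.mono fun k hk => contDiffAt_quadPenalty hd hτ _ hk _,
    hxe.mono fun k hk => hasGradientAt_quadPenalty hd hτ _ hk _, ?_⟩
  · filter_upwards [hnxy.eventually_lt_const (show (0:ℝ) < 1 / 2 by norm_num)] with k hk q hq hqx
    have hn := scale_pos ns k
    have h1 := (abs_le.1 (abs_sqrt_sq_add_sub_le (τ (ns k)) (d q - d (y k))
      (d (x k) - d (y k)))).2
    rw [sub_sub_sub_cancel_right] at h1
    have h2 := mul_le_mul_of_nonneg_left (h1.trans (hd.lip_closure q hq _ (hx k))) hn.le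
    unfold quadPenalty
    rw [show ((ns k : ℝ) + 1) = scale ns k from rfl]
    have h3 : ‖q - y k‖ ≤ ‖q - x k‖ + ‖x k - y k‖ := norm_sub_le_norm_sub_add_norm_sub _ _ _
    set n := scale ns k
    set a := ‖q - x k‖
    set b := ‖x k - y k‖
    have ha : 0 ≤ a := norm_nonneg _
    have hb : 0 ≤ b := norm_nonneg _
    have h4 : n ^ 2 * ‖q - y k‖ ^ 2 ≤ n ^ 2 * (a + b) ^ 2 := by gcongr
    have h5 : (n * a) * (n * b) ≤ (n * a) * (1 / 2) := by gcongr
    have h6 : (n * a) * (n * a) ≤ (n * a) * 1 := by gcongr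
    nlinarith
  · have hlim : Tendsto (fun k => 2 * L * (scale ns k * ‖x k - y k‖) ^ 2) atTop (𝓝 0) := by
      simpa using (hnxy.pow 2).const_mul (2 * L)
    filter_upwards [hlim.eventually_lt_const hl, hxe, hye] with k h1 hxk hyk hf
    have hn : outerNormal Ω (x k) = - gradient d (x k) := by
      rw [hd.gradient_eq _ hxk hf, neg_neg]
    have hin := hd.inner_gradient_ge hxk hyk hf (hy k)
    have hsc := scale_pos ns k
    have e : inner ℝ (x k - y k) (-gradient d (x k)) =
        inner ℝ (gradient d (x k)) (y k - x k) := by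
      rw [inner_neg_right, ← inner_neg_left, neg_sub, real_inner_comm]
    have hslope : quadPenaltySlope d τ (ns k) (x k) (y k) ≤ 0 := by
      unfold quadPenaltySlope
      rw [hd.eq_zero _ hxk hf]
      exact mul_nonpos_of_nonneg_of_nonpos (by positivity)
        (div_nonpos_of_nonpos_of_nonneg (by linarith [hd.nonneg _ (hy k)]) (Real.sqrt_nonneg _))
    rw [quadPenaltyGrad, inner_add_left, real_inner_smul_left, real_inner_smul_left, hn, e,
      inner_neg_right, real_inner_self_eq_norm_sq, hd.norm_eq _ hxk hf,
      show ((ns k : ℝ) + 1) = scale ns k from rfl]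
    have := mul_le_mul_of_nonneg_left hin (by positivity : 0 ≤ 2 * scale ns k ^ 2)
    nlinarith

end Penalty

/-! ### Coercive Hamiltonians -/

lemma eventually_mul_rpow_add_lt {σ m c : ℝ} (C D : ℝ) (hσ : 0 < σ) (hm : σ < m) (hc : 0 < c) :
    ∀ᶠ n : ℝ in atTop, C * n ^ σ + D < c * n ^ m := by
  filter_upwards [(tendsto_rpow_atTop (sub_pos.2 hm)).eventually_gt_atTop ((|C| + |D|) / c),
    eventually_ge_atTop 1] with n h1 h2
  have h3 : 1 ≤ n ^ σ := Real.one_le_rpow h2 hσ.le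
  rw [div_lt_iff₀ hc] at h1
  have h4 : n ^ m = n ^ (m - σ) * n ^ σ := by
    rw [← Real.rpow_add (by linarith)]; congr 1; ring
  have h5 : D ≤ |D| * n ^ σ := (le_abs_self D).trans (le_mul_of_one_le_right (abs_nonneg D) h3)
  have h6 : C * n ^ σ ≤ |C| * n ^ σ := by gcongr; exact le_abs_self C
  have h7 : (|C| + |D|) * n ^ σ < n ^ (m - σ) * c * n ^ σ := by gcongr
  rw [h4]
  linarith

lemma lipPenaltyGrad_swap {N : ℕ} (τ : ℕ → ℝ) (n : ℕ) (x y : Space N) :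
    lipPenaltyGrad τ n y x = - lipPenaltyGrad τ n x y := by
  unfold lipPenaltyGrad
  rw [norm_sub_rev, ← smul_neg, neg_sub]

lemma norm_lipPenaltyGrad {N : ℕ} (τ : ℕ → ℝ) (n : ℕ) (x y : Space N) :
    ‖lipPenaltyGrad τ n x y‖ = ((n : ℝ) + 1) * (‖x - y‖ / √(‖x - y‖ ^ 2 + τ n ^ 2)) := by
  rw [lipPenaltyGrad, norm_smul, Real.norm_of_nonneg (by positivity)]
  ring

lemma norm_lipPenaltyGrad_le {N : ℕ} (τ : ℕ → ℝ) (n : ℕ) (x y : Space N) :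
    ‖lipPenaltyGrad τ n x y‖ ≤ (n : ℝ) + 1 := by
  rw [norm_lipPenaltyGrad]
  refine mul_le_of_le_one_right (by positivity) (div_le_one_of_le₀ ?_ (Real.sqrt_nonneg _))
  have := le_sqrt_sq_add ‖x - y‖ (τ n)
  rwa [abs_of_nonneg (norm_nonneg _)] at this

lemma half_le_norm_lipPenaltyGrad {N : ℕ} {τ : ℕ → ℝ} {n : ℕ} {x y : Space N} (hτ : 0 < τ n)
    (h : τ n < ‖x - y‖) : ((n : ℝ) + 1) / 2 ≤ ‖lipPenaltyGrad τ n x y‖ := by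
  rw [norm_lipPenaltyGrad]
  have := mul_le_mul_of_nonneg_left (half_le_div_sqrt hτ h) (by positivity : (0:ℝ) ≤ (n : ℝ) + 1)
  linarith

lemma exists_small_parameter {σ s e : ℝ} (a b : ℝ) (hs : 0 < s) (he : 0 < e)
    (hσ : 0 < σ) : ∃ l : ℝ, 0 < l ∧ l ≤ 1 ∧ a * l ^ σ ≤ e ∧ b * l ≤ s := by
  have h1 : Tendsto (fun l : ℝ => a * l ^ σ) (𝓝[>] 0) (𝓝 0) := by
    have := ((Real.continuous_rpow_const hσ.le).tendsto' 0 0 (Real.zero_rpow hσ.ne')).const_mul a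
    rw [mul_zero] at this
    exact this.mono_left nhdsWithin_le_nhds
  have h2 : Tendsto (fun l : ℝ => b * l) (𝓝[>] 0) (𝓝 0) :=
    ((continuous_const_mul b).tendsto' 0 0 (mul_zero b)).mono_left nhdsWithin_le_nhds
  obtain ⟨l, ⟨⟨hl1, hl2⟩, hl3⟩, hl4⟩ := (((h1.eventually_lt_const he).and
    (h2.eventually_lt_const hs)).and
    (mem_nhdsWithin_of_mem_nhds (Iio_mem_nhds (zero_lt_one' ℝ)))).and self_mem_nhdsWithin |>.exists
  exact ⟨l, hl4, le_of_lt hl3, hl1.le, hl2.le⟩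

lemma tendsto_inv_scale {ns : ℕ → ℕ} (hns : StrictMono ns) :
    Tendsto (fun k => (scale ns k)⁻¹) atTop (𝓝 0) :=
  tendsto_inv_atTop_zero.comp (tendsto_scale hns)

/-- Comparison of a subsolution for a coercive Hamiltonian `H₁` with a supersolution for `H₂`. -/
lemma not_gap_of_coercive {N : ℕ} {Ω : Set (Space N)} {μ : Space N → Measure (Space N)}
    {j : Space N → Space N → Space N} {σ Cj Λ : ℝ} {ρ : Space N → Space N → ℝ}
    {H₁ H₂ : Space N → Space N → ℝ} {u v : Space N → ℝ} {K m : ℝ} {x₀ : Space N}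
    (h : IsJumpOperator Ω μ j σ Cj ρ Λ) (hΩ : IsOpen Ω) (hO : DomainClassW2Infty Ω)
    (hu : IsViscositySubsolution Ω μ j Cj H₁ u) (hv : IsViscositySupersolution Ω μ j Cj H₂ v)
    (hK : 1 ≤ K) (huK : ∀ x ∈ closure Ω, |u x| ≤ K) (hvK : ∀ x ∈ closure Ω, |v x| ≤ K)
    (hx₀ : x₀ ∈ closure Ω) (hm : 0 < m) (hmu : m ≤ u x₀ - v x₀) (hco : AssumptionH1 Ω H₁ σ)
    (hS : ∃ s : ℝ, 0 < s ∧ ∀ R : ℝ, ∃ δ : ℝ, 0 < δ ∧ ∀ x ∈ closure Ω, ∀ y ∈ closure Ω,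
      ‖x - y‖ < δ → ∀ p q, ‖p‖ ≤ R → ‖p - q‖ ≤ s → H₂ y p - H₁ x q ≤ m / 16) : False := by
  obtain ⟨s, hs, hS⟩ := hS
  choose δ hδ hS using hS
  obtain ⟨m', hm', c, hc, D, -, hco⟩ := hco
  have hσ := h.order_pos
  have hσ1 := h.order_lt_one
  have hΛ := h.one_le
  have hM := kernelMass_nonneg N σ
  -- `44K` is twice the gradient bound `22K` of the localizer, which enters the two Hamiltonians
  -- with opposite signs.
  obtain ⟨l, hl, hl1, hlσ, hls⟩ := exists_small_parameter
    (e := m / 16) (σ := σ) (200 * K * Λ * Λ * kernelMass N σ) (44 * K)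
    hs (by positivity) hσ
  obtain ⟨x₁, r, L, d, W, G, hd, -, hW, hG, hdoub⟩ := exists_localized_doubling
    (Q := fun _ _ _ => True)
    (fun x₁ hx₁ => by
      obtain ⟨r, L, d, hd, -⟩ := exists_isLocalDistance h.dim_pos hΩ hO hx₁
      exact ⟨r, L, d, hd, trivial⟩)
    hu.2.1 hv.2.1 hK huK hvK hx₀ hm hmu hl hl1
  -- All gradients at stage `n` have norm at most `n + 1 + 22K`, so the smoothing can be taken below
  -- the modulus of the Hamiltonians at that radius, however fast it degenerates.
  set τ : ℕ → ℝ := fun n => min (smoothScale σ ((n : ℝ) + 1)) (δ ((n : ℝ) + 1 + 22 * K) / 2)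
    with hτdef
  have hτ : ∀ n, 0 < τ n := fun n =>
    lt_min (smoothScale_pos (by positivity)) (half_pos (hδ _))
  have hτσ : ∀ n : ℕ, τ n ≤ smoothScale σ ((n : ℝ) + 1) := fun n => min_le_left _ _
  have hτδ : ∀ n : ℕ, τ n < δ ((n : ℝ) + 1 + 22 * K) := fun n =>
    (min_le_right _ _).trans_lt (half_lt_self (hδ _))
  obtain ⟨ns, x, y, xs, hdb⟩ := hdoub _ (isPenalization_lipPenalty hσ1 hτσ hτ)
  have hinv := tendsto_inv_scale hdb.strictMono
  have hsc : ∀ k, (ns k : ℝ) + 1 = scale ns k := fun k => rfl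
  have hnxy : Tendsto (fun k => scale ns k * ‖x k - y k‖) atTop (𝓝 0) := by
    refine squeeze_zero (fun k => mul_nonneg (scale_pos ns k).le (norm_nonneg _)) (fun k => ?_)
      (by simpa using hdb.tendsto_penalization.add hinv)
    have h1 := le_sqrt_sq_add ‖x k - y k‖ (τ (ns k))
    rw [abs_of_nonneg (norm_nonneg _)] at h1
    have h2 := scale_mul_smoothing_le hσ1 hτσ (ns k)
    have h3 := mul_le_mul_of_nonneg_left h1 (scale_pos ns k).le
    unfold lipPenalty
    rw [hsc] at h2 ⊢
    linarith
  have hnyx : Tendsto (fun k => scale ns k * ‖y k - x k‖) atTop (𝓝 0) := by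
    simpa only [norm_sub_rev] using hnxy
  have hxs := hW hdb.limit_mem'
  have hreg := isRegularPenalization_lipPenalty hd hτ hl hdb.right_mem hdb.tendsto_left
    hdb.tendsto_right hxs hnxy
  have hreg' := isRegularPenalization_lipPenalty hd hτ hl hdb.left_mem hdb.tendsto_right
    hdb.tendsto_left hxs hnyx
  have hWx := hdb.tendsto_left.eventually_mem (hG.isOpen.mem_nhds hdb.limit_mem')
  have hWy := hdb.tendsto_right.eventually_mem (hG.isOpen.mem_nhds hdb.limit_mem')
  have hKl : 22 * K * l ≤ 22 * K := mul_le_of_le_one_right (by positivity) hl1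
  -- Otherwise the penalization gradient exceeds `n/2`, the full gradient exceeds `n/4` once `n ≥
  -- 88K`, and coercivity of order `n^m'` with `m' > σ` contradicts the bound of order `n^σ`.
  have hclose : ∀ᶠ k in atTop, ‖x k - y k‖ ≤ τ (ns k) := by
    filter_upwards [eventually_hamiltonian_le h hu hK huK hl hl1 hG hreg hdb.left_mem
      hdb.tendsto_left hdb.limit_mem' (fun k q hq => by
        have := hdb.isMax k q hq (y k) (hdb.right_mem k)
        linarith), hWx,
      (tendsto_scale hdb.strictMono).eventually (eventually_mul_rpow_add_lt
        (2 * K + 200 * K * Λ * Λ * kernelMass N σ) D hσ hm'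
        (by positivity : 0 < c * (1 / 4) ^ m')),
      (tendsto_scale hdb.strictMono).eventually_ge_atTop (88 * K)] with k h1 h2 h3 h4
    by_contra! hlt
    have h5 := half_le_norm_lipPenaltyGrad (hτ (ns k)) hlt
    rw [hsc] at h5
    have h6 := hG.norm_gradient_le _ h2 (hdb.left_mem k)
    have h7 := norm_sub_le_norm_add (lipPenaltyGrad τ (ns k) (x k) (y k)) (gradient G (x k))
    have h8 : scale ns k * (1 / 4) ≤
        ‖lipPenaltyGrad τ (ns k) (x k) (y k) + gradient G (x k)‖ := by linarith
    have h9 := hco _ (hdb.left_mem k) (lipPenaltyGrad τ (ns k) (x k) (y k) + gradient G (x k))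
    have h10 : (scale ns k * (1 / 4)) ^ m' ≤
        ‖lipPenaltyGrad τ (ns k) (x k) (y k) + gradient G (x k)‖ ^ m' :=
      Real.rpow_le_rpow (mul_nonneg (scale_pos ns k).le (by norm_num)) h8 (hσ.trans hm').le
    rw [Real.mul_rpow (scale_pos ns k).le (by norm_num)] at h10
    have h11 := mul_le_mul_of_nonneg_left h10 hc.le
    linarith
  have hgap := eventually_gap_le h hΩ hO hu hv hK huK hvK hm hl hl1 hd hW hG hdb
    (lipPenalty_comm τ) hreg hreg' hnxy (hclose.mono fun k hk =>
      (hd.lip_closure _ (hdb.left_mem k) _ (hdb.right_mem k)).trans (hk.trans (hτσ _)))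
    (θ := fun k => Λ * (scale ns k * ‖x k - y k‖) + (scale ns k)⁻¹)
    (fun k => by have := scale_pos ns k; positivity)
    (by simpa using (hnxy.const_mul Λ).add hinv)
    (Eventually.of_forall fun k z _ _ _ => by
      have h1 := (abs_le.1 (abs_sqrt_norm_sub_le (τ (ns k))
        (x k + j (x k) z - (y k + j (y k) z)) (x k - y k))).2
      have e : x k + j (x k) z - (y k + j (y k) z) - (x k - y k) = j (x k) z - j (y k) z := by abel
      rw [e] at h1
      have h2 := h1.trans (h.jump_sub_le _ (hdb.left_mem k) _ (hdb.right_mem k) z)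
      have h3 := mul_le_mul_of_nonneg_left h2 (scale_pos ns k).le
      have h4 : 0 ≤ (scale ns k)⁻¹ * ‖z‖ :=
        mul_nonneg (inv_nonneg.2 (scale_pos ns k).le) (norm_nonneg z)
      unfold lipPenalty
      rw [hsc]
      linarith)
  obtain ⟨k, h1, h2, h3, h4⟩ := (hgap.and (hclose.and (hWx.and hWy))).exists
  have g1 := hG.norm_gradient_le _ h3 (hdb.left_mem k)
  have g2 := hG.norm_gradient_le _ h4 (hdb.right_mem k)
  rw [lipPenaltyGrad_swap] at h1
  set p := lipPenaltyGrad τ (ns k) (x k) (y k) with hp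
  have hpn : ‖p‖ ≤ (ns k : ℝ) + 1 := norm_lipPenaltyGrad_le _ _ _ _
  have h5 := hS ((ns k : ℝ) + 1 + 22 * K) _ (hdb.left_mem k) _ (hdb.right_mem k)
    (h2.trans_lt (hτδ _)) (-(-p + gradient G (y k))) (p + gradient G (x k))
    (by
      rw [norm_neg]
      refine (norm_add_le _ _).trans ?_
      rw [norm_neg]
      linarith)
    (by
      rw [show -(-p + gradient G (y k)) - (p + gradient G (x k)) =
        -(gradient G (x k) + gradient G (y k)) by abel, norm_neg]
      refine (norm_add_le _ _).trans ?_
      linarith)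
  -- The contradiction is `m / 4 ≤ m / 16 + m / 16`.
  linarith

/-! ### Bellman Hamiltonians -/

lemma IsLocalDistance.mono {N : ℕ} {Ω : Set (Space N)} {x₁ : Space N} {r r' L : ℝ}
    {d : Space N → ℝ} (hd : IsLocalDistance Ω x₁ r L d) (hr' : 0 < r') (hle : r' ≤ r) :
    IsLocalDistance Ω x₁ r' L d where
  pos := hr'
  nonneg_const := hd.nonneg_const
  contDiffOn := hd.contDiffOn.mono (Metric.ball_subset_ball hle)
  lip x hx y hy := hd.lip x (Metric.ball_subset_ball hle hx) y (Metric.ball_subset_ball hle hy)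
  bound x hx := hd.bound x (Metric.ball_subset_ball hle hx)
  lip_closure := hd.lip_closure
  nonneg := hd.nonneg
  nonpos x hx := hd.nonpos x (Metric.ball_subset_ball hle hx)
  eq_zero x hx := hd.eq_zero x (Metric.ball_subset_ball hle hx)
  gradient_eq x hx := hd.gradient_eq x (Metric.ball_subset_ball hle hx)
  norm_eq x hx := hd.norm_eq x (Metric.ball_subset_ball hle hx)
  norm_le x hx := hd.norm_le x (Metric.ball_subset_ball hle hx)
  strip y hy s w hs hsr := hd.strip y (Metric.ball_subset_ball hle hy) s w hs (hsr.trans hle)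

/-- Along large multiples of `ε ∇d`, the Hamiltonian is uniformly very positive or uniformly very
negative near `x₁`. -/
def IsDominated {N : ℕ} (Ω : Set (Space N)) (H : Space N → Space N → ℝ) (x₁ : Space N)
    (d : Space N → ℝ) (D ε c r : ℝ) : Prop :=
  (∀ x ∈ Metric.ball x₁ r, x ∈ closure Ω → ∀ s : ℝ, 0 ≤ s → ∀ q,
    c * s - D * (1 + ‖q‖) ≤ H x ((ε * s) • gradient d x + q)) ∨
  (∀ x ∈ Metric.ball x₁ r, x ∈ closure Ω → ∀ s : ℝ, 0 ≤ s → ∀ q,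
    H x ((ε * s) • gradient d x + q) ≤ -(c * s) + D * (1 + ‖q‖))

lemma IsDominated.mono {N : ℕ} {Ω : Set (Space N)} {H : Space N → Space N → ℝ} {x₁ : Space N}
    {d : Space N → ℝ} {D ε c c' r r' : ℝ} (h : IsDominated Ω H x₁ d D ε c r) (hc : c' ≤ c)
    (hr : r' ≤ r) : IsDominated Ω H x₁ d D ε c' r' := by
  refine h.imp (fun h x hx hxc s hs q => ?_) (fun h x hx hxc s hs q => ?_)
  · have := h x (Metric.ball_subset_ball hr hx) hxc s hs q
    have := mul_le_mul_of_nonneg_right hc hs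
    linarith
  · have := h x (Metric.ball_subset_ball hr hx) hxc s hs q
    have := mul_le_mul_of_nonneg_right hc hs
    linarith

/-! ### Continuity and normal domination from the supremum formula. -/

section Bellman

variable {N : ℕ} {Ω : Set (Space N)} {H : Space N → Space N → ℝ} {A : Type*}
  {b : Space N → A → Space N} {f : Space N → A → ℝ} {B C : ℝ}

lemma bellman_sub_le [Nonempty A] (hB : ∀ x ∈ closure Ω, ∀ α, ‖b x α‖ ≤ B ∧ |f x α| ≤ B)
    (hH : ∀ x ∈ closure Ω, ∀ p, IsLUB (range fun α => - inner ℝ (b x α) p - f x α) (H x p))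
    {ω : ℝ → ℝ} (hω : ∀ α, ∀ x ∈ closure Ω, ∀ y ∈ closure Ω, |f x α - f y α| ≤ ω ‖x - y‖)
    (hC : ∀ α, ∀ x ∈ closure Ω, ∀ y ∈ closure Ω, ‖b x α - b y α‖ ≤ C * ‖x - y‖)
    {x y : Space N} (hx : x ∈ closure Ω) (hy : y ∈ closure Ω) (p q : Space N) :
    H y p - H x q ≤ C * ‖x - y‖ * ‖p‖ + B * ‖p - q‖ + ω ‖x - y‖ := by
  rw [sub_le_iff_le_add]
  refine (hH y hy p).2 ?_
  rintro _ ⟨α, rfl⟩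
  have h1 : - inner ℝ (b x α) q - f x α ≤ H x q := (hH x hx q).1 ⟨α, rfl⟩
  have h2 : inner ℝ (b x α - b y α) p ≤ C * ‖x - y‖ * ‖p‖ :=
    (real_inner_le_norm _ _).trans (by gcongr; exact hC α x hx y hy)
  have h3 : inner ℝ (b x α) (q - p) ≤ B * ‖p - q‖ := by
    rw [norm_sub_rev]
    exact (real_inner_le_norm _ _).trans (by gcongr; exact (hB x hx α).1)
  have h4 := (abs_le.1 (hω α x hx y hy)).2
  rw [inner_sub_left] at h2
  rw [inner_sub_right] at h3
  show - inner ℝ (b y α) p - f y α ≤ _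
  linarith

/-- For the first alternative one control bounds the supremum from below. For the second all
controls must push the same way, and compactness of `A` gives a uniform rate. Either sign persists
near `x₁` because drift and gradient are Lipschitz. -/
lemma isDominated_of_bellman [Nonempty A] [TopologicalSpace A] [CompactSpace A] {x₁ : Space N}
    {r L : ℝ} {d : Space N → ℝ} (hd : IsLocalDistance Ω x₁ r L d) (hx₁ : x₁ ∈ closure Ω)
    (hbc : ContinuousOn (Function.uncurry b) (closure Ω ×ˢ univ))
    (hB : ∀ x ∈ closure Ω, ∀ α, ‖b x α‖ ≤ B ∧ |f x α| ≤ B)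
    (hH : ∀ x ∈ closure Ω, ∀ p, IsLUB (range fun α => - inner ℝ (b x α) p - f x α) (H x p))
    (hC0 : 0 < C)
    (hC : ∀ α, ∀ x ∈ closure Ω, ∀ y ∈ closure Ω, ‖b x α - b y α‖ ≤ C * ‖x - y‖) {ε : ℝ}
    (hε : |ε| = 1) (hsign : (∃ α, ε * inner ℝ (b x₁ α) (gradient d x₁) < 0) ∨
      ∀ α, 0 < ε * inner ℝ (b x₁ α) (gradient d x₁)) :
    ∃ c > 0, ∃ r' > 0, IsDominated Ω H x₁ d B ε c r' := by
  have hr := hd.pos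
  have hL := hd.nonneg_const
  have hx₁b : x₁ ∈ Metric.ball x₁ r := Metric.mem_ball_self hr
  have hB0 : 0 ≤ B := (norm_nonneg _).trans (hB x₁ hx₁ (Classical.arbitrary A)).1
  -- `C + B * L` is a Lipschitz constant at `x₁` of the normal drift. With `c` half of the rate at
  -- `x₁`, a rate `c` is kept in this ball.
  have hvar : ∀ c > 0, ∀ x ∈ Metric.ball x₁ (min r (c / (C + B * L))), x ∈ closure Ω → ∀ α,
      |ε * inner ℝ (b x α) (gradient d x) - ε * inner ℝ (b x₁ α) (gradient d x₁)| ≤ c := by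
    intro c hc x hx hxc α
    have hxr := Metric.ball_subset_ball (min_le_left _ _) hx
    have hxd : ‖x - x₁‖ ≤ c / (C + B * L) := by
      rw [← dist_eq_norm]
      exact (Metric.mem_ball.1 hx).le.trans (min_le_right _ _)
    rw [le_div_iff₀ (by positivity)] at hxd
    rw [← mul_sub, abs_mul, hε, one_mul, show inner ℝ (b x α) (gradient d x) -
      inner ℝ (b x₁ α) (gradient d x₁) = inner ℝ (b x α - b x₁ α) (gradient d x) +
        inner ℝ (b x₁ α) (gradient d x - gradient d x₁) by
      rw [inner_sub_left, inner_sub_right]; ring]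
    have h1 : |inner ℝ (b x α - b x₁ α) (gradient d x)| ≤ (C * ‖x - x₁‖) * 1 :=
      (abs_real_inner_le_norm _ _).trans (mul_le_mul (hC α x hxc x₁ hx₁) (hd.norm_le x hxr hxc)
        (norm_nonneg _) (by positivity))
    have h2 : |inner ℝ (b x₁ α) (gradient d x - gradient d x₁)| ≤ B * (L * ‖x - x₁‖) :=
      (abs_real_inner_le_norm _ _).trans (mul_le_mul (hB x₁ hx₁ α).1 (hd.lip x hxr x₁ hx₁b)
        (norm_nonneg _) hB0)
    refine (abs_add_le _ _).trans ?_
    linarith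
  have hval : ∀ x ∈ closure Ω, ∀ (s : ℝ) (q : Space N) α,
      |(- inner ℝ (b x α) ((ε * s) • gradient d x + q) - f x α) +
        s * (ε * inner ℝ (b x α) (gradient d x))| ≤ B * (1 + ‖q‖) := by
    intro x hx s q α
    have h1 : |inner ℝ (b x α) q| ≤ B * ‖q‖ :=
      (abs_real_inner_le_norm _ _).trans (by gcongr; exact (hB x hx α).1)
    have h2 := abs_le.1 (hB x hx α).2
    rw [inner_add_right, real_inner_smul_right, show -(ε * s * inner ℝ (b x α) (gradient d x) +
      inner ℝ (b x α) q) - f x α + s * (ε * inner ℝ (b x α) (gradient d x)) =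
        -(inner ℝ (b x α) q + f x α) by ring, abs_neg]
    refine (abs_add_le _ _).trans ?_
    linarith [(hB x hx α).2]
  rcases hsign with ⟨α, hα⟩ | hα
  · set c := -(ε * inner ℝ (b x₁ α) (gradient d x₁)) / 2 with hc
    have hc0 : 0 < c := by rw [hc]; linarith
    refine ⟨c, hc0, _, lt_min hr (by positivity : 0 < c / (C + B * L)), Or.inl ?_⟩
    intro x hx hxc s hs q
    have h1 : - inner ℝ (b x α) ((ε * s) • gradient d x + q) - f x α ≤ _ :=
      (hH x hxc ((ε * s) • gradient d x + q)).1 ⟨α, rfl⟩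
    have h2 := (abs_le.1 (hval x hxc s q α)).1
    have h3 := (abs_le.1 (hvar c hc0 x hx hxc α)).2
    have h4 : ε * inner ℝ (b x α) (gradient d x) ≤ -c := by linarith
    have h5 := mul_le_mul_of_nonneg_left h4 hs
    linarith
  · have hcont : Continuous fun α => ε * inner ℝ (b x₁ α) (gradient d x₁) := by
      have : Continuous fun α => b x₁ α := by
        rw [← continuousOn_univ]
        exact hbc.comp (by fun_prop : Continuous fun α => (x₁, α)).continuousOn
          fun α _ => ⟨hx₁, mem_univ _⟩
      fun_prop
    obtain ⟨α₀, -, hmin⟩ := isCompact_univ.exists_isMinOn univ_nonempty hcont.continuousOn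
    set c := ε * inner ℝ (b x₁ α₀) (gradient d x₁) / 2 with hc
    have hc0 : 0 < c := half_pos (hα α₀)
    refine ⟨c, hc0, _, lt_min hr (by positivity : 0 < c / (C + B * L)), Or.inr ?_⟩
    intro x hx hxc s hs q
    refine (hH x hxc _).2 ?_
    rintro _ ⟨α, rfl⟩
    have h2 := (abs_le.1 (hval x hxc s q α)).2
    have h3 := (abs_le.1 (hvar c hc0 x hx hxc α)).1
    have h6 : ε * inner ℝ (b x₁ α₀) (gradient d x₁) ≤ ε * inner ℝ (b x₁ α) (gradient d x₁) :=
      hmin (mem_univ α)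
    have h4 : c ≤ ε * inner ℝ (b x α) (gradient d x) := by linarith
    have h5 := mul_le_mul_of_nonneg_left h4 hs
    show - inner ℝ (b x α) ((ε * s) • gradient d x + q) - f x α ≤ _
    linarith

/-- At each boundary point, and for each direction `±∇d`, either some control has negative normal
drift or all have positive one. On `Γ_in` and `Γ_out` the two directions use different alternatives;
on `Γ` both use the first. -/
lemma exists_isDominated_of_bellman [Nonempty A] [TopologicalSpace A] [CompactSpace A]
    {x₁ : Space N} {r L : ℝ} {d : Space N → ℝ} (hd : IsLocalDistance Ω x₁ r L d)
    (hx₁ : x₁ ∈ frontier Ω)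
    (hbc : ContinuousOn (Function.uncurry b) (closure Ω ×ˢ univ))
    (hB : ∀ x ∈ closure Ω, ∀ α, ‖b x α‖ ≤ B ∧ |f x α| ≤ B)
    (hH : ∀ x ∈ closure Ω, ∀ p, IsLUB (range fun α => - inner ℝ (b x α) p - f x α) (H x p))
    (hC0 : 0 < C)
    (hC : ∀ α, ∀ x ∈ closure Ω, ∀ y ∈ closure Ω, ‖b x α - b y α‖ ≤ C * ‖x - y‖)
    (hΓ : AssumptionB Ω b) :
    ∃ c > 0, ∃ r' > 0, r' ≤ r ∧
      IsDominated Ω H x₁ d B 1 c r' ∧ IsDominated Ω H x₁ d B (-1) c r' := by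
  have hx₁c := frontier_subset_closure hx₁
  have hg : gradient d x₁ = - outerNormal Ω x₁ :=
    hd.gradient_eq _ (Metric.mem_ball_self hd.pos) hx₁
  have hn : ∀ α, inner ℝ (b x₁ α) (gradient d x₁) = - inner ℝ (b x₁ α) (outerNormal Ω x₁) :=
    fun α => by rw [hg, inner_neg_right]
  have hsign : ((∃ α, 1 * inner ℝ (b x₁ α) (gradient d x₁) < 0) ∨
      ∀ α, 0 < 1 * inner ℝ (b x₁ α) (gradient d x₁)) ∧
      ((∃ α, (-1) * inner ℝ (b x₁ α) (gradient d x₁) < 0) ∨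
      ∀ α, 0 < (-1) * inner ℝ (b x₁ α) (gradient d x₁)) := by
    simp only [hn]
    rcases (hΓ.1 ▸ hx₁ : x₁ ∈ GammaIn Ω b ∪ GammaOut Ω b ∪ GammaMixed Ω b) with
      (⟨-, h⟩ | ⟨-, h⟩) | ⟨-, α₁, α₂, h1, h2⟩
    · exact ⟨Or.inr fun α => by linarith [h α],
        Or.inl ⟨Classical.arbitrary A, by linarith [h (Classical.arbitrary A)]⟩⟩
    · exact ⟨Or.inl ⟨Classical.arbitrary A, by linarith [h (Classical.arbitrary A)]⟩,
        Or.inr fun α => by linarith [h α]⟩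
    · exact ⟨Or.inl ⟨α₂, by linarith⟩, Or.inl ⟨α₁, by linarith⟩⟩
  obtain ⟨c, hc, r₁, hr₁, h1⟩ := isDominated_of_bellman hd hx₁c hbc hB hH hC0 hC
    (ε := 1) (by simp) hsign.1
  obtain ⟨c', hc', r₂, hr₂, h2⟩ := isDominated_of_bellman hd hx₁c hbc hB hH hC0 hC
    (ε := -1) (by simp) hsign.2
  exact ⟨min c c', lt_min hc hc', min r (min r₁ r₂), lt_min hd.pos (lt_min hr₁ hr₂),
    min_le_left _ _,
    h1.mono (min_le_left _ _) ((min_le_right _ _).trans (min_le_left _ _)),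
    h2.mono (min_le_right _ _) ((min_le_right _ _).trans (min_le_right _ _))⟩

end Bellman

/-- Increments of `quadPenalty` along simultaneous jumps. -/
lemma exists_quadPenalty_incr_le {N : ℕ} {Ω : Set (Space N)} {μ : Space N → Measure (Space N)}
    {j : Space N → Space N → Space N} {σ Cj Λ : ℝ} {ρ : Space N → Space N → ℝ}
    (h : IsJumpOperator Ω μ j σ Cj ρ Λ) {x₁ xs : Space N} {r L : ℝ} {d : Space N → ℝ}
    (hd : IsLocalDistance Ω x₁ r L d) (hxs : xs ∈ Metric.ball x₁ r) (τ : ℕ → ℝ) :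
    ∃ C : ℝ, 0 ≤ C ∧ ∀ᶠ q : Space N × Space N in 𝓝 (xs, xs),
      q.1 ∈ closure Ω → q.2 ∈ closure Ω → ∀ z, q.1 + j q.1 z ∈ closure Ω →
      q.2 + j q.2 z ∈ closure Ω → ∀ n : ℕ, ((n : ℝ) + 1) * ‖q.1 - q.2‖ ≤ 1 →
      C * (((n : ℝ) + 1) * ‖q.1 - q.2‖) * ‖z‖ ≤ 1 →
      quadPenalty d τ n (q.1 + j q.1 z) (q.2 + j q.2 z) - quadPenalty d τ n q.1 q.2 ≤
        C * (((n : ℝ) + 1) * ‖q.1 - q.2‖) * ‖z‖ := by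
  have hΛ := h.one_le
  have hL := hd.nonneg_const
  obtain ⟨s, hs, hsr⟩ := exists_between (Metric.mem_ball.1 hxs)
  have hrs : 0 < r - s := by linarith
  -- The first term handles jumps that stay in the ball of `d`. The others handle long jumps, where
  -- `‖z‖ > (r - s) / Λ` and the Lipschitz bound of `d` on `closure Ω` suffices.
  set C₁ : ℝ := 2 * L * Λ + 2 * Λ / (r - s) + Λ with hC₁
  have hC₁0 : 0 ≤ C₁ := by positivity
  have hs' : Metric.ball x₁ s ∈ 𝓝 xs := Metric.isOpen_ball.mem_nhds hs
  refine ⟨3 * Λ + C₁, by positivity, ?_⟩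
  rw [nhds_prod_eq]
  filter_upwards [prod_mem_prod hs' hs'] with q hq hx hy z hxz hyz n hn1 hn2
  set x := q.1
  set y := q.2
  set m : ℝ := (n : ℝ) + 1 with hm
  have hm0 : 0 < m := by positivity
  have hjd := h.jump_sub_le _ hx _ hy z
  have hz := norm_nonneg z
  have ha := norm_nonneg (x - y)
  have hXY : ‖x + j x z - (y + j y z)‖ ≤ ‖x - y‖ * (1 + Λ * ‖z‖) := by
    rw [show x + j x z - (y + j y z) = (x - y) + (j x z - j y z) by abel]
    refine (norm_add_le _ _).trans ?_
    linarith
  have hsecond : |(d (x + j x z) - d (y + j y z)) - (d x - d y)| ≤ C₁ * (‖x - y‖ * ‖z‖) := by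
    have hxz0 : 0 ≤ ‖x - y‖ * ‖z‖ := by positivity
    by_cases hle : s + Λ * ‖z‖ ≤ r
    · refine (abs_second_difference_jump_le h hd hx hy hq.1 hq.2 hle).trans ?_
      have : 2 * L * Λ ≤ C₁ := by
        have : 0 ≤ 2 * Λ / (r - s) := by positivity
        rw [hC₁]; linarith
      calc _ = 2 * L * Λ * (‖x - y‖ * ‖z‖) := by ring
        _ ≤ _ := by gcongr
    · have h1 : 1 ≤ Λ / (r - s) * ‖z‖ := by
        rw [div_mul_eq_mul_div, one_le_div hrs]
        linarith
      have h2 := hd.lip_closure _ hxz _ hyz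
      have h3 := hd.lip_closure _ hx _ hy
      have h4 := abs_sub (d (x + j x z) - d (y + j y z)) (d x - d y)
      have h5 : ‖x - y‖ * 1 ≤ ‖x - y‖ * (Λ / (r - s) * ‖z‖) := by gcongr
      have h6 : 0 ≤ 2 * L * Λ * (‖x - y‖ * ‖z‖) := by positivity
      calc _ ≤ ‖x - y‖ * (1 + Λ * ‖z‖) + ‖x - y‖ := by linarith
        _ ≤ 2 * (‖x - y‖ * (Λ / (r - s) * ‖z‖)) + Λ * (‖x - y‖ * ‖z‖) +
            2 * L * Λ * (‖x - y‖ * ‖z‖) := by linarith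
        _ = _ := by rw [hC₁]; ring
  have hsq := (abs_le.1 (abs_sqrt_sq_add_sub_le (τ n) (d (x + j x z) - d (y + j y z))
    (d x - d y))).2
  have h1 := mul_le_mul_of_nonneg_left (hsq.trans hsecond) hm0.le
  have h2 : ‖x + j x z - (y + j y z)‖ ^ 2 ≤ (‖x - y‖ * (1 + Λ * ‖z‖)) ^ 2 := by gcongr
  have h3 := mul_le_mul_of_nonneg_left h2 (sq_nonneg m)
  set a := ‖x - y‖
  set t := ‖z‖
  have ha' : 0 ≤ m * a := by positivity
  -- The quadratic part grows by at most `(ma)²(2Λt + Λ²t²)`; with `ma ≤ 1` and `Λ(ma)t ≤ 1` this is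
  -- at most `3Λ(ma)t`.
  have h4 : Λ * (m * a) * t ≤ 1 := by
    refine le_trans ?_ hn2
    gcongr
    linarith
  have h5 : (m * a) * ((m * a) * (2 * Λ * t)) ≤ 1 * ((m * a) * (2 * Λ * t)) := by gcongr
  have h6 : (Λ * (m * a) * t) * (Λ * (m * a) * t) ≤ 1 * (Λ * (m * a) * t) := by gcongr
  unfold quadPenalty
  rw [← hm]
  nlinarith

lemma quadPenaltySlope_swap {N : ℕ} (d : Space N → ℝ) (τ : ℕ → ℝ) (n : ℕ) (x y : Space N) :
    quadPenaltySlope d τ n y x = - quadPenaltySlope d τ n x y := by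
  unfold quadPenaltySlope
  rw [show (d y - d x) ^ 2 = (d x - d y) ^ 2 by ring]
  ring

lemma abs_quadPenaltySlope_le {N : ℕ} (d : Space N → ℝ) (τ : ℕ → ℝ) (n : ℕ) (x y : Space N) :
    |quadPenaltySlope d τ n x y| ≤ (n : ℝ) + 1 := by
  rw [quadPenaltySlope, abs_mul, abs_div, abs_of_nonneg (Real.sqrt_nonneg _),
    abs_of_nonneg (by positivity : (0:ℝ) ≤ (n : ℝ) + 1)]
  exact mul_le_of_le_one_right (by positivity)
    (div_le_one_of_le₀ (le_sqrt_sq_add _ _) (Real.sqrt_nonneg _))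

lemma half_le_mul_quadPenaltySlope {N : ℕ} {d : Space N → ℝ} {τ : ℕ → ℝ} {n : ℕ} {x y : Space N}
    {ε : ℝ} (hτ : 0 < τ n) (hε : ε ^ 2 = 1) (h : τ n < ε * (d x - d y)) :
    ((n : ℝ) + 1) / 2 ≤ ε * quadPenaltySlope d τ n x y := by
  have h1 := half_le_div_sqrt hτ h
  rw [mul_pow, hε, one_mul] at h1
  have h2 := mul_le_mul_of_nonneg_left h1 (by positivity : (0:ℝ) ≤ (n : ℝ) + 1)
  rw [quadPenaltySlope]
  calc _ = ((n : ℝ) + 1) * (1 / 2) := by ring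
    _ ≤ _ := h2
    _ = _ := by ring

/-- Comparison when the Hamiltonian is Lipschitz and, near the boundary, dominated by its normal
component. -/
lemma not_gap_of_isDominated {N : ℕ} {Ω : Set (Space N)} {μ : Space N → Measure (Space N)}
    {j : Space N → Space N → Space N} {σ Cj Λ : ℝ} {ρ : Space N → Space N → ℝ}
    {H : Space N → Space N → ℝ} {u v : Space N → ℝ} {K m : ℝ} {x₀ : Space N}
    (h : IsJumpOperator Ω μ j σ Cj ρ Λ) (hΩ : IsOpen Ω) (hO : DomainClassW2Infty Ω)
    (hu : IsViscositySubsolution Ω μ j Cj H u) (hv : IsViscositySupersolution Ω μ j Cj H v)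
    (hK : 1 ≤ K) (huK : ∀ x ∈ closure Ω, |u x| ≤ K) (hvK : ∀ x ∈ closure Ω, |v x| ≤ K)
    (hx₀ : x₀ ∈ closure Ω) (hm : 0 < m) (hmu : m ≤ u x₀ - v x₀) {B C : ℝ} (hB : 0 ≤ B)
    (hC : 0 ≤ C) {ω : ℝ → ℝ} (hω : IsModulus ω)
    (hH : ∀ x ∈ closure Ω, ∀ y ∈ closure Ω, ∀ p q,
      H y p - H x q ≤ C * ‖x - y‖ * ‖p‖ + B * ‖p - q‖ + ω ‖x - y‖)
    (hdom : ∀ x₁ ∈ frontier Ω, ∀ r L d, IsLocalDistance Ω x₁ r L d →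
      ∃ c > 0, ∃ r' > 0, r' ≤ r ∧
        IsDominated Ω H x₁ d B 1 c r' ∧ IsDominated Ω H x₁ d B (-1) c r') : False := by
  have hσ := h.order_pos
  have hσ1 := h.order_lt_one
  have hΛ := h.one_le
  have hM := kernelMass_nonneg N σ
  obtain ⟨l, hl, hl1, hlσ, hls⟩ := exists_small_parameter (s := m / 16)
    (e := m / 16) (σ := σ) (200 * K * Λ * Λ * kernelMass N σ) (B * (44 * K))
    (by positivity) (by positivity) hσ
  obtain ⟨x₁, r, L, d, W, G, hd, hQ, hW, hG, hdoub⟩ := exists_localized_doubling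
    (Q := fun x₁ r d => (∀ x, d x = 1) ∨ ∃ c > 0, ∀ ε : ℝ, ε = 1 ∨ ε = -1 →
      IsDominated Ω H x₁ d B ε c r)
    (fun x₁ hx₁ => by
      obtain ⟨r, L, d, hd, hd1 | hf⟩ := exists_isLocalDistance h.dim_pos hΩ hO hx₁
      · exact ⟨r, L, d, hd, Or.inl hd1⟩
      · obtain ⟨c, hc, r', hr', hle, h1, h2⟩ := hdom x₁ hf r L d hd
        refine ⟨r', L, d, hd.mono hr' hle, Or.inr ⟨c, hc, ?_⟩⟩
        rintro ε (rfl | rfl)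
        · exact h1
        · exact h2)
    hu.2.1 hv.2.1 hK huK hvK hx₀ hm hmu hl hl1
  set τ : ℕ → ℝ := fun n => smoothScale σ ((n : ℝ) + 1) with hτdef
  have hτ : ∀ n, 0 < τ n := fun n => smoothScale_pos (by positivity)
  obtain ⟨ns, x, y, xs, hdb⟩ := hdoub _ (isPenalization_quadPenalty hd hτ)
  have hinv := tendsto_inv_scale hdb.strictMono
  have hsc : ∀ k, (ns k : ℝ) + 1 = scale ns k := fun k => rfl
  have hxc := hdb.left_mem
  have hyc := hdb.right_mem
  have hnxy : Tendsto (fun k => scale ns k * ‖x k - y k‖) atTop (𝓝 0) := by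
    have h0 := (Real.continuous_sqrt.tendsto' 0 0 Real.sqrt_zero).comp hdb.tendsto_penalization
    refine squeeze_zero (fun k => mul_nonneg (scale_pos ns k).le (norm_nonneg _)) (fun k => ?_) h0
    refine Real.le_sqrt_of_sq_le ?_
    have h1 := self_le_sqrt_sq_add (d (x k) - d (y k)) (τ (ns k))
    have h2 : 0 ≤ scale ns k * (√((d (x k) - d (y k)) ^ 2 + τ (ns k) ^ 2) - τ (ns k)) :=
      mul_nonneg (scale_pos ns k).le (by linarith)
    show _ ≤ quadPenalty d τ (ns k) (x k) (y k)
    unfold quadPenalty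
    rw [hsc, mul_pow]
    linarith
  have hnyx : Tendsto (fun k => scale ns k * ‖y k - x k‖) atTop (𝓝 0) := by
    simpa only [norm_sub_rev] using hnxy
  have hxy : Tendsto (fun k => ‖x k - y k‖) atTop (𝓝 0) :=
    squeeze_zero (fun k => norm_nonneg _)
      (fun k => le_mul_of_one_le_left (norm_nonneg _) (one_le_scale ns k)) hnxy
  have hxs := hW hdb.limit_mem'
  have hreg := isRegularPenalization_quadPenalty hd hτ hl hxc hyc hdb.tendsto_left
    hdb.tendsto_right hxs hnxy
  have hreg' := isRegularPenalization_quadPenalty hd hτ hl hyc hxc hdb.tendsto_right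
    hdb.tendsto_left hxs hnyx
  have hWx := hdb.tendsto_left.eventually_mem (hG.isOpen.mem_nhds hdb.limit_mem')
  have hWy := hdb.tendsto_right.eventually_mem (hG.isOpen.mem_nhds hdb.limit_mem')
  have hKl : 22 * K * l ≤ 22 * K := mul_le_of_le_one_right (by positivity) hl1
  -- Near an interior point `d` is constant. Near the boundary, a larger difference gives a
  -- component of at least `n/2` along `ε∇d`, `ε = ±1`, and domination contradicts the `n^σ` bound
  -- for the subsolution at `x` or for the supersolution at `y`.
  have hclose : ∀ᶠ k in atTop, |d (x k) - d (y k)| ≤ smoothScale σ (scale ns k) := by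
    obtain hd1 | ⟨c, hc, hcd⟩ := hQ
    · refine Eventually.of_forall fun k => ?_
      rw [hd1, hd1, sub_self, abs_zero]
      exact (smoothScale_pos (scale_pos ns k)).le
    set C₀ : ℝ := 2 * K + 200 * K * Λ * Λ * kernelMass N σ
    have hv' := hv.neg
    filter_upwards [eventually_hamiltonian_le h hu hK huK hl hl1 hG hreg hxc
      hdb.tendsto_left hdb.limit_mem' (fun k q hq => by
        have := hdb.isMax k q hq (y k) (hyc k)
        linarith),
      eventually_hamiltonian_le h hv' hK
        (fun x hx => by rw [abs_neg]; exact hvK x hx) hl hl1 hG hreg' hyc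
      hdb.tendsto_right hdb.limit_mem' (fun k q hq => by
        have := hdb.isMax k (x k) (hxc k) q hq
        rw [quadPenalty_comm _ _ _ q, quadPenalty_comm _ _ _ (y k)]
        linarith), hWx, hWy,
      (tendsto_scale hdb.strictMono).eventually (eventually_mul_rpow_add_lt
        C₀ (B * (1 + 22 * K)) hσ hσ1 (by positivity : 0 < c / 4)),
      (hnxy.const_mul (2 * B)).eventually_lt_const
        (show 2 * B * 0 < c / 4 by rw [mul_zero]; positivity)] with k h1 h2 hx hy h4 h5
    have hgx := (hG.norm_gradient_le _ hx (hxc k)).trans hKl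
    have hgy := (hG.norm_gradient_le _ hy (hyc k)).trans hKl
    have hn := scale_pos ns k
    rw [Real.rpow_one] at h4
    have hcontra : ∀ ε : ℝ, ε = 1 ∨ ε = -1 → ¬ (τ (ns k) < ε * (d (x k) - d (y k))) := by
      intro ε hε hlt
      have hε2 : ε ^ 2 = 1 := by rcases hε with rfl | rfl <;> norm_num
      have hslope := half_le_mul_quadPenaltySlope (hτ (ns k)) hε2 hlt
      rw [hsc] at hslope
      set s := ε * quadPenaltySlope d τ (ns k) (x k) (y k) with hs
      have hεs : quadPenaltySlope d τ (ns k) (x k) (y k) = ε * s := by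
        rw [hs, ← mul_assoc, ← sq, hε2, one_mul]
      have hs0 : 0 ≤ s := by linarith
      have hcs : c * (scale ns k / 2) ≤ c * s := by gcongr
      -- The quadratic part of the gradient is `2n · (n‖x - y‖) = o(n)`, so it cannot compensate the
      -- component along `∇d`.
      have hq : ∀ g : Space N, ‖g‖ ≤ 22 * K →
          B * (1 + ‖(2 * scale ns k ^ 2) • (x k - y k) + g‖) <
            c / 4 * scale ns k + B * (1 + 22 * K) := by
        intro g hg
        have h6 : ‖(2 * scale ns k ^ 2) • (x k - y k) + g‖ ≤
            2 * scale ns k * (scale ns k * ‖x k - y k‖) + 22 * K := by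
          refine (norm_add_le _ _).trans (add_le_add ?_ hg)
          rw [norm_smul, Real.norm_of_nonneg (by positivity)]
          exact le_of_eq (by ring)
        have h7 := mul_le_mul_of_nonneg_left h6 hB
        have h8 : 2 * B * (scale ns k * ‖x k - y k‖) * scale ns k < c / 4 * scale ns k := by
          gcongr
        linarith
      rcases hcd ε hε with hlow | hup
      · have h6 := hlow _ (hW hx) (hxc k) s hs0
          ((2 * scale ns k ^ 2) • (x k - y k) + gradient G (x k))
        have e : quadPenaltyGrad d τ (ns k) (x k) (y k) + gradient G (x k) =
            (ε * s) • gradient d (x k) +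
              ((2 * scale ns k ^ 2) • (x k - y k) + gradient G (x k)) := by
          rw [quadPenaltyGrad, hεs, hsc]; abel
        rw [e] at h1
        have h7 := hq _ hgx
        linarith
      · have h6 := hup _ (hW hy) (hyc k) s hs0
          ((2 * scale ns k ^ 2) • (x k - y k) + -gradient G (y k))
        have e : -(quadPenaltyGrad d τ (ns k) (y k) (x k) + gradient G (y k)) =
            (ε * s) • gradient d (y k) +
              ((2 * scale ns k ^ 2) • (x k - y k) + -gradient G (y k)) := by
          rw [quadPenaltyGrad, quadPenaltySlope_swap, hεs, hsc, ← neg_sub (x k), smul_neg, neg_smul]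
          abel
        rw [e] at h2
        have h7 := hq _ (by rw [norm_neg]; exact hgy)
        linarith
    have hp := not_lt.1 (hcontra 1 (Or.inl rfl))
    have hm := not_lt.1 (hcontra (-1) (Or.inr rfl))
    rw [abs_le]
    have : τ (ns k) = smoothScale σ (scale ns k) := rfl
    constructor <;> linarith
  obtain ⟨C₁, hC₁, hincr⟩ := exists_quadPenalty_incr_le h hd hxs τ
  have hgap := eventually_gap_le h hΩ hO hu hv hK huK hvK hm hl hl1 hd hW hG hdb
    (quadPenalty_comm d τ) hreg hreg' hnxy hclose
    (θ := fun k => C₁ * (scale ns k * ‖x k - y k‖) + (scale ns k)⁻¹)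
    (fun k => by have := scale_pos ns k; positivity)
    (by simpa using (hnxy.const_mul C₁).add hinv)
    (by
      filter_upwards [(hdb.tendsto_left.prodMk_nhds hdb.tendsto_right).eventually hincr,
        hnxy.eventually_lt_const one_pos] with k hk h1 z hxz hyz hz
      have h4 : 0 ≤ (scale ns k)⁻¹ * ‖z‖ :=
        mul_nonneg (inv_nonneg.2 (scale_pos ns k).le) (norm_nonneg z)
      have h5 := hk (hxc k) (hyc k) z hxz hyz (ns k) h1.le (by rw [hsc]; linarith)
      rw [hsc] at h5
      linarith)
  have hωlim : Tendsto (fun k => ω ‖x k - y k‖) atTop (𝓝 0) :=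
    hω.2.2.comp (tendsto_nhdsWithin_iff.2 ⟨hxy, Eventually.of_forall fun k => norm_nonneg _⟩)
  -- Everything in the Hamiltonian difference except the localizer contribution: the Lipschitz drift
  -- is tested against a gradient of size `2n²‖x - y‖ + n + 22K`, and the gradients of `d` at the
  -- two points differ by `L‖x - y‖`, multiplied by a slope at most `n`.
  have hrest : Tendsto (fun k => C * (2 * (scale ns k * ‖x k - y k‖) ^ 2 +
      scale ns k * ‖x k - y k‖ + 22 * K * ‖x k - y k‖) +
      B * (L * (scale ns k * ‖x k - y k‖)) + ω ‖x k - y k‖) atTop (𝓝 0) := by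
    simpa using (((((hnxy.pow 2).const_mul 2).add hnxy).add
      (hxy.const_mul (22 * K))).const_mul C).add ((hnxy.const_mul L).const_mul B) |>.add hωlim
  obtain ⟨k, h1, h2, h3, h4⟩ := (hgap.and ((hrest.eventually_lt_const
    (show 0 < m / 16 by positivity)).and (hWx.and hWy))).exists
  have g1 := hG.norm_gradient_le _ h3 (hxc k)
  have g2 := hG.norm_gradient_le _ h4 (hyc k)
  have hn := scale_pos ns k
  have hsl := abs_quadPenaltySlope_le d τ (ns k) (x k) (y k)
  rw [hsc] at hsl
  set s := quadPenaltySlope d τ (ns k) (x k) (y k) with hs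
  have hdy := hd.norm_le _ (hW h4) (hyc k)
  have eP : -(quadPenaltyGrad d τ (ns k) (y k) (x k) + gradient G (y k)) =
      (2 * scale ns k ^ 2) • (x k - y k) + s • gradient d (y k) - gradient G (y k) := by
    rw [quadPenaltyGrad, quadPenaltySlope_swap, hsc, ← neg_sub (x k), smul_neg, neg_smul]
    abel
  have eQ : quadPenaltyGrad d τ (ns k) (x k) (y k) + gradient G (x k) =
      (2 * scale ns k ^ 2) • (x k - y k) + s • gradient d (x k) + gradient G (x k) := by
    rw [quadPenaltyGrad, hsc]
  rw [eP, eQ] at h1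
  have hP : ‖(2 * scale ns k ^ 2) • (x k - y k) + s • gradient d (y k) - gradient G (y k)‖ ≤
      2 * scale ns k ^ 2 * ‖x k - y k‖ + scale ns k + 22 * K := by
    refine (norm_sub_le _ _).trans (add_le_add ((norm_add_le _ _).trans (add_le_add ?_ ?_))
      (g2.trans hKl))
    · rw [norm_smul, Real.norm_of_nonneg (by positivity)]
    · rw [norm_smul, Real.norm_eq_abs]
      calc _ ≤ scale ns k * 1 := by gcongr
        _ = _ := mul_one _
  have hPQ : ‖(2 * scale ns k ^ 2) • (x k - y k) + s • gradient d (y k) - gradient G (y k) -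
      ((2 * scale ns k ^ 2) • (x k - y k) + s • gradient d (x k) + gradient G (x k))‖ ≤
      L * (scale ns k * ‖x k - y k‖) + 44 * K * l := by
    have e : (2 * scale ns k ^ 2) • (x k - y k) + s • gradient d (y k) - gradient G (y k) -
        ((2 * scale ns k ^ 2) • (x k - y k) + s • gradient d (x k) + gradient G (x k)) =
        s • (gradient d (y k) - gradient d (x k)) - (gradient G (y k) + gradient G (x k)) := by
      rw [smul_sub s]; abel
    rw [e]
    have a1 : ‖s • (gradient d (y k) - gradient d (x k))‖ ≤
        scale ns k * (L * ‖x k - y k‖) := by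
      rw [norm_smul, Real.norm_eq_abs, norm_sub_rev (x k)]
      gcongr
      exact hd.lip _ (hW h4) _ (hW h3)
    have a2 := norm_add_le (gradient G (y k)) (gradient G (x k))
    refine (norm_sub_le _ _).trans ?_
    linarith
  have h5 := hH _ (hxc k) _ (hyc k)
    ((2 * scale ns k ^ 2) • (x k - y k) + s • gradient d (y k) - gradient G (y k))
    ((2 * scale ns k ^ 2) • (x k - y k) + s • gradient d (x k) + gradient G (x k))
  have h6 : C * ‖x k - y k‖ * ‖(2 * scale ns k ^ 2) • (x k - y k) + s • gradient d (y k) -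
      gradient G (y k)‖ ≤ C * ‖x k - y k‖ * (2 * scale ns k ^ 2 * ‖x k - y k‖ + scale ns k +
        22 * K) := by gcongr
  have h7 := mul_le_mul_of_nonneg_left hPQ hB
  nlinarith

/-! ### Comparison -/

lemma IsModulus.exists_forall_le {ω : ℝ → ℝ} (hω : IsModulus ω) {e : ℝ} (he : 0 < e) :
    ∃ δ > 0, ∀ t, 0 ≤ t → t < δ → ω t ≤ e := by
  obtain ⟨δ, hδ, hsub⟩ := Metric.mem_nhdsWithin_iff.1 (hω.2.2.eventually_lt_const he)
  refine ⟨δ, hδ, fun t ht htd => le_of_lt (hsub ⟨?_, ht⟩)⟩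
  rwa [Metric.mem_ball, Real.dist_eq, sub_zero, abs_of_nonneg ht]

lemma gradient_const_mul {N : ℕ} (c : ℝ) (φ : Space N → ℝ) (x : Space N) :
    gradient (fun y => c * φ y) x = c • gradient φ x := by
  have h : fderiv ℝ (c • φ) x = c • fderiv ℝ φ x :=
    congrFun (fderiv_const_smul_field (f := φ) c) x
  unfold gradient
  rw [show (fun y => c * φ y) = c • φ from rfl, h, map_smulₛₗ]
  simp

/-- The operator is linear, so scaling affects only the Hamiltonian. This creates the strict gain
that (Hb) measures. -/
lemma IsViscositySubsolution.const_mul {N : ℕ} {Ω : Set (Space N)}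
    {μ : Space N → Measure (Space N)} {j : Space N → Space N → Space N} {Cj : ℝ}
    {H : Space N → Space N → ℝ} {u : Space N → ℝ}
    (hu : IsViscositySubsolution Ω μ j Cj H u) {θ : ℝ} (hθ : 0 < θ) :
    IsViscositySubsolution Ω μ j Cj (fun x p => θ * H x (θ⁻¹ • p)) (fun x => θ * u x) := by
  obtain ⟨⟨K, hK⟩, husc, hu⟩ := hu
  refine ⟨⟨θ * K, fun x hx => ?_⟩, fun x hx a ha => ?_, fun φ hφ ξ hξ x hx hmax => ?_⟩
  · rw [abs_mul, abs_of_pos hθ]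
    gcongr
    exact hK x hx
  · filter_upwards [husc x hx (a / θ) ((lt_div_iff₀' hθ).2 ha)] with y hy
    exact (lt_div_iff₀' hθ).1 hy
  · have hcancel : ∀ t : ℝ, θ * (θ⁻¹ * t) = t := fun t => mul_inv_cancel_left₀ hθ.ne' t
    have hmax' : IsMaxOn (fun y => u y - θ⁻¹ * φ y)
        (Metric.closedBall x (Cj * ξ) ∩ closure Ω) x := by
      intro y hy
      have h1 : θ * u y - φ y ≤ θ * u x - φ x := hmax hy
      show u y - θ⁻¹ * φ y ≤ u x - θ⁻¹ * φ x
      refine le_of_mul_le_mul_left ?_ hθ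
      rwa [mul_sub, mul_sub, hcancel, hcancel]
    have key := hu (fun y => θ⁻¹ * φ y) (contDiff_const.mul hφ) ξ hξ x hx hmax'
    have hF : testF Ω μ j (fun x p => θ * H x (θ⁻¹ • p)) ξ φ (fun x => θ * u x) x =
        θ * testF Ω μ j H ξ (fun y => θ⁻¹ * φ y) u x := by
      have e1 : innerPart Ω μ j ξ φ x = θ * innerPart Ω μ j ξ (fun y => θ⁻¹ * φ y) x := by
        unfold innerPart
        rw [← integral_const_mul]
        congr 1; ext z; rw [mul_sub, hcancel, hcancel]
      have e2 : outerPart Ω μ j ξ (fun y => θ * u y) x = θ * outerPart Ω μ j ξ u x := by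
        unfold outerPart
        rw [← integral_const_mul]
        congr 1; ext z; rw [mul_sub]
      unfold testF
      rw [e1, e2, gradient_const_mul]
      ring
    have hnd : normalDeriv Ω φ x = θ * normalDeriv Ω (fun y => θ⁻¹ * φ y) x := by
      unfold normalDeriv
      rw [gradient_const_mul, real_inner_smul_left, hcancel]
    refine ⟨fun hxΩ => ?_, fun hxf => ?_⟩
    · rw [hF]
      exact mul_nonpos_of_nonneg_of_nonpos hθ.le (key.1 hxΩ)
    · have := key.2 hxf
      rw [hF, hnd, min_le_iff]
      rw [min_le_iff] at this
      exact this.imp (mul_nonpos_of_nonneg_of_nonpos hθ.le)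
        (mul_nonpos_of_nonneg_of_nonpos hθ.le)

lemma AssumptionH1.const_mul {N : ℕ} {Ω : Set (Space N)} {H : Space N → Space N → ℝ} {σ : ℝ}
    (hH : AssumptionH1 Ω H σ) {θ : ℝ} (hθ : 0 < θ) :
    AssumptionH1 Ω (fun x p => θ * H x (θ⁻¹ • p)) σ := by
  obtain ⟨m, hm, c, hc, D, hD, hH⟩ := hH
  refine ⟨m, hm, θ * (c * θ⁻¹ ^ m), by positivity, θ * D, by positivity, fun x hx p => ?_⟩
  have h1 := mul_le_mul_of_nonneg_left (hH x hx (θ⁻¹ • p)) hθ.le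
  rw [norm_smul, Real.norm_of_nonneg (by positivity), Real.mul_rpow (by positivity)
    (norm_nonneg p)] at h1
  linarith

lemma mul_rpow_sub_one_le {m t k κ e : ℝ} (hm : 1 < m) (ht : 0 ≤ t) (hk : 0 ≤ k)
    (h1 : k * 2 ^ m ≤ κ) (h2 : k * 2 ^ m ≤ e) : k * (t + 1) ^ (m - 1) ≤ κ * t ^ m + e := by
  have h0 : 0 ≤ k * (2:ℝ) ^ m := by positivity
  have h3 : (t + 1) ^ (m - 1) ≤ (t + 1) ^ m :=
    Real.rpow_le_rpow_of_exponent_le (by linarith) (by linarith)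
  have ht' : 0 ≤ t ^ m := Real.rpow_nonneg ht m
  rcases le_total t 1 with h | h
  · have h4 : (t + 1) ^ m ≤ 2 ^ m := Real.rpow_le_rpow (by linarith) (by linarith) (by linarith)
    calc _ ≤ k * 2 ^ m := by gcongr; exact h3.trans h4
      _ ≤ κ * t ^ m + e := by nlinarith [mul_nonneg (h0.trans h1) ht']
  · have h4 : (t + 1) ^ m ≤ 2 ^ m * t ^ m := by
      rw [← Real.mul_rpow (by norm_num) ht]
      exact Real.rpow_le_rpow (by linarith) (by linarith) (by linarith)
    calc _ ≤ k * (2 ^ m * t ^ m) := by gcongr; exact h3.trans h4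
      _ = k * 2 ^ m * t ^ m := by ring
      _ ≤ κ * t ^ m := by gcongr
      _ ≤ _ := by linarith

/-! ### Comparison for the three types of Hamiltonian. -/

section Comparison

variable {N : ℕ} {Ω : Set (Space N)} {μ : Space N → Measure (Space N)}
  {j : Space N → Space N → Space N} {σ Cj Λ : ℝ} {ρ : Space N → Space N → ℝ}
  {H : Space N → Space N → ℝ} {u v : Space N → ℝ} {K : ℝ} {x₀ : Space N}

lemma le_of_isBellman (h : IsJumpOperator Ω μ j σ Cj ρ Λ) (hΩ : IsOpen Ω)
    (hO : DomainClassW2Infty Ω) (hH : IsBellman.{u} Ω H)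
    (hu : IsViscositySubsolution Ω μ j Cj H u) (hv : IsViscositySupersolution Ω μ j Cj H v)
    (hK : 1 ≤ K) (huK : ∀ x ∈ closure Ω, |u x| ≤ K) (hvK : ∀ x ∈ closure Ω, |v x| ≤ K)
    (hx₀ : x₀ ∈ closure Ω) : u x₀ ≤ v x₀ := by
  by_contra! hlt
  obtain ⟨A, _, _, _, b, f, hbc, -, ⟨B, hB⟩, hlub, ⟨ω, hω, hf⟩, ⟨C, hC0, hC⟩, hΓ⟩ := hH
  have hB0 : 0 ≤ B := (norm_nonneg _).trans (hB x₀ hx₀ (Classical.arbitrary A)).1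
  exact not_gap_of_isDominated h hΩ hO hu hv hK huK hvK hx₀ (sub_pos.2 hlt) le_rfl hB0 hC0.le hω
    (fun x hx y hy p q => bellman_sub_le hB hlub hf hC hx hy p q)
    (fun x₁ hx₁ r L d hd => exists_isDominated_of_bellman hd hx₁ hbc hB hlub hC0 hC hΓ)

/-- The term `ω(|x-y|)(1+|p|)` is harmless because `δ` may depend on the radius `R` bounding `p`;
only the Lipschitz constant in `p` must be uniform, and it fixes `s`. -/
lemma le_of_coercive_of_lipschitz (h : IsJumpOperator Ω μ j σ Cj ρ Λ) (hΩ : IsOpen Ω)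
    (hO : DomainClassW2Infty Ω) (hH : AssumptionH1 Ω H σ) (hHa : AssumptionHa Ω H)
    (hu : IsViscositySubsolution Ω μ j Cj H u) (hv : IsViscositySupersolution Ω μ j Cj H v)
    (hK : 1 ≤ K) (huK : ∀ x ∈ closure Ω, |u x| ≤ K) (hvK : ∀ x ∈ closure Ω, |v x| ≤ K)
    (hx₀ : x₀ ∈ closure Ω) : u x₀ ≤ v x₀ := by
  by_contra! hlt
  obtain ⟨C, hC, ω, hω, hHa⟩ := hHa
  set m := u x₀ - v x₀
  have hm : 0 < m := sub_pos.2 hlt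
  refine not_gap_of_coercive h hΩ hO hu hv hK huK hvK hx₀ hm le_rfl hH
    ⟨m / (32 * C), by positivity, fun R => ?_⟩
  obtain ⟨δ, hδ, hωδ⟩ := hω.exists_forall_le (e := m / (32 * (1 + |R|))) (by positivity)
  refine ⟨δ, hδ, fun x hx y hy hxy p q hp hpq => ?_⟩
  have h1 := hHa x hx y hy p q
  have h2 : ω ‖x - y‖ * (1 + ‖p‖) ≤ m / (32 * (1 + |R|)) * (1 + |R|) := by
    gcongr
    · exact hωδ _ (norm_nonneg _) hxy
    · exact hp.trans (le_abs_self R)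
  have h3 : C * ‖p - q‖ ≤ C * (m / (32 * C)) := by gcongr
  have e2 : m / (32 * (1 + |R|)) * (1 + |R|) = m / 32 := by
    have : 1 + |R| ≠ 0 := by positivity
    field_simp
  have e3 : C * (m / (32 * C)) = m / 32 := by field_simp
  linarith

/-- The difference splits as `H(y,p) - H(x,q)` plus `H(x,q) - θ H(x, q/θ)` with `θ = 1 - η`. The
second part gains `-κ|q|^n`, which absorbs the error `C|p-q|(|q|+1)^(n-1)` of the first once `|p-q|
≤ s` is small relative to `η`. -/
lemma le_of_coercive_of_convex (h : IsJumpOperator Ω μ j σ Cj ρ Λ) (hΩ : IsOpen Ω)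
    (hO : DomainClassW2Infty Ω) (hH : AssumptionH1 Ω H σ) {n : ℝ} (hHb : AssumptionHb Ω H n)
    (hHc : AssumptionHc Ω H n)
    (hu : IsViscositySubsolution Ω μ j Cj H u) (hv : IsViscositySupersolution Ω μ j Cj H v)
    (hK : 1 ≤ K) (huK : ∀ x ∈ closure Ω, |u x| ≤ K) (hvK : ∀ x ∈ closure Ω, |v x| ≤ K)
    (hx₀ : x₀ ∈ closure Ω) : u x₀ ≤ v x₀ := by
  by_contra! hlt
  obtain ⟨hn, A, hA, C', hC', hHb⟩ := hHb
  obtain ⟨C, hC, ω, hω, hHc⟩ := hHc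
  set m := u x₀ - v x₀ with hmdef
  have hm : 0 < m := sub_pos.2 hlt
  have hK0 : 0 < K := by linarith
  -- In turn: `θ` stays positive, the gap remains at least `m / 2` after scaling `u`, and the
  -- additive loss `ηA` is negligible.
  set η : ℝ := min (1 / 2) (min (m / (2 * K)) (m / (128 * A))) with hη
  have hη0 : 0 < η := by positivity
  have hη1 : η ≤ 1 / 2 := min_le_left _ _
  have hηK : η * K ≤ m / 2 := by
    have : η ≤ m / (2 * K) := (min_le_right _ _).trans (min_le_left _ _)
    rw [le_div_iff₀ (by positivity)] at this
    linarith
  have hηA : η * A ≤ m / 128 := by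
    have : η ≤ m / (128 * A) := (min_le_right _ _).trans (min_le_right _ _)
    rw [le_div_iff₀ (by positivity)] at this
    linarith
  have hθ : 0 < 1 - η := by linarith
  have hgap : m / 2 ≤ (1 - η) * u x₀ - v x₀ := by
    have h1 : η * u x₀ ≤ η * K := by gcongr; exact (abs_le.1 (huK x₀ hx₀)).2
    linarith
  set κ : ℝ := η * (C' * (n - 1)) with hκ
  have hκ0 : 0 < κ := mul_pos hη0 (mul_pos hC' (by linarith))
  -- `s ≤ 1` makes the norms of `p` and `q` comparable up to `1`. The other bound is what
  -- `mul_rpow_sub_one_le` needs, `2^n` coming from `t + 1 ≤ 2 max(t,1)`.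
  set s : ℝ := min 1 (min κ (m / 128) / (C * 2 ^ n)) with hs
  have hs0 : 0 < s := by positivity
  have hs1 : s ≤ 1 := min_le_left _ _
  have hCs : C * s * 2 ^ n ≤ min κ (m / 128) := by
    have : s ≤ min κ (m / 128) / (C * 2 ^ n) := min_le_right _ _
    rw [le_div_iff₀ (by positivity)] at this
    linarith
  refine not_gap_of_coercive h hΩ hO (hu.const_mul hθ) hv hK (fun x hx => ?_) hvK hx₀
    (half_pos hm) hgap (hH.const_mul hθ) ⟨s, hs0, fun R => ?_⟩
  · rw [abs_mul, abs_of_pos hθ]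
    exact (mul_le_of_le_one_left (abs_nonneg _) (by linarith)).trans (huK x hx)
  obtain ⟨δ, hδ, hωδ⟩ := hω.exists_forall_le (e := m / (128 * (1 + (|R| + 1) ^ n)))
    (by positivity)
  refine ⟨δ, hδ, fun x hx y hy hxy p q hp hpq => ?_⟩
  have hpR : ‖p‖ ≤ |R| := hp.trans (le_abs_self R)
  have hqp : ‖q‖ ≤ ‖p‖ + 1 := by
    have := norm_sub_norm_le q p
    rw [norm_sub_rev] at this
    linarith
  have hpq' : ‖p‖ ≤ ‖q‖ + 1 := by
    have := norm_sub_norm_le p q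
    linarith
  have h1 := hHc x hx y hy p q
  have h2 := hHb (1 - η) hθ (by linarith) x hx q
  rw [sub_sub_cancel] at h2
  have h3 : ω ‖x - y‖ * (1 + max (‖p‖ ^ n) (‖q‖ ^ n)) ≤
      m / (128 * (1 + (|R| + 1) ^ n)) * (1 + (|R| + 1) ^ n) := by
    refine mul_le_mul (hωδ _ (norm_nonneg _) hxy) ?_ (by positivity) (by positivity)
    gcongr
    exact max_le (Real.rpow_le_rpow (norm_nonneg _) (by linarith) (by linarith))
      (Real.rpow_le_rpow (norm_nonneg _) (by linarith) (by linarith))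
  have e3 : m / (128 * (1 + (|R| + 1) ^ n)) * (1 + (|R| + 1) ^ n) = m / 128 := by
    have : 1 + (|R| + 1) ^ n ≠ 0 := by positivity
    field_simp
  have h4 : C * ‖p - q‖ * max (‖p‖ ^ (n - 1)) (‖q‖ ^ (n - 1)) ≤ C * s * (‖q‖ + 1) ^ (n - 1) := by
    refine mul_le_mul (by gcongr) ?_ (by positivity) (by positivity)
    exact max_le (Real.rpow_le_rpow (norm_nonneg _) hpq' (by linarith))
      (Real.rpow_le_rpow (norm_nonneg _) (by linarith) (by linarith))
  have h5 := mul_rpow_sub_one_le hn (norm_nonneg q) (by positivity : 0 ≤ C * s)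
    (hCs.trans (min_le_left _ _)) (hCs.trans (min_le_right _ _))
  have h6 : η * (C' * (1 - n) * ‖q‖ ^ n + A) = -(κ * ‖q‖ ^ n) + η * A := by rw [hκ]; ring
  -- Three errors of at most `m / 128` fit into the allowed `(m / 2) / 16 = m / 32`.
  show H y p - (1 - η) * H x ((1 - η)⁻¹ • q) ≤ _
  linarith

end Comparison

end CensoredNeumann

theorem theorem3p1 {N : ℕ} (hN : 0 < N)
    (Ω : Set (Space N)) (hΩ : IsOpen Ω)
    (hO : DomainClassW2Infty Ω)
    (μ : Space N → Measure (Space N)) (σ : ℝ)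
    (hM : AssumptionM Ω μ σ)
    (j : Space N → Space N → Space N) (Cj : ℝ)
    (hJ0 : AssumptionJ0 Ω j)
    (hJ1 : AssumptionJ1 Ω j Cj)
    (H : Space N → Space N → ℝ)
    (hHcont : ContinuousOn (Function.uncurry H) (closure Ω ×ˢ univ))
    (hH : IsBellman.{u} Ω H ∨
      (AssumptionH1 Ω H σ ∧ AssumptionHa Ω H) ∨
      (AssumptionH1 Ω H σ ∧
        ∃ m : ℝ, AssumptionHb Ω H m ∧ AssumptionHc Ω H m))
    (u v : Space N → ℝ)
    (hu : IsViscositySubsolution Ω μ j Cj H u)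
    (hv : IsViscositySupersolution Ω μ j Cj H v) :
    ∀ x ∈ closure Ω, u x ≤ v x := by
  obtain ⟨ρ, Λ, h⟩ := exists_isJumpOperator hN hM hJ0 hJ1
  obtain ⟨Ku, hKu⟩ := hu.1
  obtain ⟨Kv, hKv⟩ := hv.1
  intro x₀ hx₀
  have hK : 1 ≤ max 1 (max Ku Kv) := le_max_left _ _
  have huK : ∀ x ∈ closure Ω, |u x| ≤ max 1 (max Ku Kv) := fun x hx =>
    (hKu x hx).trans ((le_max_left _ _).trans (le_max_right _ _))
  have hvK : ∀ x ∈ closure Ω, |v x| ≤ max 1 (max Ku Kv) := fun x hx =>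
    (hKv x hx).trans ((le_max_right _ _).trans (le_max_right _ _))
  rcases hH with hH | ⟨hH1, hHa⟩ | ⟨hH1, m, hHb, hHc⟩
  · exact le_of_isBellman h hΩ hO hH hu hv hK huK hvK hx₀
  · exact le_of_coercive_of_lipschitz h hΩ hO hH1 hHa hu hv hK huK hvK hx₀
  · exact le_of_coercive_of_convex h hΩ hO hH1 hHb hHc hu hv hK huK hvK hx₀
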